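/- **Setting.** For strings $x,y$ with $|x|\ge |y|$ put $n(x,y)=|x|$ and $m(x,y)=|y|$. Let $L(x,y)$ be the length of a longest common subsequence (LCS) of $x,y$, and put $\delta=m-L$, $\Delta=n-L$. Let $|\Sigma|(x,y)$ be the number of symbols that occur in both $x$ and $y$, and let $M(x,y)=\#\{(i,j): x[i]=y[j]\}$. Let $d(x,y)$ be the number of dominant pairs, that is, of pairs $(i,j)$ with $1\le i\le |x|$, $1\le j\le |y|$, $L[i,j]>L[i-1,j]$ and $L[i,j]>L[i,j-1]$, where $L[i,j]=L(x[1..i],y[1..j])$. Let $\mathcal P=\{m,L,\delta,\Delta,|\Sigma|,M,d\}$. Throughout, $|x|\ge|y|$ and every symbol of the alphabet $\{0,\dots,s-1\}$ (where $s$ depends on the instance) occurs in both $x$ and $y$. A *parameter setting* is a vector $\alpha=(\alpha_p)_{p\in\mathcal P}$ of reals $\alpha_p\ge 0$. For $\gamma\ge 1$: - $\mathrm{LCS}^\gamma(\alpha)$ is the problem of computing $L(x,y)$ for strings $x,y$ with $n^{\alpha_p}/\gamma\le p(x,y)\le \gamma n^{\alpha_p}$ for all $p\in\mathcal P$, where $n=|x|$.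 - Its *downward closure* $\mathrm{LCS}_\le^\gamma(\alpha)$ is the problem of computing $L(x,y)$ for a given triple $(n,x,y)$ with $n\in\mathbb N$, $|x|\le\gamma n$ and $p(x,y)\le\gamma n^{\alpha_p}$ for all $p\in\mathcal P$. The setting $\alpha$ is *non-trivial* if for some $\gamma\ge1$ the problem $\mathrm{LCS}^\gamma(\alpha)$ has infinitely many instances. An *algorithm* is a program of a word RAM whose words have $O(\log n)$ bits: it has unit-cost arithmetic and bitwise operations and indirect addressing, and all occurring words are bounded by a fixed polynomial in $n$. It is an *$O(n^\beta)$-time algorithm* for a problem if it solves every instance with parameter $n$ in at most $C\max(n,1)^\beta$ steps, for a constant $C$. **Lemma (Monotonicity).** Let $\alpha$ be a non-trivial parameter setting and let $\beta\ge 1$ be real. 1. If $\mathrm{LCS}_\le^\gamma(\alpha)$ has an $O(n^\beta)$-time algorithm for all $\gamma\ge1$, then $\mathrm{LCS}^\gamma(\alpha)$ has an $O(n^\beta)$-time algorithm for all $\gamma\ge1$. 2. Suppose that for each $p\in\mathcal P$ the target value $n^{\alpha_p}$ can be computed from $n$ up to a constant factor in time $O(n^\beta)$; that is, some $f_p:\mathbb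 N\to\mathbb N$ with $f_p(n)=\Theta(n^{\alpha_p})$ is computable in time $O(n^\beta)$. Then $\mathrm{LCS}^\gamma(\alpha)$ has an $O(n^\beta)$-time algorithm for all $\gamma\ge1$ if and only if $\mathrm{LCS}_\le^\gamma(\alpha)$ has an $O(n^\beta)$-time algorithm for all $\gamma\ge1$. -/

import Mathlib

namespace LCSMono

/-! ### Strings and their parameters -/

/-- Lengths of common (not necessarily contiguous) subsequences of two strings. -/
def commonSubseqLengths (x y : List ℕ) : Set ℕ :=
  {k | ∃ z : List ℕ, z.Sublist x ∧ z.Sublist y ∧ z.length = k}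

/-- `|LCS(x, y)|`, the length of a longest common subsequence. -/
noncomputable def lcsLen (x y : List ℕ) : ℕ := sSup (commonSubseqLengths x y)

theorem lcsLen_isGreatest (x y : List ℕ) :
    IsGreatest (commonSubseqLengths x y) (lcsLen x y) := by
  have hne : (commonSubseqLengths x y).Nonempty :=
    ⟨0, [], List.nil_sublist x, List.nil_sublist y, rfl⟩
  have hbdd : BddAbove (commonSubseqLengths x y) :=
    ⟨x.length, fun k ⟨_, hx, _, hk⟩ => hk ▸ hx.length_le⟩
  exact ⟨Nat.sSup_mem hne hbdd, fun k hk => le_csSup hbdd hk⟩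

/-- The entry `L[i, j] = |LCS(x[1..i], y[1..j])|` of the dynamic programming table. -/
noncomputable def table (x y : List ℕ) (i j : ℕ) : ℕ := lcsLen (x.take i) (y.take j)

/-- The number of symbols that occur both in `x` and in `y`. -/
def alphabetSize (x y : List ℕ) : ℕ := (x.toFinset ∩ y.toFinset).card

/-- The number of matching pairs `(i, j)`, that is, `x[i] = y[j]`. -/
def matchingPairs (x y : List ℕ) : ℕ :=
  (Finset.univ.filter fun q : Fin x.length × Fin y.length => x.get q.1 = y.get q.2).card

/-- The number of dominant pairs: `L[i, j] > L[i-1, j]` and `L[i, j] > L[i, j-1]`,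
for `1 ≤ i ≤ |x|` and `1 ≤ j ≤ |y|`. -/
noncomputable def dominantPairs (x y : List ℕ) : ℕ :=
  ((Finset.Icc 1 x.length ×ˢ Finset.Icc 1 y.length).filter fun q : ℕ × ℕ =>
    table x y (q.1 - 1) q.2 < table x y q.1 q.2 ∧
      table x y q.1 (q.2 - 1) < table x y q.1 q.2).card

/-- The seven parameters `m, L, δ, Δ, |Σ|, M, d`. -/
inductive Param where
  | m
  | L
  | smallDelta
  | bigDelta
  | sigma
  | M
  | d

/-- The value `p(x, y)` of a parameter; `x` is the longer string. -/
noncomputable def Param.val (p : Param) (x y : List ℕ) : ℕ :=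
  match p with
  | .m => y.length
  | .L => lcsLen x y
  | .smallDelta => y.length - lcsLen x y
  | .bigDelta => x.length - lcsLen x y
  | .sigma => alphabetSize x y
  | .M => matchingPairs x y
  | .d => dominantPairs x y

/-- The standing conventions on a pair of strings: `x` is the longer one, and every symbol of the
alphabet occurs both in `x` and in `y`. The alphabet is `{0, …, s - 1}`, where `s` is its size. -/
def IsStringPair (x y : List ℕ) : Prop :=
  y.length ≤ x.length ∧ ∃ s : ℕ, (∀ a, a ∈ x ↔ a < s) ∧ (∀ a, a ∈ y ↔ a < s)

/-! ### The word RAM -/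

/-- The binary word operations (subtraction is truncated at zero, `div` and `mod` are Euclidean). -/
inductive BinOp where
  | add
  | sub
  | mul
  | div
  | mod
  | and
  | or
  | xor
  | shl
  | shr

/-- Semantics of the word operations on natural numbers. -/
def BinOp.eval (o : BinOp) (a b : ℕ) : ℕ :=
  match o with
  | .add => a + b
  | .sub => a - b
  | .mul => a * b
  | .div => a / b
  | .mod => a % b
  | .and => a &&& b
  | .or => a ||| b
  | .xor => a ^^^ b
  | .shl => a <<< b
  | .shr => a >>> b

/-- Instructions. Arguments that name registers and jump targets are constants of the program. -/
inductive Instr where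
  /-- register `i` becomes the constant `c` -/
  | const (i c : ℕ)
  /-- register `i` becomes the value of `o` on registers `j` and `k` -/
  | op (o : BinOp) (i j k : ℕ)
  /-- register `i` becomes the content of the memory cell addressed by register `j` -/
  | load (i j : ℕ)
  /-- the memory cell addressed by register `i` becomes the content of register `j` -/
  | store (i j : ℕ)
  /-- jump to instruction `l` if register `i` is zero -/
  | jz (i l : ℕ)

/-- A program is a finite list of instructions. -/
abbrev Program := List Instr

/-- A configuration: program counter, registers, memory. -/
structure Config where
  pc : ℕ
  reg : ℕ → ℕ
  mem : ℕ → ℕ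

/-- The effect of one instruction. -/
def Instr.exec (ins : Instr) (c : Config) : Config :=
  match ins with
  | .const i v => ⟨c.pc + 1, Function.update c.reg i v, c.mem⟩
  | .op o i j k => ⟨c.pc + 1, Function.update c.reg i (o.eval (c.reg j) (c.reg k)), c.mem⟩
  | .load i j => ⟨c.pc + 1, Function.update c.reg i (c.mem (c.reg j)), c.mem⟩
  | .store i j => ⟨c.pc + 1, c.reg, Function.update c.mem (c.reg i) (c.reg j)⟩
  | .jz i l => ⟨if c.reg i = 0 then l else c.pc + 1, c.reg, c.mem⟩

/-- One step; the machine has halted once the program counter is outside the program. -/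
def step (P : Program) (c : Config) : Config :=
  match P[c.pc]? with
  | some ins => ins.exec c
  | none => c

/-- The initial configuration: the input stands in memory cells `0, 1, 2, …`; all other cells and
all registers are zero. -/
def initial (input : List ℕ) : Config := ⟨0, fun _ => 0, fun a => input.getD a 0⟩

/-- The configuration after `t` steps on a given input. -/
def run (P : Program) (input : List ℕ) (t : ℕ) : Config := (step P)^[t] (initial input)

/-- All words of the configuration are at most `B`. -/
def Config.WordsLE (c : Config) (B : ℕ) : Prop := (∀ i, c.reg i ≤ B) ∧ ∀ a, c.mem a ≤ B

/-- A computational problem: instances with a size, an encoding as a sequence of words,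
and the correct answer. -/
structure Problem where
  Inst : Type
  size : Inst → ℕ
  input : Inst → List ℕ
  answer : Inst → ℕ

/-- `Q` has an `O(n ^ β)`-time algorithm: one program that, on every instance of size `n`, halts
within `O(n ^ β)` steps with the answer in register `0`, while all words that ever occur are
bounded by a fixed polynomial in `n` (words of `O(log n)` bits). Reading `n` as `max n 1`
concerns instances of size zero only. -/
def HasAlgorithm (Q : Problem) (β : ℝ) : Prop :=
  ∃ (P : Program) (C k : ℕ), ∀ I : Q.Inst, ∃ t : ℕ,
    (t : ℝ) ≤ C * (max (Q.size I) 1 : ℕ) ^ β ∧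
    P.length ≤ (run P (Q.input I) t).pc ∧
    (run P (Q.input I) t).reg 0 = Q.answer I ∧
    ∀ s ≤ t, (run P (Q.input I) s).WordsLE (C * (max (Q.size I) 1) ^ k)

/-! ### Parameter settings -/

/-- The instances `(x, y)` of `LCS^γ(α)`, where `n = |x|`. -/
def exactInstances (γ : ℝ) (α : Param → ℝ) : Set (List ℕ × List ℕ) :=
  {I | IsStringPair I.1 I.2 ∧ ∀ p : Param,
    (I.1.length : ℝ) ^ α p / γ ≤ p.val I.1 I.2 ∧ (p.val I.1 I.2 : ℝ) ≤ (I.1.length : ℝ) ^ α p * γ}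

/-- The problem `LCS^γ(α)`. -/
noncomputable def exactLCS (γ : ℝ) (α : Param → ℝ) : Problem where
  Inst := exactInstances γ α
  size I := I.1.1.length
  input I := I.1.1.length :: I.1.2.length :: (I.1.1 ++ I.1.2)
  answer I := lcsLen I.1.1 I.1.2

/-- The instances `(n, x, y)` of the downward closure `LCS_≤^γ(α)`. The first bound is the one for
the parameter `n(x, y) = |x|`, whose exponent is `1`. -/
def closureInstances (γ : ℝ) (α : Param → ℝ) : Set (ℕ × List ℕ × List ℕ) :=
  {I | IsStringPair I.2.1 I.2.2 ∧ (I.2.1.length : ℝ) ≤ γ * I.1 ∧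
    ∀ p : Param, (p.val I.2.1 I.2.2 : ℝ) ≤ γ * (I.1 : ℝ) ^ α p}

/-- The problem `LCS_≤^γ(α)`; the size of an instance `(n, x, y)` is `n`. -/
noncomputable def closureLCS (γ : ℝ) (α : Param → ℝ) : Problem where
  Inst := closureInstances γ α
  size I := I.1.1
  input I := I.1.1 :: I.1.2.1.length :: I.1.2.2.length :: (I.1.2.1 ++ I.1.2.2)
  answer I := lcsLen I.1.2.1 I.1.2.2

/-- `α` is non-trivial: for some `γ ≥ 1`, `LCS^γ(α)` has infinitely many instances. -/
def NonTrivial (α : Param → ℝ) : Prop :=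
  ∃ γ : ℝ, 1 ≤ γ ∧ (exactInstances γ α).Infinite

/-- Given `n`, some number `f n = Θ(n ^ a)` can be computed in time `O(n ^ β)`. -/
def PowerComputable (β a : ℝ) : Prop :=
  ∃ f : ℕ → ℕ,
    (∃ c : ℝ, 1 ≤ c ∧ ∀ n : ℕ, 1 ≤ n → (n : ℝ) ^ a / c ≤ f n ∧ (f n : ℝ) ≤ c * (n : ℝ) ^ a) ∧
    HasAlgorithm ⟨ℕ, fun n => n, fun n => [n], f⟩ β

end LCSMono

/-! Part 1 is immediate: since γ ≥ 1, an exact instance (x, y) is the instance (|x|, x, y) of the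
closure with the same γ.

For the converse in part 2, a closure instance is padded. All seven parameters are additive when
pairs over disjoint alphabets are concatenated (`Param.val_glue`). So it suffices to have, for every
N ≥ 1, a pair of padding strings of length Θ(N) whose parameters are Θ(N^α_p) and whose LCS length
is known exactly. Placed before (x, y), it gives an instance of LCS^γ'(α) with γ' independent of the
instance (`exists_exact_of_closure`), and L(x, y) is a difference of two numbers. As γ' may exceed
γ, the exact problem must be solvable for all γ.

Paddings exist because α is non-trivial. General inequalities such as d ≤ M, L² ≤ |Σ|·M, d ≤ 2m(Δ+1)
and d ≤ L²|Σ| hold for all string pairs considered; on arbitrarily long instances of the exact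
problem they become linear inequalities between the exponents (`feasible_of_nonTrivial`).
Conversely, these inequalities let four blocks attain all targets without overshooting any
(`padOf_bounds`): - 0 1^a against 1 0^b, with LCS length 1, gives δ and Δ; - 0^R (0 1 … t-1)^S
against S ascending or S descending runs of the same symbols gives L and d; - 0 1 … k-1 against
itself or its reversal gives |Σ|; - a unary pair gives M if α_L < 1; otherwise the main block
already does. No block is needed for m and n, because m = L + δ and n = L + Δ.

The given programs must finally run inside one RAM program. Registers and memory are interleaved
modulo 9: a driver owns class 0 of the registers, and each subprogram is simulated once, on a fresh
class of its own (`simulate_run`, `call_spec`). Every fragment turns a word bound M into a fixed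
power of M, so words stay polynomial (`Block.hasAlgorithm`). -/

namespace LCSMono

/-! ### Code fragments of the word RAM -/

/-- Registers and memory. -/
abbrev Store := (ℕ → ℕ) × (ℕ → ℕ)

/-- The configuration with a given program counter and store. -/
def Store.at (s : Store) (pc : ℕ) : Config := ⟨pc, s.1, s.2⟩

/-- All words of the store are at most `B`. -/
def Store.LE (s : Store) (B : ℕ) : Prop := (∀ i, s.1 i ≤ B) ∧ ∀ a, s.2 a ≤ B

theorem Store.LE.mono {s : Store} {B B' : ℕ} (h : s.LE B) (hB : B ≤ B') : s.LE B' :=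
  ⟨fun i => (h.1 i).trans hB, fun a => (h.2 a).trans hB⟩

/-- Within `T` steps the machine gets from `c` to `c'`, with all words at most `B` on the way. -/
def Reach (P : Program) (B T : ℕ) (c c' : Config) : Prop :=
  ∃ t ≤ T, (step P)^[t] c = c' ∧ ∀ u ≤ t, ((step P)^[u] c).WordsLE B

theorem Reach.refl {P : Program} {B : ℕ} {c : Config} (h : c.WordsLE B) : Reach P B 0 c c :=
  ⟨0, le_rfl, rfl, fun u hu => by obtain rfl := Nat.le_zero.1 hu; exact h⟩

theorem Reach.trans {P : Program} {B T₁ T₂ : ℕ} {c₁ c₂ c₃ : Config} (h₁ : Reach P B T₁ c₁ c₂)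
    (h₂ : Reach P B T₂ c₂ c₃) : Reach P B (T₁ + T₂) c₁ c₃ := by
  obtain ⟨t₁, ht₁, e₁, b₁⟩ := h₁
  obtain ⟨t₂, ht₂, e₂, b₂⟩ := h₂
  refine ⟨t₂ + t₁, by omega, by rw [Function.iterate_add_apply, e₁, e₂], fun u hu => ?_⟩
  rcases le_total u t₁ with h | h
  · exact b₁ u h
  · obtain ⟨v, rfl⟩ := Nat.exists_eq_add_of_le' h
    rw [Function.iterate_add_apply, e₁]
    exact b₂ v (by omega)

theorem Reach.mono {P : Program} {B B' T T' : ℕ} {c c' : Config} (h : Reach P B T c c')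
    (hB : B ≤ B') (hT : T ≤ T') : Reach P B' T' c c' := by
  obtain ⟨t, ht, e, b⟩ := h
  exact ⟨t, ht.trans hT, e, fun u hu =>
    ⟨fun i => ((b u hu).1 i).trans hB, fun a => ((b u hu).2 a).trans hB⟩⟩

theorem Reach.single {P : Program} {B : ℕ} {c c' : Config} (h : step P c = c')
    (hc : c.WordsLE B) (hc' : c'.WordsLE B) : Reach P B 1 c c' := by
  refine ⟨1, le_rfl, h, fun u hu => ?_⟩
  interval_cases u
  · exact hc
  · simpa [h] using hc'

/-- The program `P` contains the instructions `l` from position `o` on. -/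
def CodeAt (P : Program) (o : ℕ) (l : List Instr) : Prop := ∀ k < l.length, P[o + k]? = l[k]?

theorem CodeAt.left {P : Program} {o : ℕ} {l₁ l₂ : List Instr} (h : CodeAt P o (l₁ ++ l₂)) :
    CodeAt P o l₁ := fun k hk => by
  rw [h k (by simp; omega), List.getElem?_append_left hk]

theorem CodeAt.right {P : Program} {o : ℕ} {l₁ l₂ : List Instr} (h : CodeAt P o (l₁ ++ l₂)) :
    CodeAt P (o + l₁.length) l₂ := fun k hk => by
  rw [add_assoc, h (l₁.length + k) (by simp; omega), List.getElem?_append_right (by omega)]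
  simp

theorem CodeAt.head {P : Program} {o : ℕ} {i : Instr} {l : List Instr} (h : CodeAt P o (i :: l)) :
    P[o]? = some i := by simpa using h 0 (by simp)

theorem CodeAt.tail {P : Program} {o : ℕ} {i : Instr} {l : List Instr} (h : CodeAt P o (i :: l)) :
    CodeAt P (o + 1) l := CodeAt.right (l₁ := [i]) h

/-- A relocatable code fragment: its code depends on the position; words bounded by `M` before
it runs are bounded by `M ^ growth` afterwards. -/
structure Block where
  code : ℕ → List Instr
  growth : ℕ
  pos : 0 < growth

/-- Run from the store `s`, the fragment ends within `T` steps in a store with property `Q`. -/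
def Block.Spec (f : Block) (M T : ℕ) (s : Store) (Q : Store → Prop) : Prop :=
  ∀ P o, CodeAt P o (f.code o) → ∃ s' : Store, Q s' ∧ s'.LE (M ^ f.growth) ∧
    Reach P (M ^ f.growth) T (s.at o) (s'.at (o + (f.code o).length))

/-- Sequential composition. -/
def Block.seq (f g : Block) : Block where
  code o := f.code o ++ g.code (o + (f.code o).length)
  growth := f.growth * g.growth
  pos := Nat.mul_pos f.pos g.pos

/-- The second fragment starts from words bounded by `M ^ f.growth`, so the exponents multiply. A
fixed composition of fragments keeps all words polynomial. -/
theorem Block.Spec.seq {f g : Block} {M T₁ T₂ : ℕ} {s : Store} {Q₁ Q₂ : Store → Prop} (hM : 0 < M)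
    (h₁ : f.Spec M T₁ s Q₁)
    (h₂ : ∀ s₁, s₁.LE (M ^ f.growth) → Q₁ s₁ → g.Spec (M ^ f.growth) T₂ s₁ Q₂) :
    (f.seq g).Spec M (T₁ + T₂) s Q₂ := by
  intro P o h
  have e : (f.seq g).code o = f.code o ++ g.code (o + (f.code o).length) := rfl
  rw [e] at h ⊢
  obtain ⟨s₁, q₁, b₁, r₁⟩ := h₁ P o h.left
  obtain ⟨s₂, q₂, b₂, r₂⟩ := h₂ s₁ b₁ q₁ P _ h.right
  refine ⟨s₂, q₂, by simpa [Block.seq, pow_mul] using b₂, ?_⟩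
  have h1 := r₁.mono (Nat.pow_le_pow_right hM (Nat.le_mul_of_pos_right f.growth g.pos)) le_rfl
  rw [← pow_mul] at r₂
  rw [List.length_append, ← add_assoc]
  exact h1.trans r₂

theorem Block.Spec.imp {f : Block} {M T T' : ℕ} {s : Store} {Q Q' : Store → Prop}
    (h : f.Spec M T s Q) (hT : T ≤ T') (hQ : ∀ s', Q s' → Q' s') : f.Spec M T' s Q' := by
  intro P o hP
  obtain ⟨s₁, q₁, b₁, r₁⟩ := h P o hP
  exact ⟨s₁, hQ _ q₁, b₁, r₁.mono le_rfl hT⟩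

/-- The empty fragment. -/
def Block.skip : Block := ⟨fun _ => [], 1, one_pos⟩

theorem Block.skip_spec {M : ℕ} {s : Store} {Q : Store → Prop} (hs : s.LE M) (h : Q s) :
    Block.skip.Spec M 0 s Q :=
  fun P o _ => ⟨s, h, by simpa [Block.skip] using hs, by
    simpa [Block.skip] using Reach.refl (P := P) (c := s.at o) hs⟩

/-- Instructions without jumps whose results are at most the product or sum of the operands, or a
constant at most `10`. -/
def Instr.Plain : Instr → Prop
  | .const _ c => c ≤ 10
  | .op .add _ _ _ => True
  | .op .sub _ _ _ => True
  | .op .mul _ _ _ => True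
  | .op .div _ _ _ => True
  | .op .mod _ _ _ => True
  | .op _ _ _ _ => False
  | .load _ _ => True
  | .store _ _ => True
  | .jz _ _ => False

/-- The effect of an instruction on the store. -/
def Instr.act (ins : Instr) (s : Store) : Store := ((ins.exec (s.at 0)).reg, (ins.exec (s.at 0)).mem)

@[simp] theorem act_const (i c : ℕ) (s : Store) :
    (Instr.const i c).act s = (Function.update s.1 i c, s.2) := rfl
@[simp] theorem act_op (o : BinOp) (i j k : ℕ) (s : Store) :
    (Instr.op o i j k).act s = (Function.update s.1 i (o.eval (s.1 j) (s.1 k)), s.2) := rfl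
@[simp] theorem act_load (i j : ℕ) (s : Store) :
    (Instr.load i j).act s = (Function.update s.1 i (s.2 (s.1 j)), s.2) := rfl
@[simp] theorem act_store (i j : ℕ) (s : Store) :
    (Instr.store i j).act s = (s.1, Function.update s.2 (s.1 i) (s.1 j)) := rfl

theorem update_le {f : ℕ → ℕ} {i v B : ℕ} (h : ∀ j, f j ≤ B) (hv : v ≤ B) (j : ℕ) :
    Function.update f i v j ≤ B := by
  rw [Function.update_apply]; split_ifs <;> simp_all

theorem Instr.Plain.act_le {ins : Instr} (h : ins.Plain) {s : Store} {M : ℕ} (hM : 10 ≤ M)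
    (hs : s.LE M) : (ins.act s).LE (M ^ 2) := by
  have hM2 : M ≤ M ^ 2 := Nat.le_self_pow (by norm_num) M
  have h' := hs.mono hM2
  have key : ∀ a b, a ≤ M → b ≤ M → a + b ≤ M ^ 2 ∧ a * b ≤ M ^ 2 := fun a b ha hb =>
    ⟨by nlinarith, by rw [sq]; exact Nat.mul_le_mul ha hb⟩
  cases ins with
  | const i c => exact ⟨update_le h'.1 (by have : c ≤ 10 := h; omega), h'.2⟩
  | op o i j k =>
    refine ⟨update_le h'.1 ?_, h'.2⟩
    have h1 := hs.1 j
    have h2 := hs.1 k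
    obtain ⟨k1, k2⟩ := key _ _ h1 h2
    cases o with
    | add => exact k1
    | sub => exact (Nat.sub_le _ _).trans (h1.trans hM2)
    | mul => exact k2
    | div => exact (Nat.div_le_self _ _).trans (h1.trans hM2)
    | mod => exact (Nat.mod_le _ _).trans (h1.trans hM2)
    | and => exact h.elim
    | or => exact h.elim
    | xor => exact h.elim
    | shl => exact h.elim
    | shr => exact h.elim
  | load i j => exact ⟨update_le h'.1 (h'.2 _), h'.2⟩
  | store i j => exact ⟨h'.1, update_le h'.2 (h'.1 _)⟩
  | jz i l => exact h.elim

theorem Instr.Plain.step_eq {ins : Instr} (h : ins.Plain) {P : Program} {o : ℕ}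
    (hP : P[o]? = some ins) (s : Store) : step P (s.at o) = (ins.act s).at (o + 1) := by
  have e : step P (s.at o) = ins.exec (s.at o) := by simp [step, Store.at, hP]
  rw [e]
  cases ins with
  | jz i l => exact h.elim
  | _ => rfl

theorem step_jz {P : Program} {o i l : ℕ} (h : P[o]? = some (.jz i l)) (s : Store) :
    step P (s.at o) = s.at (if s.1 i = 0 then l else o + 1) := by
  simp only [step, Store.at, h, Instr.exec]; rfl

/-- The effect of straight-line code. -/
def lineAct (l : List Instr) (s : Store) : Store := l.foldl (fun s i => i.act s) s

@[simp] theorem lineAct_nil (s : Store) : lineAct [] s = s := rfl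
@[simp] theorem lineAct_cons (i : Instr) (l : List Instr) (s : Store) :
    lineAct (i :: l) s = lineAct l (i.act s) := rfl
theorem lineAct_append (l l' : List Instr) (s : Store) :
    lineAct (l ++ l') s = lineAct l' (lineAct l s) := by simp [lineAct]

theorem lineAct_le {l : List Instr} (hl : ∀ i ∈ l, i.Plain) {s : Store} {M : ℕ} (hM : 10 ≤ M)
    (hs : s.LE M) : (lineAct l s).LE (M ^ 2 ^ l.length) := by
  induction l generalizing s M with
  | nil => simpa using hs
  | cons i l ih =>
    have := ih (fun j hj => hl j (by simp [hj])) (M := M ^ 2)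
      (hM.trans (Nat.le_self_pow (by norm_num) M)) ((hl i (by simp)).act_le hM hs)
    rw [← pow_mul] at this
    rwa [List.length_cons, pow_succ']

theorem reach_line {l : List Instr} (hl : ∀ i ∈ l, i.Plain) {s : Store} {M : ℕ} (hM : 10 ≤ M)
    (hs : s.LE M) {P : Program} {o : ℕ} (hP : CodeAt P o l) :
    Reach P (M ^ 2 ^ l.length) l.length (s.at o) ((lineAct l s).at (o + l.length)) := by
  induction l generalizing s M o with
  | nil => exact Reach.refl (hs.mono (by simp))
  | cons i l ih =>
    have hi := hl i (by simp)
    have h1 := hi.act_le hM hs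
    have := ih (fun j hj => hl j (by simp [hj])) (M := M ^ 2)
      (hM.trans (Nat.le_self_pow (by norm_num) M)) h1 hP.tail
    rw [← pow_mul, ← pow_succ'] at this
    rw [List.length_cons, add_comm l.length, ← add_assoc o]
    have hb : M ^ 2 ≤ M ^ 2 ^ (l.length + 1) :=
      Nat.pow_le_pow_right (by omega) (Nat.le_self_pow (by omega) 2)
    rw [add_comm 1 l.length]
    have h0 : Reach P (M ^ 2 ^ (l.length + 1)) 1 (s.at o) ((i.act s).at (o + 1)) :=
      Reach.single (hi.step_eq hP.head s)
        ((hs.mono (Nat.le_self_pow (by norm_num) M)).mono hb) (h1.mono hb)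
    rw [add_comm l.length 1]
    rw [add_comm l.length 1] at h0 this
    exact h0.trans this

/-- Straight-line code as a fragment. -/
def Block.line (l : List Instr) : Block := ⟨fun _ => l, 2 ^ l.length, by positivity⟩

theorem Block.line_spec {l : List Instr} (hl : ∀ i ∈ l, i.Plain) {s : Store} {M : ℕ} (hM : 10 ≤ M)
    (hs : s.LE M) {Q : Store → Prop} (h : Q (lineAct l s)) : (line l).Spec M l.length s Q :=
  fun _ _ hP => ⟨_, h, lineAct_le hl hM hs, reach_line hl hM hs hP⟩

/-! ### Filling a stretch of memory -/

/-- The memory `m` with `g 0, …, g (k - 1)` written to the cells `p, p + 9, p + 18, …`. -/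
def fillMem (m : ℕ → ℕ) (p : ℕ) (g : ℕ → ℕ) : ℕ → ℕ → ℕ
  | 0 => m
  | k + 1 => Function.update (fillMem m p g k) (p + 9 * k) (g k)

theorem fillMem_of_ne {m : ℕ → ℕ} {p : ℕ} {g : ℕ → ℕ} {k a : ℕ} (h : ∀ i < k, a ≠ p + 9 * i) :
    fillMem m p g k a = m a := by
  induction k with
  | zero => rfl
  | succ k ih =>
    rw [fillMem, Function.update_of_ne (h k (by omega)), ih fun i hi => h i (by omega)]

theorem fillMem_of_lt {m : ℕ → ℕ} {p : ℕ} {g : ℕ → ℕ} {k i : ℕ} (h : i < k) :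
    fillMem m p g k (p + 9 * i) = g i := by
  induction k with
  | zero => omega
  | succ k ih =>
    rw [fillMem, Function.update_apply]
    split_ifs with h'
    · rw [show i = k by omega]
    · exact ih (by omega)

theorem fillMem_le {m : ℕ → ℕ} {p : ℕ} {g : ℕ → ℕ} {k B : ℕ} (hm : ∀ a, m a ≤ B)
    (hg : ∀ i < k, g i ≤ B) (a : ℕ) : fillMem m p g k a ≤ B := by
  by_cases h : ∃ l < k, a = p + 9 * l
  · obtain ⟨l, hl, rfl⟩ := h
    rw [fillMem_of_lt hl]; exact hg l hl
  · push Not at h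
    rw [fillMem_of_ne h]; exact hm a

/-- The store at the head of the filling loop after `k` of `N` rounds. -/
def fillState (s : Store) (g : ℕ → ℕ) (N k : ℕ) : Store :=
  (Function.update (Function.update (Function.update (Function.update s.1 54 (s.1 54 + 9 * k))
    72 k) 63 (N - k)) 45 0, fillMem s.2 (s.1 54) g k)

/-- The body of the filling loop. -/
def fillBody (v : List Instr) : List Instr :=
  v ++ [.store 54 45, .const 45 0, .op .add 54 54 27, .op .add 72 72 18, .op .sub 63 63 18]

/-- Fill memory with stride `9`: the value of round `i` is computed by `v` from register `72`, which
holds `i`, into register `45`; the address is in register `54`, the number of rounds in `63`. -/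
def Block.fill (v : List Instr) : Block where
  code o := [.const 72 0, .const 45 0, .jz 63 (o + v.length + 9)] ++ (fillBody v ++ [.jz 9 (o + 2)])
  growth := 3 * 2 ^ (v.length + 5)
  pos := by positivity

/-- Induction on the number `k` of rounds still to do. Register `9` holds zero, so the closing `jz
9` jumps unconditionally. A round costs the length of `v`, five further instructions and two jumps.
-/
theorem fill_loop {v : List Instr} (hv : ∀ i ∈ v, i.Plain) {s : Store} {g : ℕ → ℕ} {N B M : ℕ}
    (hM : 10 ≤ M) (hB : B = M ^ 2 ^ (v.length + 5))
    (h1 : s.1 18 = 1) (h9 : s.1 27 = 9) (h0 : s.1 9 = 0)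
    (hg : ∀ k < N, lineAct v (fillState s g N k) =
      (Function.update (fillState s g N k).1 45 (g k), (fillState s g N k).2))
    (hle : ∀ k ≤ N, (fillState s g N k).LE M) {P : Program} {o : ℕ}
    (hP : CodeAt P o ((Block.fill v).code o)) (k : ℕ) (hk : k ≤ N) :
    Reach P B (k * (v.length + 7)) ((fillState s g N (N - k)).at (o + 2))
      ((fillState s g N N).at (o + 2)) := by
  induction k with
  | zero =>
    simp only [Nat.sub_zero, zero_mul]
    exact Reach.refl ((hle N le_rfl).mono (hB ▸ Nat.le_self_pow (by positivity) M))
  | succ k ih =>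
    have ih := ih (by omega)
    set j := N - (k + 1) with hj
    have hj1 : N - k = j + 1 := by omega
    rw [hj1] at ih
    have hMB : M ≤ B := hB ▸ Nat.le_self_pow (by positivity) M
    have hjl := hle j (by omega)
    have hp2 : P[o + 2]? = some (.jz 63 (o + v.length + 9)) := (hP 2 (by simp [Block.fill])).trans rfl
    have hbody : CodeAt P (o + 3) (fillBody v ++ [.jz 9 (o + 2)]) := CodeAt.right
      (l₁ := [.const 72 0, .const 45 0, .jz 63 (o + v.length + 9)]) hP
    have hcnt : (fillState s g N j).1 63 ≠ 0 := by
      simp only [fillState]; simp; omega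
    have s1 : Reach P B 1 ((fillState s g N j).at (o + 2)) ((fillState s g N j).at (o + 3)) := by
      refine Reach.single ?_ (hjl.mono hMB) (hjl.mono hMB)
      rw [step_jz hp2, if_neg hcnt]
    have hplain : ∀ i ∈ fillBody v, i.Plain := by
      intro i hi
      simp only [fillBody, List.mem_append] at hi
      rcases hi with hi | hi
      · exact hv i hi
      · simp at hi; rcases hi with rfl | rfl | rfl | rfl | rfl <;> simp [Instr.Plain]
    have hlen : (fillBody v).length = v.length + 5 := by simp [fillBody]
    have s2 := reach_line hplain hM hjl hbody.left
    rw [hlen, ← hB] at s2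
    have hact : lineAct (fillBody v) (fillState s g N j) = fillState s g N (j + 1) := by
      rw [fillBody, lineAct_append, hg j (by omega)]
      simp only [lineAct_cons, lineAct_nil, act_const, act_op, act_store, BinOp.eval]
      refine Prod.ext ?_ ?_
      · funext i
        simp [fillState, Function.update_apply, h1, h9]
        split_ifs <;> first | rfl | omega
      · simp [fillState, fillMem]
    rw [hact] at s2
    have hb := hle (j + 1) (by omega)
    have hp3 : P[o + 3 + (v.length + 5)]? = some (.jz 9 (o + 2)) := by
      have := hbody.right.head; rwa [hlen] at this
    have s3 : Reach P B 1 ((fillState s g N (j + 1)).at (o + 3 + (v.length + 5)))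
        ((fillState s g N (j + 1)).at (o + 2)) := by
      refine Reach.single ?_ (hb.mono hMB) (hb.mono hMB)
      rw [step_jz hp3, if_pos]
      simp [fillState, h0]
    exact (((s1.trans s2).trans s3).trans ih).mono le_rfl (by ring_nf; omega)

/-- The word bound must not depend on the number of rounds. The stores at the head of the loop are
known explicitly and stay below `M ^ 3`, so the growth of straight-line code is paid for one round
only. -/
theorem Block.fill_spec {v : List Instr} (hv : ∀ i ∈ v, i.Plain) {s : Store} {g : ℕ → ℕ} {M : ℕ}
    (hM : 10 ≤ M) (hs : s.LE M) (h1 : s.1 18 = 1) (h9 : s.1 27 = 9) (h0 : s.1 9 = 0)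
    (hg : ∀ k < s.1 63, lineAct v (fillState s g (s.1 63) k) =
      (Function.update (fillState s g (s.1 63) k).1 45 (g k), (fillState s g (s.1 63) k).2))
    (hgle : ∀ k < s.1 63, g k ≤ M ^ 3) {Q : Store → Prop}
    (hQ : Q (fillState s g (s.1 63) (s.1 63))) :
    (Block.fill v).Spec M (s.1 63 * (v.length + 7) + 3) s Q := by
  set N := s.1 63 with hN
  have hM3 : M ≤ M ^ 3 := Nat.le_self_pow (by norm_num) M
  have hle : ∀ k ≤ N, (fillState s g N k).LE (M ^ 3) := by
    intro k hk
    have hNM := hs.1 63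
    have hp := hs.1 54
    refine ⟨?_, fillMem_le (fun a => (hs.2 a).trans hM3) fun i hi => hgle i (by omega)⟩
    have : s.1 54 + 9 * k ≤ M ^ 3 := by
      have : 10 * M ≤ M ^ 3 := by nlinarith [Nat.mul_le_mul hM hM]
      omega
    exact update_le (update_le (update_le (update_le (fun i => (hs.1 i).trans hM3) this)
      (by omega)) (by omega)) (by omega)
  have hB : M ^ (3 * 2 ^ (v.length + 5)) = (M ^ 3) ^ 2 ^ (v.length + 5) := pow_mul _ _ _
  have hMB : M ^ 3 ≤ (M ^ 3) ^ 2 ^ (v.length + 5) := Nat.le_self_pow (by positivity) _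
  intro P o hP
  refine ⟨_, hQ, ((hle N le_rfl).mono hMB).mono hB.ge, ?_⟩
  have hlen : ((Block.fill v).code o).length = v.length + 9 := by simp [Block.fill, fillBody]
  have loop := fill_loop hv (hM.trans hM3) hB h1 h9 h0 hg hle hP N le_rfl
  rw [Nat.sub_self] at loop
  have hp2 : P[o + 2]? = some (.jz 63 (o + v.length + 9)) := (hP 2 (by simp [Block.fill])).trans rfl
  have hpre : CodeAt P o [.const 72 0, .const 45 0] :=
    CodeAt.left (l₂ := [.jz 63 (o + v.length + 9)] ++ (fillBody v ++ [.jz 9 (o + 2)])) hP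
  have s1 := reach_line (by simp [Instr.Plain]) hM hs hpre
  have hact : lineAct [.const 72 0, .const 45 0] s = fillState s g N 0 := by
    refine Prod.ext ?_ rfl
    funext i
    simp [fillState, Function.update_apply, hN]
    split_ifs <;> simp_all
  rw [hact] at s1
  have s3 : Reach P (M ^ (3 * 2 ^ (v.length + 5))) 1 ((fillState s g N N).at (o + 2))
      ((fillState s g N N).at (o + (v.length + 9))) := by
    have hb : ((fillState s g N N)).LE (M ^ (3 * 2 ^ (v.length + 5))) :=
      ((hle N le_rfl).mono hMB).mono hB.ge
    refine Reach.single ?_ hb hb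
    rw [step_jz hp2, if_pos, add_assoc]
    simp [fillState]
  rw [hlen]
  have s1' := s1.mono (B' := M ^ (3 * 2 ^ (v.length + 5))) (T' := 2) (Nat.pow_le_pow_right (by omega)
    (by
      have : 2 ^ 2 ≤ 2 ^ (v.length + 5) := Nat.pow_le_pow_right (by norm_num) (by omega)
      simp; omega)) (by simp)
  exact ((s1'.trans loop).trans s3).mono le_rfl (by omega)

/-! ### Virtual machines

Registers and memory are split into residue classes modulo `9`. Class `0` of the registers holds the
variables of the driver; class `r` of registers and memory belongs to the `r`-th virtual machine. -/

/-- The translation of one instruction for the virtual machine `r`, whose memory cell `a` is the cell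
`9 * a + reg 36`; the code of the machine starts at `o`, and it has `n` instructions. -/
def Instr.translate (r o n : ℕ) : Instr → List Instr
  | .const i c => [.const (9 * i + r) c, .const 45 0, .const 45 0]
  | .op b i j k => [.op b (9 * i + r) (9 * j + r) (9 * k + r), .const 45 0, .const 45 0]
  | .load i j => [.op .mul 45 (9 * j + r) 27, .op .add 45 45 36, .load (9 * i + r) 45]
  | .store i j => [.op .mul 45 (9 * i + r) 27, .op .add 45 45 36, .store 45 (9 * j + r)]
  | .jz i l => [.jz (9 * i + r) (o + 3 * min l n), .const 45 0, .const 45 0]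

/-- Short translations are filled up with writes to the scratch register `45`. The uniform length
makes `o + 3 * l` the correct jump target; the cap `min l n` sends every halting jump to the end of
the translated code. -/
theorem Instr.length_translate (r o n : ℕ) (i : Instr) : (i.translate r o n).length = 3 := by
  cases i <;> rfl

/-- The translation of a program. -/
def translate (r o : ℕ) (P : Program) : List Instr := P.flatMap (Instr.translate r o P.length)

theorem length_translate (r o : ℕ) (P : Program) : (translate r o P).length = 3 * P.length := by
  rw [translate, List.length_flatMap]
  simp [Instr.length_translate, mul_comm]

theorem codeAt_translate {P Q : Program} {r o : ℕ} (h : CodeAt Q o (translate r o P)) {p : ℕ}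
    {i : Instr} (hp : P[p]? = some i) : CodeAt Q (o + 3 * p) (i.translate r o P.length) := by
  obtain ⟨hlt, rfl⟩ := List.getElem?_eq_some_iff.1 hp
  have e : P = P.take p ++ P[p] :: P.drop (p + 1) := by simp
  have e2 : translate r o P = (P.take p).flatMap (Instr.translate r o P.length) ++
      ((P[p]).translate r o P.length ++ (P.drop (p + 1)).flatMap (Instr.translate r o P.length)) := by
    conv_lhs => rw [translate, e]
    rw [List.flatMap_append, List.flatMap_cons, ← e]
  rw [e2] at h
  have := h.right.left
  rwa [List.length_flatMap, show (List.map (fun a => (a.translate r o P.length).length)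
    (P.take p)).sum = 3 * p by simp [Instr.length_translate, mul_comm, hlt.le]] at this

/-- The store `s'` represents the virtual configuration `c` in class `r`, and agrees with `s`
elsewhere, register `45` excepted. -/
structure Simulates (r : ℕ) (s : Store) (c : Config) (s' : Store) : Prop where
  reg : ∀ i, s'.1 (9 * i + r) = c.reg i
  mem : ∀ a, s'.2 (9 * a + s.1 36) = c.mem a
  reg_frame : ∀ i, i % 9 ≠ r → i ≠ 45 → s'.1 i = s.1 i
  mem_frame : ∀ b, (∀ a, b ≠ 9 * a + s.1 36) → s'.2 b = s.2 b

theorem Simulates.le {r : ℕ} {s s' : Store} {c : Config} (h : Simulates r s c s') {M : ℕ}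
    (hs : s.LE M) (hc : c.WordsLE M) (h45 : s'.1 45 ≤ M) : s'.LE M := by
  refine ⟨fun i => ?_, fun b => ?_⟩
  · by_cases hi : i % 9 = r
    · have : i = 9 * (i / 9) + r := by omega
      rw [this, h.reg]; exact hc.1 _
    · by_cases h' : i = 45
      · rw [h']; exact h45
      · rw [h.reg_frame i hi h']; exact hs.1 i
  · by_cases hb : ∃ a, b = 9 * a + s.1 36
    · obtain ⟨a, rfl⟩ := hb
      rw [h.mem]; exact hc.2 a
    · push Not at hb
      rw [h.mem_frame b hb]; exact hs.2 b

theorem pc_step_le {P : Program} {c : Config} (h : P.length ≤ c.pc) : step P c = c := by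
  simp [step, List.getElem?_eq_none h]

theorem Simulates.set {r : ℕ} {s s' : Store} {c : Config} (hr : r < 9) (h : Simulates r s c s')
    (p i v : ℕ) : Simulates r s ⟨p, Function.update c.reg i v, c.mem⟩
      (Function.update s'.1 (9 * i + r) v, s'.2) where
  reg j := by
    simp only [Function.update_apply]
    by_cases hj : j = i
    · simp [hj]
    · rw [if_neg (by omega), if_neg hj, h.reg]
  mem := h.mem
  reg_frame j hj h45 := by
    simp only; rw [Function.update_of_ne (by omega), h.reg_frame j hj h45]
  mem_frame := h.mem_frame

theorem Simulates.tmp {r : ℕ} {s s' : Store} {c : Config} (hr : 1 ≤ r) (hr9 : r < 9)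
    (h : Simulates r s c s') (v : ℕ) : Simulates r s c (Function.update s'.1 45 v, s'.2) where
  reg j := by
    simp only
    rw [Function.update_of_ne (by omega), h.reg]
  mem := h.mem
  reg_frame j hj h45 := by
    simp only; rw [Function.update_of_ne h45, h.reg_frame j hj h45]
  mem_frame := h.mem_frame

theorem Simulates.put {r : ℕ} {s s' : Store} {c : Config} (h : Simulates r s c s')
    (p a v : ℕ) : Simulates r s ⟨p, c.reg, Function.update c.mem a v⟩
      (s'.1, Function.update s'.2 (9 * a + s.1 36) v) where
  reg := h.reg
  mem b := by
    simp only [Function.update_apply]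
    by_cases hb : b = a
    · simp [hb]
    · rw [if_neg (by omega), if_neg hb, h.mem]
  reg_frame := h.reg_frame
  mem_frame b hb := by
    simp only
    rw [Function.update_of_ne (hb a), h.mem_frame b hb]

theorem Simulates.pc {r : ℕ} {s s' : Store} {c : Config} (h : Simulates r s c s')
    (p : ℕ) : Simulates r s ⟨p, c.reg, c.mem⟩ s' := ⟨h.reg, h.mem, h.reg_frame, h.mem_frame⟩

theorem step_act {P : Program} {o : ℕ} {ins : Instr} (hP : P[o]? = some ins)
    (h : ∀ i l, ins ≠ .jz i l) (s : Store) : step P (s.at o) = (ins.act s).at (o + 1) := by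
  have e : step P (s.at o) = ins.exec (s.at o) := by simp [step, Store.at, hP]
  rw [e]
  cases ins with
  | jz i l => exact (h i l rfl).elim
  | _ => rfl

theorem reach_three {P : Program} {o B : ℕ} {i₁ i₂ i₃ : Instr} (hP : CodeAt P o [i₁, i₂, i₃])
    (h₁ : ∀ i l, i₁ ≠ .jz i l) (h₂ : ∀ i l, i₂ ≠ .jz i l) (h₃ : ∀ i l, i₃ ≠ .jz i l) {s : Store}
    (hs : s.LE B) (l₁ : (i₁.act s).LE B) (l₂ : (i₂.act (i₁.act s)).LE B)
    (l₃ : (i₃.act (i₂.act (i₁.act s))).LE B) :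
    Reach P B 3 (s.at o) ((i₃.act (i₂.act (i₁.act s))).at (o + 3)) :=
  ((Reach.single (step_act hP.head h₁ s) hs l₁).trans
    (Reach.single (step_act hP.tail.head h₂ _) l₁ l₂)).trans
    (Reach.single (step_act hP.tail.tail.head h₃ _) l₂ l₃)

/-- The virtual words are bounded by `M` by assumption, so even multiplications and shifts cause no
growth. Only the physical address in register `45` may exceed `M`, and it is at most `9 * M + M ≤ M
^ 2`; this bound does not accumulate over the steps. -/
theorem simulate_step {P Q : Program} {r o : ℕ} (hr : 1 ≤ r) (hr9 : r < 9)
    (hQ : CodeAt Q o (translate r o P)) {s s₁ : Store} {c : Config} {M : ℕ} (hM : 10 ≤ M)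
    (hs : s.LE M) (h27 : s.1 27 = 9) (hc : c.WordsLE M) (hc' : (step P c).WordsLE M)
    (h₁ : Simulates r s c s₁) (h45 : s₁.1 45 ≤ M ^ 2) :
    ∃ s₂ : Store, Simulates r s (step P c) s₂ ∧ s₂.1 45 ≤ M ^ 2 ∧
      Reach Q (M ^ 2) 3 (s₁.at (o + 3 * min c.pc P.length))
        (s₂.at (o + 3 * min (step P c).pc P.length)) := by
  have hM2 : M ≤ M ^ 2 := Nat.le_self_pow (by norm_num) M
  have cc : ∀ {c : Config}, c.WordsLE M → c.WordsLE (M ^ 2) := fun h =>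
    ⟨fun i => (h.1 i).trans hM2, fun i => (h.2 i).trans hM2⟩
  have hs2 := hs.mono hM2
  have hle₁ : s₁.LE (M ^ 2) := h₁.le hs2 (cc hc) h45
  rcases lt_or_ge c.pc P.length with hpc | hpc
  swap
  -- A halted virtual machine needs no physical step.
  · rw [pc_step_le hpc]
    exact ⟨s₁, h₁, h45, (Reach.refl (c := s₁.at _) hle₁).mono le_rfl (by omega)⟩
  obtain ⟨ins, hP⟩ : ∃ ins, P[c.pc]? = some ins := ⟨P[c.pc], by simp [hpc]⟩
  have hcode := codeAt_translate hQ hP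
  have h45r : ∀ i, 9 * i + r ≠ 45 := fun i => by omega
  have h27' : s₁.1 27 = 9 := by rw [h₁.reg_frame 27 (by omega) (by omega), h27]
  have h36' : s₁.1 36 = s.1 36 := by rw [h₁.reg_frame 36 (by omega) (by omega)]
  have haddr : ∀ j, c.reg j * 9 ≤ M ^ 2 ∧ c.reg j * 9 + s.1 36 ≤ M ^ 2 := fun j => by
    have := hc.1 j
    have := hs.1 36
    have hb : M * 9 + M ≤ M ^ 2 := by nlinarith
    constructor <;> omega
  have hst : step P c = ins.exec c := by simp [step, hP]
  rw [hst] at hc' ⊢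
  rw [min_eq_left hpc.le]
  have hnext : min (c.pc + 1) P.length = c.pc + 1 := min_eq_left hpc
  cases ins with
  | const i v =>
    have t1 := h₁.set hr9 (c.pc + 1) i v
    have t2 := t1.tmp hr hr9 0
    have t3 := t2.tmp hr hr9 0
    refine ⟨_, t3, by simp, ?_⟩
    simp only [Instr.exec, hnext]
    refine reach_three hcode (by simp) (by simp) (by simp) hle₁ (t1.le hs2 (cc hc') ?_)
      (t2.le hs2 (cc hc') (by simp)) (t3.le hs2 (cc hc') (by simp))
    simpa [Function.update_of_ne (h45r i).symm] using h45
  | op b i j k =>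
    have t1 := h₁.set hr9 (c.pc + 1) i (b.eval (c.reg j) (c.reg k))
    have t2 := t1.tmp hr hr9 0
    have t3 := t2.tmp hr hr9 0
    refine ⟨_, t3, by simp, ?_⟩
    simp only [Instr.exec, hnext]
    have := reach_three (B := M ^ 2) hcode (by simp) (by simp) (by simp) hle₁
    simp only [act_op, act_const, h₁.reg] at this
    refine this (t1.le hs2 (cc hc') ?_)
      (t2.le hs2 (cc hc') (by simp)) (t3.le hs2 (cc hc') (by simp))
    simpa [Function.update_of_ne (h45r i).symm] using h45
  | load i j =>
    have t1 := h₁.tmp hr hr9 (c.reg j * 9)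
    have t2 := t1.tmp hr hr9 (c.reg j * 9 + s.1 36)
    have t3 := t2.set hr9 (c.pc + 1) i (c.mem (c.reg j))
    have e3 : s₁.2 (c.reg j * 9 + s.1 36) = c.mem (c.reg j) := by rw [mul_comm, h₁.mem]
    refine ⟨_, t3, ?_, ?_⟩
    · simp only; rw [Function.update_of_ne (h45r i).symm]; simpa using (haddr j).2
    simp only [Instr.exec, hnext]
    have := reach_three (B := M ^ 2) hcode (by simp) (by simp) (by simp) hle₁
    simp only [act_op, act_load, BinOp.eval, h₁.reg, h27', Function.update_self,
      Function.update_of_ne (show (36 : ℕ) ≠ 45 by norm_num), h36', e3] at this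
    refine this (t1.le hs2 (cc hc) (by simpa using (haddr j).1))
      (t2.le hs2 (cc hc) (by simpa using (haddr j).2)) (t3.le hs2 (cc hc') ?_)
    simp only; rw [Function.update_of_ne (h45r i).symm]; simpa using (haddr j).2
  | store i j =>
    have t1 := h₁.tmp hr hr9 (c.reg i * 9)
    have t2 := t1.tmp hr hr9 (c.reg i * 9 + s.1 36)
    have t3 := t2.put (c.pc + 1) (c.reg i) (c.reg j)
    refine ⟨_, t3, by simpa using (haddr i).2, ?_⟩
    simp only [Instr.exec, hnext]
    have := reach_three (B := M ^ 2) hcode (by simp) (by simp) (by simp) hle₁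
    simp only [act_op, act_store, BinOp.eval, h₁.reg, h27', Function.update_self,
      Function.update_of_ne (show (36 : ℕ) ≠ 45 by norm_num), h36',
      Function.update_of_ne (h45r j), mul_comm _ 9] at this
    simp only [mul_comm _ 9] at t1 t2 t3 ⊢
    refine this (t1.le hs2 (cc hc) ?_) (t2.le hs2 (cc hc) ?_) (t3.le hs2 (cc hc') ?_)
    · have := (haddr i).1; simp; omega
    · have := (haddr i).2; simp; omega
    · have := (haddr i).2; simp; omega
  | jz i l =>
    have hreg := h₁.reg i
    have t0 := h₁.pc (if c.reg i = 0 then l else c.pc + 1)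
    have t1 := t0.tmp hr hr9 0
    by_cases hi : c.reg i = 0
    · refine ⟨_, t0, h45, ?_⟩
      simp only [Instr.exec, hi, if_true]
      refine (Reach.single (c := s₁.at _) (c' := s₁.at _) ?_ hle₁ hle₁).mono le_rfl (by norm_num)
      rw [step_jz hcode.head, if_pos (by rw [hreg, hi])]
    · have t2 := t1.tmp hr hr9 0
      refine ⟨_, t2, by simp, ?_⟩
      simp only [Instr.exec, if_neg hi, hnext]
      refine ((Reach.single (c := s₁.at _) (c' := s₁.at _) ?_ hle₁ hle₁).trans ((Reach.single
        (step_act hcode.tail.head (by simp) _) hle₁ ?_).trans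
        (Reach.single (step_act hcode.tail.tail.head (by simp) _) ?_ ?_)))
      · rw [step_jz hcode.head, if_neg (by rw [hreg]; exact hi)]
      all_goals simp only [act_const]
      · exact t1.le hs2 (cc hc') (by simp)
      · exact t1.le hs2 (cc hc') (by simp)
      · exact t2.le hs2 (cc hc') (by simp)

theorem simulate_run {P Q : Program} {r o : ℕ} (hr : 1 ≤ r) (hr9 : r < 9)
    (hQ : CodeAt Q o (translate r o P)) {s : Store} {c : Config} {M : ℕ} (hM : 10 ≤ M)
    (hs : s.LE M) (h27 : s.1 27 = 9) (hc0 : Simulates r s c s) (hpc : c.pc = 0) (t : ℕ)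
    (hc : ∀ u ≤ t, ((step P)^[u] c).WordsLE M) :
    ∃ s₂ : Store, Simulates r s ((step P)^[t] c) s₂ ∧ s₂.1 45 ≤ M ^ 2 ∧
      Reach Q (M ^ 2) (3 * t) (s.at o) (s₂.at (o + 3 * min ((step P)^[t] c).pc P.length)) := by
  have hM2 : M ≤ M ^ 2 := Nat.le_self_pow (by norm_num) M
  induction t with
  | zero =>
    refine ⟨s, hc0, (hs.1 45).trans hM2, ?_⟩
    simp only [Function.iterate_zero, id, hpc, Nat.zero_min, mul_zero, add_zero]
    exact Reach.refl (hs.mono hM2)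
  | succ t ih =>
    obtain ⟨s₁, h1, h45, h2⟩ := ih fun u hu => hc u (by omega)
    rw [Function.iterate_succ_apply']
    have hc' := hc (t + 1) le_rfl
    rw [Function.iterate_succ_apply'] at hc'
    obtain ⟨s₂, h3, h46, h4⟩ := simulate_step hr hr9 hQ hM hs h27 (hc t (by omega)) hc' h1 h45
    exact ⟨s₂, h3, h46, (h2.trans h4).mono le_rfl (by omega)⟩

/-! ### The driver -/

/-- The store of the driver: `ρ` gives the values of its variables (scratch variables excepted), the
input is intact, and the virtual machines from the `c`-th on are fresh. -/
structure Base (inp : List ℕ) (c : ℕ) (ρ : ℕ → ℕ) (s : Store) : Prop where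
  env : ∀ v, v < 4 ∨ 8 < v → s.1 (9 * v) = ρ v
  zero : ρ 1 = 0
  one : ρ 2 = 1
  nine : ρ 3 = 9
  length_le : inp.length ≤ ρ 12
  input : ∀ a < ρ 12, s.2 a = inp.getD a 0
  mem : ∀ r a, c ≤ r → r < 9 → s.2 (9 * a + (ρ 12 + r)) = 0
  reg : ∀ r i, c ≤ r → r < 9 → s.1 (9 * i + r) = 0

/-- The virtual machine `r` has fresh registers, and its memory contains the sequence `l`. -/
structure Tape (r : ℕ) (l : List ℕ) (ρ : ℕ → ℕ) (s : Store) : Prop where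
  base : s.1 36 = ρ 12 + r
  ptr : s.1 54 = ρ 12 + r + 9 * l.length
  mem : ∀ a, s.2 (9 * a + (ρ 12 + r)) = l.getD a 0
  reg : ∀ i, s.1 (9 * i + r) = 0

theorem Base.congr {inp : List ℕ} {c : ℕ} {ρ : ℕ → ℕ} {s s' : Store} (h : Base inp c ρ s)
    (hm : s'.2 = s.2) (hr : ∀ i, (∀ v, 4 ≤ v → v ≤ 8 → i ≠ 9 * v) → s'.1 i = s.1 i)
    (hc : 1 ≤ c) : Base inp c ρ s' where
  env v hv := by rw [hr _ fun w hw hw' => by omega, h.env v hv]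
  zero := h.zero
  one := h.one
  nine := h.nine
  length_le := h.length_le
  input a ha := by rw [hm, h.input a ha]
  mem r a hr1 hr9 := by rw [hm, h.mem r a hr1 hr9]
  reg r i hr1 hr9 := by rw [hr _ fun w hw hw' => by omega, h.reg r i hr1 hr9]

/-- How the symbols of a segment are computed from driver variables. -/
inductive Gen where
  /-- `b + i % t` -/
  | up (b t : ℕ)
  /-- `b - i % t` -/
  | down (b t : ℕ)
  /-- `inp[q + i] + b` -/
  | copy (q b : ℕ)

/-- The `i`-th symbol. -/
def Gen.value (inp : List ℕ) (ρ : ℕ → ℕ) : Gen → ℕ → ℕ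
  | .up b t, i => ρ b + i % ρ t
  | .down b t, i => ρ b - i % ρ t
  | .copy q b, i => inp.getD (ρ q + i) 0 + ρ b

/-- Code that computes the symbol into register `45`. -/
def Gen.code : Gen → List Instr
  | .up b t => [.op .mod 45 72 (9 * t), .op .add 45 45 (9 * b)]
  | .down b t => [.op .mod 45 72 (9 * t), .op .sub 45 (9 * b) 45]
  | .copy q b => [.op .add 45 (9 * q) 72, .load 45 45, .op .add 45 45 (9 * b)]

/-- The variables of a segment are not scratch variables. -/
def Gen.Ok : Gen → Prop
  | .up b t => (b < 4 ∨ 8 < b) ∧ (t < 4 ∨ 8 < t)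
  | .down b t => (b < 4 ∨ 8 < b) ∧ (t < 4 ∨ 8 < t)
  | .copy q b => (q < 4 ∨ 8 < q) ∧ (b < 4 ∨ 8 < b)

/-- A copied segment lies within the input. -/
def Gen.Legal (N : ℕ) (ρ : ℕ → ℕ) : Gen → Prop
  | .copy q _ => ρ q + N ≤ ρ 12
  | _ => True

theorem Gen.plain (g : Gen) : ∀ i ∈ g.code, i.Plain := by
  cases g <;> simp [Gen.code, Instr.Plain]

theorem Gen.code_length_le (g : Gen) : g.code.length ≤ 3 := by
  cases g <;> simp [Gen.code]

/-- Driver commands: arithmetic on variables, and appending a segment to the current tape. -/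
inductive Cmd where
  | op (o : BinOp) (d a b : ℕ)
  | const (d c : ℕ)
  | seg (c : ℕ) (g : Gen)

/-- Effect of a command on the tape and the variables. -/
def Cmd.exec (inp : List ℕ) : Cmd → List ℕ × (ℕ → ℕ) → List ℕ × (ℕ → ℕ)
  | .op o d a b, s => (s.1, Function.update s.2 d (o.eval (s.2 a) (s.2 b)))
  | .const d c, s => (s.1, Function.update s.2 d c)
  | .seg c g, s => (s.1 ++ (List.range (s.2 c)).map (g.value inp s.2), s.2)

/-- Code of a command. -/
def Cmd.block : Cmd → Block
  | .op o d a b => Block.line [.op o (9 * d) (9 * a) (9 * b)]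
  | .const d c => Block.line [.const (9 * d) c]
  | .seg c g => (Block.line [.op .add 63 (9 * c) 9]).seq (Block.fill g.code)

/-- Static conditions on a command. -/
def Cmd.Ok : Cmd → Prop
  | .op o d a b => (Instr.op o 0 0 0).Plain ∧ 12 < d ∧ (a < 4 ∨ 8 < a) ∧ (b < 4 ∨ 8 < b)
  | .const d c => 12 < d ∧ c ≤ 10
  | .seg c g => (c < 4 ∨ 8 < c) ∧ g.Ok

/-- Dynamic conditions on a command. -/
def Cmd.Legal (ρ : ℕ → ℕ) : Cmd → Prop
  | .seg c g => g.Legal (ρ c) ρ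
  | _ => True

/-- Variables up to `12` are reserved: the constants `0, 1, 9` in `1, 2, 3`, scratch in `4, …, 8`,
sizes obtained from the input in `9, 10, 11`, and in `12` the address where the virtual memories
begin. -/
theorem Base.set {inp : List ℕ} {c d v : ℕ} {ρ : ℕ → ℕ} {s : Store} (h : Base inp c ρ s)
    (hc : 1 ≤ c) (hd : 12 < d) :
    Base inp c (Function.update ρ d v) (Function.update s.1 (9 * d) v, s.2) where
  env w hw := by
    simp only [Function.update_apply]
    by_cases hwd : w = d
    · simp [hwd]
    · rw [if_neg (by omega), if_neg hwd, h.env w hw]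
  zero := by rw [Function.update_of_ne (by omega), h.zero]
  one := by rw [Function.update_of_ne (by omega), h.one]
  nine := by rw [Function.update_of_ne (by omega), h.nine]
  length_le := by rw [Function.update_of_ne (by omega)]; exact h.length_le
  input a ha := by rw [Function.update_of_ne (by omega)] at ha; exact h.input a ha
  mem r a h1 h9 := by rw [Function.update_of_ne (by omega)]; exact h.mem r a h1 h9
  reg r i h1 h9 := by
    simp only; rw [Function.update_of_ne (by omega)]; exact h.reg r i h1 h9

theorem Tape.set {r d v : ℕ} {l : List ℕ} {ρ : ℕ → ℕ} {s : Store} (h : Tape r l ρ s)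
    (hr : 1 ≤ r) (hr9 : r < 9) (hd : 12 < d) :
    Tape r l (Function.update ρ d v) (Function.update s.1 (9 * d) v, s.2) where
  base := by
    simp only; rw [Function.update_of_ne (by omega), Function.update_of_ne (by omega), h.base]
  ptr := by
    simp only; rw [Function.update_of_ne (by omega), Function.update_of_ne (by omega), h.ptr]
  mem a := by rw [Function.update_of_ne (by omega)]; exact h.mem a
  reg i := by simp only; rw [Function.update_of_ne (by omega)]; exact h.reg i

theorem getD_append_map {l : List ℕ} {g : ℕ → ℕ} {N a : ℕ} :
    (l ++ (List.range N).map g).getD a 0 =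
      if l.length ≤ a ∧ a < l.length + N then g (a - l.length) else l.getD a 0 := by
  rcases lt_or_ge a l.length with h | h
  · rw [List.getD_append _ _ _ _ h, if_neg (by omega)]
  · rw [List.getD_append_right _ _ _ _ h]
    by_cases h' : a < l.length + N
    · rw [if_pos ⟨h, h'⟩, List.getD_eq_getElem _ _ (by simp; omega)]; simp
    · rw [if_neg (by omega), List.getD_eq_default _ _ (by simp; omega),
        List.getD_eq_default _ _ h]

/-- The cells written lie beyond the input and in the residue class of machine `r`, so the input and
the fresh machines remain untouched. A symbol costs at most three instructions of its generator plus
seven of the loop. -/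
theorem seg_spec {inp l : List ℕ} {r c M : ℕ} {ρ : ℕ → ℕ} {s : Store} {g : Gen} (hr : 1 ≤ r)
    (hr9 : r < 9) (hM : 10 ≤ M) (hs : s.LE M) (hb : Base inp (r + 1) ρ s) (ht : Tape r l ρ s)
    (hok : (Cmd.seg c g).Ok) (hleg : (Cmd.seg c g).Legal ρ) :
    (Cmd.seg c g).block.Spec M (10 * ρ c + 4) s fun s' => Base inp (r + 1) ρ s' ∧
      Tape r (l ++ (List.range (ρ c)).map (g.value inp ρ)) ρ s' := by
  obtain ⟨hc, hg⟩ := hok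
  have hz : s.1 9 = 0 := by rw [← hb.zero, ← hb.env 1 (by omega)]
  set s₁ : Store := (Function.update s.1 63 (ρ c), s.2) with hs₁
  have h1 : (Block.line [.op .add 63 (9 * c) 9]).Spec M 1 s (fun s' => s' = s₁) :=
    Block.line_spec (by simp [Instr.Plain]) hM hs (by
      simp [BinOp.eval, hz, hb.env c hc, hs₁])
  refine (h1.seq (by omega) (T₂ := 10 * ρ c + 3) ?_).imp (by omega) fun _ h => h
  rintro _ hle rfl
  have hb1 : Base inp (r + 1) ρ s₁ := hb.congr rfl (fun i hi => by
    simp only [hs₁]; rw [Function.update_of_ne (hi 7 (by omega) (by omega))]) (by omega)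
  have ht1 : Tape r l ρ s₁ := ⟨by simp [hs₁, ht.base], by simp [hs₁, ht.ptr], ht.mem, fun i => by
    simp only [hs₁]; rw [Function.update_of_ne (by omega), ht.reg]⟩
  have e63 : s₁.1 63 = ρ c := by simp [hs₁]
  set M' := M ^ (Block.line [.op .add 63 (9 * c) 9]).growth with hM'
  have hM2 : 10 ≤ M' := hM.trans (Nat.le_self_pow (Block.pos _).ne' M)
  have hreg : ∀ v, v < 4 ∨ 8 < v → ∀ k N, (fillState s₁ (g.value inp ρ) N k).1 (9 * v) = ρ v := by
    intro v hv k N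
    simp only [fillState]
    rw [Function.update_of_ne (by omega), Function.update_of_ne (by omega),
      Function.update_of_ne (by omega), Function.update_of_ne (by omega), hb1.env v hv]
  have h72 : ∀ k N, (fillState s₁ (g.value inp ρ) N k).1 72 = k := by
    intro k N; simp [fillState]
  have hin : ∀ a < ρ 12, ∀ k N, (fillState s₁ (g.value inp ρ) N k).2 a = inp.getD a 0 := by
    intro a ha k N
    simp only [fillState]
    rw [fillMem_of_ne (fun i _ => by rw [ht1.ptr]; omega), hb1.input a ha]
  have hgle : ∀ k < s₁.1 63, g.value inp ρ k ≤ M' ^ 3 := by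
    intro k hk
    have hk' : k ≤ M' := hk.le.trans (hle.1 63)
    have hρ : ∀ v, v < 4 ∨ 8 < v → ρ v ≤ M' := fun v hv => by
      rw [← hb1.env v hv]; exact hle.1 _
    have h2 : M' + M' ≤ M' ^ 3 := by nlinarith [Nat.mul_le_mul hM2 hM2]
    cases g with
    | up b t =>
      have := Nat.mod_le k (ρ t)
      have := hρ b hg.1
      simp only [Gen.value]; omega
    | down b t =>
      have := hρ b hg.1
      simp only [Gen.value]; omega
    | copy q b =>
      have := hρ b hg.2
      have h3 : inp.getD (ρ q + k) 0 ≤ M' := by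
        rw [← hb1.input _ (by simp only [Cmd.Legal, Gen.Legal] at hleg; omega)]; exact hle.2 _
      simp only [Gen.value]; omega
  refine (Block.fill_spec (g := g.value inp ρ) g.plain hM2 hle ?_ ?_ ?_ ?_ hgle
    (Q := fun s' => Base inp (r + 1) ρ s' ∧
      Tape r (l ++ (List.range (ρ c)).map (g.value inp ρ)) ρ s') ⟨?_, ?_⟩).imp ?_ fun _ h => h
  · exact (hb1.env 2 (by omega)).trans hb1.one
  · exact (hb1.env 3 (by omega)).trans hb1.nine
  · exact (hb1.env 1 (by omega)).trans hb1.zero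
  · intro k hk
    cases g with
    | up b t =>
      simp only [Gen.code, lineAct_cons, lineAct_nil, act_op, BinOp.eval, h72,
        Function.update_self, hreg t hg.2, Function.update_of_ne (show 9 * b ≠ 45 by
          have := hg.1; omega), hreg b hg.1, Function.update_idem, Gen.value]
      rw [add_comm]
    | down b t =>
      simp only [Gen.code, lineAct_cons, lineAct_nil, act_op, BinOp.eval, h72,
        Function.update_self, hreg t hg.2, Function.update_of_ne (show 9 * b ≠ 45 by
          have := hg.1; omega), hreg b hg.1, Function.update_idem, Gen.value]
    | copy q b =>
      have : ρ q + k < ρ 12 := by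
        simp only [Cmd.Legal, Gen.Legal] at hleg; omega
      simp only [Gen.code, lineAct_cons, lineAct_nil, act_op, act_load, BinOp.eval, h72,
        Function.update_self, hreg q hg.1, Function.update_of_ne (show 9 * b ≠ 45 by
          have := hg.2; omega), hreg b hg.2, Function.update_idem, Gen.value, hin _ this]
  · have hmem : ∀ a, (∀ k, a ≠ 9 * k + (ρ 12 + r)) →
        (fillState s₁ (g.value inp ρ) (s₁.1 63) (s₁.1 63)).2 a = s₁.2 a := fun a ha => by
      simp only [fillState]
      rw [fillMem_of_ne fun i _ => by rw [ht1.ptr]; have := ha (l.length + i); omega]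
    exact
    { env := fun v hv => hreg v hv _ _
      zero := hb1.zero
      one := hb1.one
      nine := hb1.nine
      length_le := hb1.length_le
      input := fun a ha => hin a ha _ _
      mem := fun r' a h1 h9 => by rw [hmem _ fun k => by omega, hb1.mem r' a h1 h9]
      reg := fun r' i h1 h9 => by
        simp only [fillState]
        rw [Function.update_of_ne (by omega), Function.update_of_ne (by omega),
          Function.update_of_ne (by omega), Function.update_of_ne (by omega), hb1.reg r' i h1 h9] }
  · exact
    { base := by simp [fillState, ht1.base]
      ptr := by simp [fillState, ht1.ptr, e63]; ring
      mem := fun a => by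
        rw [getD_append_map, e63]
        simp only [fillState]
        split_ifs with ha
        · have : 9 * a + (ρ 12 + r) = s₁.1 54 + 9 * (a - l.length) := by rw [ht1.ptr]; omega
          rw [this, fillMem_of_lt (by omega)]
        · rw [fillMem_of_ne fun i hi => by rw [ht1.ptr]; omega, ht1.mem]
      reg := fun i => by
        simp only [fillState]
        rw [Function.update_of_ne (by omega), Function.update_of_ne (by omega),
          Function.update_of_ne (by omega), Function.update_of_ne (by omega), ht1.reg] }
  · rw [e63]
    have := g.code_length_le
    have := Nat.mul_le_mul_left (ρ c) (show g.code.length + 7 ≤ 10 by omega)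
    omega

/-- A list of commands. -/
def cmdsBlock : List Cmd → Block
  | [] => Block.skip
  | c :: l => c.block.seq (cmdsBlock l)

/-- Effect of a list of commands. -/
def cmdsExec (inp : List ℕ) (cs : List Cmd) (s : List ℕ × (ℕ → ℕ)) : List ℕ × (ℕ → ℕ) :=
  cs.foldl (fun s c => c.exec inp s) s

/-- Dynamic conditions on a list of commands. -/
def cmdsLegal (inp : List ℕ) : List Cmd → List ℕ × (ℕ → ℕ) → Prop
  | [], _ => True
  | c :: cs, s => c.Legal s.2 ∧ cmdsLegal inp cs (c.exec inp s)

theorem Cmd.length_exec (inp : List ℕ) (c : Cmd) (s : List ℕ × (ℕ → ℕ)) :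
    s.1.length ≤ (c.exec inp s).1.length := by
  cases c <;> simp [Cmd.exec]

theorem length_cmdsExec (inp : List ℕ) (cs : List Cmd) (s : List ℕ × (ℕ → ℕ)) :
    s.1.length ≤ (cmdsExec inp cs s).1.length := by
  induction cs generalizing s with
  | nil => exact le_rfl
  | cons c cs ih => exact (c.length_exec inp s).trans (ih _)

theorem cmd_spec {inp l : List ℕ} {r M : ℕ} {ρ : ℕ → ℕ} {s : Store} {c : Cmd} (hr : 1 ≤ r)
    (hr9 : r < 9) (hM : 10 ≤ M) (hs : s.LE M) (hb : Base inp (r + 1) ρ s) (ht : Tape r l ρ s)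
    (hok : c.Ok) (hleg : c.Legal ρ) :
    c.block.Spec M (10 * ((c.exec inp (l, ρ)).1.length - l.length) + 4) s fun s' =>
      Base inp (r + 1) (c.exec inp (l, ρ)).2 s' ∧
      Tape r (c.exec inp (l, ρ)).1 (c.exec inp (l, ρ)).2 s' := by
  cases c with
  | op o d a b =>
    obtain ⟨hp, hd, ha, hb'⟩ := hok
    refine (Block.line_spec (l := [.op o (9 * d) (9 * a) (9 * b)]) ?_ hM hs ?_).imp
      (by simp) fun _ h => h
    · simp only [List.mem_singleton, forall_eq]; revert hp; cases o <;> exact id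
    · simp only [lineAct_cons, lineAct_nil, act_op, hb.env a ha, hb.env b hb']
      exact ⟨hb.set (by omega) hd, ht.set hr hr9 hd⟩
  | const d v =>
    obtain ⟨hd, hv⟩ := hok
    refine (Block.line_spec (l := [.const (9 * d) v]) ?_ hM hs ?_).imp
      (by simp) fun _ h => h
    · simpa [Instr.Plain] using hv
    · simp only [lineAct_cons, lineAct_nil, act_const]
      exact ⟨hb.set (by omega) hd, ht.set hr hr9 hd⟩
  | seg c g =>
    exact (seg_spec hr hr9 hM hs hb ht hok hleg).imp (by simp [Cmd.exec]) fun _ h => h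

/-- The costs telescope: up to a constant per command, the time is ten times the number of symbols
written. -/
theorem cmds_spec {inp l : List ℕ} {r M : ℕ} {ρ : ℕ → ℕ} {s : Store} {cs : List Cmd} (hr : 1 ≤ r)
    (hr9 : r < 9) (hM : 10 ≤ M) (hs : s.LE M) (hb : Base inp (r + 1) ρ s) (ht : Tape r l ρ s)
    (hok : ∀ c ∈ cs, c.Ok) (hleg : cmdsLegal inp cs (l, ρ)) :
    (cmdsBlock cs).Spec M
      (10 * ((cmdsExec inp cs (l, ρ)).1.length - l.length) + 4 * cs.length) s fun s' =>
      Base inp (r + 1) (cmdsExec inp cs (l, ρ)).2 s' ∧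
      Tape r (cmdsExec inp cs (l, ρ)).1 (cmdsExec inp cs (l, ρ)).2 s' := by
  induction cs generalizing s M l ρ with
  | nil => exact (Block.skip_spec hs ⟨hb, ht⟩).imp (by simp) fun _ h => h
  | cons c cs ih =>
    have h1 := cmd_spec hr hr9 hM hs hb ht (hok c (by simp)) hleg.1
    have hl := c.length_exec inp (l, ρ)
    have hl' := length_cmdsExec inp cs (c.exec inp (l, ρ))
    refine (h1.seq (by omega) fun s₁ hle h => ih (hM.trans (Nat.le_self_pow (Block.pos _).ne' M))
      hle h.1 h.2 (fun c hc => hok c (by simp [hc])) hleg.2).imp ?_ fun _ h => h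
    have : cmdsExec inp (c :: cs) (l, ρ) = cmdsExec inp cs (c.exec inp (l, ρ)) := rfl
    rw [this, List.length_cons]
    generalize (cmdsExec inp cs (c.exec inp (l, ρ))).1.length = x at *
    simp only at *
    omega

/-! ### Opening and calling virtual machines -/

/-- Code that makes `r` the current virtual machine. -/
def openBlock (r : ℕ) : Block :=
  Block.line [.const 45 r, .op .add 36 108 45, .op .add 54 36 9]

theorem open_spec {inp : List ℕ} {r M : ℕ} {ρ : ℕ → ℕ} {s : Store} (hr : 1 ≤ r)
    (hr9 : r < 9) (hM : 10 ≤ M) (hs : s.LE M) (hb : Base inp r ρ s) :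
    (openBlock r).Spec M 3 s fun s' => Base inp (r + 1) ρ s' ∧ Tape r [] ρ s' := by
  refine Block.line_spec (by simp [Instr.Plain]; omega) hM hs ?_
  have hz : s.1 9 = 0 := by rw [← hb.zero, ← hb.env 1 (by omega)]
  have hB : s.1 108 = ρ 12 := by rw [← hb.env 12 (by omega)]
  simp only [lineAct_cons, lineAct_nil, act_const, act_op, BinOp.eval, Function.update_self,
    Function.update_of_ne (show (108 : ℕ) ≠ 45 by norm_num),
    Function.update_of_ne (show (9 : ℕ) ≠ 45 by norm_num),
    Function.update_of_ne (show (9 : ℕ) ≠ 36 by norm_num), hz, hB, add_zero]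
  have hr' : ∀ i, (∀ v, 4 ≤ v → v ≤ 8 → i ≠ 9 * v) →
      Function.update (Function.update (Function.update s.1 45 r) 36 (ρ 12 + r)) 54 (ρ 12 + r) i
        = s.1 i := fun i hi => by
    rw [Function.update_of_ne (hi 6 (by omega) (by omega)),
      Function.update_of_ne (hi 4 (by omega) (by omega)),
      Function.update_of_ne (hi 5 (by omega) (by omega))]
  refine ⟨?_, by simp, by simp, fun a => by simpa using hb.mem r a le_rfl hr9, fun i => ?_⟩
  · have := hb.congr (s' := (Function.update (Function.update (Function.update s.1 45 r) 36
      (ρ 12 + r)) 54 (ρ 12 + r), s.2)) rfl hr' hr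
    exact ⟨this.env, this.zero, this.one, this.nine, this.length_le, this.input,
      fun r' a h1 => this.mem r' a (by omega), fun r' i h1 => this.reg r' i (by omega)⟩
  · simp only
    rw [hr' _ fun v _ _ => by omega, hb.reg r i le_rfl hr9]

/-- Run the program `P` on the current virtual machine `r`, and store its result in variable `d`. -/
def callBlock (d r : ℕ) (P : Program) : Block :=
  Block.seq ⟨fun o => translate r o P, 2, two_pos⟩ (Block.line [.op .add (9 * d) r 9])

/-- A tape together with fresh registers is exactly the initial configuration of `P` on `l`, so the
simulation applies. The result stands in virtual register `0`, which is physical register `r`. -/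
theorem call_spec {inp l : List ℕ} {r d M t : ℕ} {ρ : ℕ → ℕ} {s : Store} {P : Program} (hr : 1 ≤ r)
    (hr9 : r < 9) (hd : 12 < d) (hM : 10 ≤ M) (hs : s.LE M) (hb : Base inp (r + 1) ρ s)
    (ht : Tape r l ρ s) (hhalt : P.length ≤ (run P l t).pc)
    (hle : ∀ u ≤ t, (run P l u).WordsLE M) :
    (callBlock d r P).Spec M (3 * t + 1) s
      (Base inp (r + 1) (Function.update ρ d ((run P l t).reg 0))) := by
  have hsim : Simulates r s (initial l) s :=
    ⟨fun i => by rw [ht.reg]; rfl, fun a => by rw [ht.base, ht.mem]; rfl, fun _ _ _ => rfl,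
      fun _ _ => rfl⟩
  have h27 : s.1 27 = 9 := (hb.env 3 (by omega)).trans hb.nine
  have hM2 : M ≤ M ^ 2 := Nat.le_self_pow (by norm_num) M
  have h1 : Block.Spec ⟨fun o => translate r o P, 2, two_pos⟩ M (3 * t) s
      (Simulates r s (run P l t)) := fun Q o hQ => by
    obtain ⟨s₂, h2, h45, h3⟩ := simulate_run hr hr9 hQ hM hs h27 hsim rfl t hle
    refine ⟨s₂, h2, h2.le (hs.mono hM2) ?_ h45, ?_⟩
    · exact ⟨fun i => ((hle t le_rfl).1 i).trans hM2, fun i => ((hle t le_rfl).2 i).trans hM2⟩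
    · have e : min ((step P)^[t] (initial l)).pc P.length = P.length := min_eq_right hhalt
      rw [e] at h3
      simpa [length_translate] using h3
  refine h1.seq (by omega) fun s₁ hle₁ h₁ => ?_
  have hb1 : Base inp (r + 1) ρ s₁ :=
    { env := fun v hv => by rw [h₁.reg_frame _ (by omega) (by omega), hb.env v hv]
      zero := hb.zero
      one := hb.one
      nine := hb.nine
      length_le := hb.length_le
      input := fun a ha => by
        rw [h₁.mem_frame a fun k => by rw [ht.base]; omega, hb.input a ha]
      mem := fun r' a hr1 hr2 => by
        rw [h₁.mem_frame _ fun k => by rw [ht.base]; omega, hb.mem r' a hr1 hr2]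
      reg := fun r' i hr1 hr2 => by
        rw [h₁.reg_frame _ (by omega) (by omega), hb.reg r' i hr1 hr2] }
  refine (Block.line_spec (l := [.op .add (9 * d) r 9]) (by simp [Instr.Plain])
    (hM.trans hM2) hle₁ ?_).imp (by simp) fun _ h => h
  have h0 := h₁.reg 0
  rw [mul_zero, zero_add] at h0
  have hz : s₁.1 9 = 0 := (hb1.env 1 (by omega)).trans hb1.zero
  simp only [lineAct_cons, lineAct_nil, act_op, BinOp.eval, h0, hz, add_zero]
  exact hb1.set (by omega) hd

/-- The initial store on a given input. -/
def initStore (input : List ℕ) : Store := (fun _ => 0, fun a => input.getD a 0)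

theorem initStore_le {input : List ℕ} {M : ℕ} (h : ∀ a ∈ input, a ≤ M) :
    (initStore input).LE M := by
  refine ⟨fun _ => Nat.zero_le _, fun a => ?_⟩
  rcases lt_or_ge a input.length with ha | ha
  · simp only [initStore]
    rw [List.getD_eq_getElem _ _ ha]; exact h _ (List.getElem_mem ha)
  · simp only [initStore]
    rw [List.getD_eq_default _ _ ha]; exact Nat.zero_le _

theorem Block.hasAlgorithm (f : Block) {Q : Problem} {β : ℝ} {C k : ℕ}
    (h : ∀ I : Q.Inst, ∃ M T : ℕ, M ≤ C * (max (Q.size I) 1) ^ k ∧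
      (T : ℝ) ≤ C * (max (Q.size I) 1 : ℕ) ^ β ∧
      f.Spec M T (initStore (Q.input I)) fun s => s.1 0 = Q.answer I) : HasAlgorithm Q β := by
  -- The summand `C ^ f.growth` pays for the words, the summand `C` for the time.
  refine ⟨f.code 0, C ^ f.growth + C, k * f.growth, fun I => ?_⟩
  obtain ⟨M, T, hM, hT, hf⟩ := h I
  obtain ⟨s', hs', -, t, ht, e, hw⟩ := hf (f.code 0) 0 fun k _ => by simp
  set N := max (Q.size I) 1 with hN
  have e' : run (f.code 0) (Q.input I) t = s'.at (0 + (f.code 0).length) := e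
  refine ⟨t, ?_, ?_, ?_, fun u hu => ?_⟩
  · have hN0 : (0 : ℝ) ≤ (N : ℝ) ^ β := by positivity
    have : (t : ℝ) ≤ T := by exact_mod_cast ht
    push_cast
    nlinarith [show (0 : ℝ) ≤ (C : ℝ) ^ f.growth by positivity]
  · rw [e']; simp [Store.at]
  · rw [e']; exact hs'
  · have hb : M ^ f.growth ≤ (C ^ f.growth + C) * N ^ (k * f.growth) := by
      calc M ^ f.growth ≤ (C * N ^ k) ^ f.growth := Nat.pow_le_pow_left hM _
        _ = C ^ f.growth * N ^ (k * f.growth) := by rw [mul_pow, pow_mul]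
        _ ≤ _ := Nat.mul_le_mul_right _ (by omega)
    exact ⟨fun i => ((hw u hu).1 i).trans hb, fun a => ((hw u hu).2 a).trans hb⟩

theorem Base.of_init {inp : List ℕ} {s : Store} (hm : s.2 = fun a => inp.getD a 0)
    (hr : ∀ i, i % 9 ≠ 0 → s.1 i = 0) (h9 : s.1 9 = 0) (h18 : s.1 18 = 1) (h27 : s.1 27 = 9)
    (h108 : inp.length ≤ s.1 108) : Base inp 1 (fun v => s.1 (9 * v)) s where
  env _ _ := rfl
  zero := h9
  one := h18
  nine := h27
  length_le := h108
  input a _ := by rw [hm]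
  mem r a _ _ := by rw [hm]; exact List.getD_eq_default _ _ (by
    change inp.length ≤ 9 * a + (s.1 108 + r)
    omega)
  reg r i _ _ := hr _ (by omega)

theorem map_range_getD_append (a l : List ℕ) (T : ℕ) :
    (List.range l.length).map (fun i => (a ++ l).getD (a.length + i) 0 + T) = l.map (· + T) := by
  refine List.ext_getElem (by simp) fun i h1 h2 => ?_
  simp only [List.getElem_map, List.getElem_range]
  rw [List.getD_append_right _ _ _ _ (by omega), Nat.add_sub_cancel_left,
    List.getD_eq_getElem _ _ (by simpa using h2)]

theorem size_le_length {x : List ℕ} {s : ℕ} (h : ∀ a, a ∈ x ↔ a < s) : s ≤ x.length := by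
  have : Finset.range s ⊆ x.toFinset := fun a ha => by simpa [h] using ha
  simpa using (Finset.card_le_card this).trans x.toFinset_card_le

theorem IsStringPair.mem_lt {x y : List ℕ} (h : IsStringPair x y) {a : ℕ}
    (ha : a ∈ x ++ y) : a < x.length := by
  obtain ⟨-, s, hx, hy⟩ := h
  have := size_le_length hx
  rcases List.mem_append.1 ha with h | h
  · exact ((hx a).1 h).trans_le this
  · exact ((hy a).1 h).trans_le this

/-! ### The exact problem reduces to its downward closure -/

/-- Initialisation on an input `lx, ly, x, y`. -/
def exactInit : List Instr :=
  [.const 18 1, .const 27 9, .load 81 9, .load 90 18, .op .add 99 81 90, .const 45 2,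
    .op .add 108 99 45]

/-- Writing the sequence `lx, lx, ly, x, y`. -/
def exactCmds : List Cmd :=
  [.const 13 2, .seg 2 (.up 9 2), .seg 2 (.up 9 2), .seg 2 (.up 10 2), .seg 11 (.copy 13 1)]

/-- Prepend the length of the first string to the input, and run `P`. -/
def exactBlock (P : Program) : Block :=
  (Block.line exactInit).seq <| (openBlock 1).seq <| (cmdsBlock exactCmds).seq <|
    (callBlock 14 1 P).seq <| Block.line [.op .add 0 126 9]

theorem exact_of_closure {γ β : ℝ} {α : Param → ℝ} (hγ : 1 ≤ γ) (hβ : 1 ≤ β)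
    (h : HasAlgorithm (closureLCS γ α) β) : HasAlgorithm (exactLCS γ α) β := by
  obtain ⟨P, C, k, hP⟩ := h
  refine (exactBlock P).hasAlgorithm (C := 3 * C + 90) (k := k + 1) ?_
  rintro ⟨⟨x, y⟩, hI⟩
  have hI' : (x.length, x, y) ∈ closureInstances γ α :=
    ⟨hI.1, le_mul_of_one_le_left (by positivity) hγ, fun p => by
      rw [mul_comm]; exact (hI.2 p).2⟩
  obtain ⟨t, ht, hhalt, hans, hw⟩ := hP ⟨_, hI'⟩
  simp only [closureLCS, exactLCS] at ht hhalt hans hw ⊢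
  have hyx : y.length ≤ x.length := hI.1.1
  set N := max x.length 1 with hN
  have hN1 : 1 ≤ N := le_max_right _ _
  set M := (3 * C + 90) * N ^ (k + 1) with hM
  have hMW : C * N ^ k ≤ M := Nat.mul_le_mul (by omega) (Nat.pow_le_pow_right hN1 (by omega))
  have hMN : 90 * N ≤ M := Nat.mul_le_mul (by omega) (Nat.le_self_pow (by omega) N)
  have hM10 : 10 ≤ M := by omega
  have hNx : x.length ≤ N := le_max_left _ _
  set inp := x.length :: y.length :: (x ++ y) with hinp
  have hlen : inp.length = x.length + y.length + 2 := by simp [hinp]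
  refine ⟨M, 7 + (3 + ((10 * (x.length + y.length + 3) + 20) + ((3 * t + 1) + 1))), le_rfl, ?_, ?_⟩
  · have h1 : (N : ℝ) ≤ (N : ℝ) ^ β := Real.self_le_rpow_of_one_le (by exact_mod_cast hN1) hβ
    have h2 : (7 + (3 + ((10 * (x.length + y.length + 3) + 20) + ((3 * t + 1) + 1))) : ℝ) ≤
        3 * t + 90 * N := by
      have : 7 + (3 + ((10 * (x.length + y.length + 3) + 20) + ((3 * t + 1) + 1))) ≤
        3 * t + 90 * N := by omega
      exact_mod_cast this
    push_cast at ht ⊢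
    linarith
  have hs0 : (initStore inp).LE M := initStore_le fun a ha => by
    have : a ≤ x.length := by
      simp only [hinp, List.mem_cons] at ha
      rcases ha with rfl | rfl | ha
      · exact le_rfl
      · exact hyx
      · exact (hI.1.mem_lt ha).le
    omega
  refine (Block.line_spec (Q := fun s => Base inp 1 (fun v => s.1 (9 * v)) s ∧
      s.1 81 = x.length ∧ s.1 90 = y.length ∧ s.1 99 = x.length + y.length ∧
      s.1 108 = x.length + y.length + 2) (by simp [exactInit, Instr.Plain])
    hM10 hs0 ?_).seq (by omega) ?_
  · refine ⟨Base.of_init rfl (fun i hi => ?_) ?_ ?_ ?_ ?_, ?_, ?_, ?_, ?_⟩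
    · simp only [exactInit, lineAct_cons, lineAct_nil, act_const, act_op, act_load, initStore,
        Function.update_apply]
      repeat rw [if_neg (by omega)]
    all_goals simp [exactInit, initStore, BinOp.eval, hinp]
  rintro s₁ hs₁ ⟨hb, e9, e10, e11, e12⟩
  have up : ∀ {A : ℕ} (f : Block), M ≤ A → M ≤ A ^ f.growth := fun f h =>
    h.trans (Nat.le_self_pow f.pos.ne' _)
  have m1 := up (Block.line exactInit) le_rfl
  refine (open_spec le_rfl (by norm_num) (hM10.trans m1) hs₁ hb).seq (by omega) ?_
  rintro s₂ hs₂ ⟨hb2, ht2⟩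
  have m2 := up (openBlock 1) m1
  set ρ : ℕ → ℕ := fun v => s₁.1 (9 * v) with hρ
  have hleg : cmdsLegal inp exactCmds ([], ρ) := by
    simp [exactCmds, cmdsLegal, Cmd.Legal, Gen.Legal, Cmd.exec, hρ, e11, e12]
    omega
  -- Variable `2` holds one, so a segment of that length writes the value of a single variable. The
  -- strings start at cell two of the input.
  have htape : (cmdsExec inp exactCmds ([], ρ)).1 =
      x.length :: x.length :: y.length :: (x ++ y) := by
    have h18 : s₁.1 18 = 1 := hb.one
    have h9 : s₁.1 9 = 0 := hb.zero
    have := map_range_getD_append [x.length, y.length] (x ++ y) 0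
    simp only [List.length_append, List.length_cons, List.length_nil, zero_add,
      add_zero, List.map_id'] at this
    simp [exactCmds, cmdsExec, Cmd.exec, hρ, e9, e10, e11, h18, Gen.value]
    refine Eq.trans (List.map_congr_left fun i _ => ?_) this
    simp [Gen.value, h9, hinp]
  refine Block.Spec.seq (by omega) ((cmds_spec le_rfl (by norm_num) (hM10.trans m2) hs₂ hb2 ht2
    (by simp [exactCmds, Cmd.Ok, Gen.Ok]) hleg).imp ?_ fun _ h => h) ?_
  · rw [htape]; simp [exactCmds]
  rintro s₃ hs₃ ⟨hb3, ht3⟩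
  have m3 := up (cmdsBlock exactCmds) m2
  rw [htape] at ht3
  refine (call_spec le_rfl (by norm_num) (by norm_num) (hM10.trans m3) hs₃ hb3 ht3 hhalt
    fun u hu => ?_).seq (by omega) ?_
  · have := hw u hu
    exact ⟨fun i => (this.1 i).trans (hMW.trans m3), fun i => (this.2 i).trans (hMW.trans m3)⟩
  intro s₄ hs₄ hb4
  have m4 := up (callBlock 14 1 P) m3
  refine Block.line_spec (l := [.op .add 0 126 9]) (by simp [Instr.Plain]) (hM10.trans m4) hs₄ ?_
  have h14 := hb4.env 14 (by omega)
  have h9 : s₄.1 9 = 0 := (hb4.env 1 (by omega)).trans hb4.zero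
  simp only [Function.update_self] at h14
  simpa [BinOp.eval, h14, h9] using hans

/-! ### Longest common subsequences -/

section LCS
variable {x y x₁ x₂ y₁ y₂ z : List ℕ}

theorem length_le_lcsLen (hx : z.Sublist x) (hy : z.Sublist y) : z.length ≤ lcsLen x y :=
  (lcsLen_isGreatest x y).2 ⟨z, hx, hy, rfl⟩

theorem exists_lcs (x y : List ℕ) : ∃ z : List ℕ, z.Sublist x ∧ z.Sublist y ∧ z.length = lcsLen x y :=
  (lcsLen_isGreatest x y).1

theorem lcsLen_comm (x y : List ℕ) : lcsLen x y = lcsLen y x := by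
  apply le_antisymm
  · obtain ⟨z, h1, h2, h⟩ := exists_lcs x y
    exact h ▸ length_le_lcsLen h2 h1
  · obtain ⟨z, h1, h2, h⟩ := exists_lcs y x
    exact h ▸ length_le_lcsLen h2 h1

theorem lcsLen_le_left (x y : List ℕ) : lcsLen x y ≤ x.length := by
  obtain ⟨z, h1, h2, h⟩ := exists_lcs x y
  exact h ▸ h1.length_le

theorem lcsLen_le_right (x y : List ℕ) : lcsLen x y ≤ y.length := by
  rw [lcsLen_comm]; exact lcsLen_le_left y x

theorem lcsLen_mono (hx : x₁.Sublist x₂) (hy : y₁.Sublist y₂) : lcsLen x₁ y₁ ≤ lcsLen x₂ y₂ := by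
  obtain ⟨z, h1, h2, h⟩ := exists_lcs x₁ y₁
  exact h ▸ length_le_lcsLen (h1.trans hx) (h2.trans hy)

theorem lcsLen_of_sublist (h : y.Sublist x) : lcsLen x y = y.length :=
  le_antisymm (lcsLen_le_right x y) (length_le_lcsLen h (List.Sublist.refl y))

theorem lcsLen_eq_zero (h : ∀ a ∈ x, a ∉ y) : lcsLen x y = 0 := by
  obtain ⟨z, h1, h2, hz⟩ := exists_lcs x y
  rw [← hz, List.length_eq_zero_iff, List.eq_nil_iff_forall_not_mem]
  exact fun a ha => h a (h1.subset ha) (h2.subset ha)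

theorem lcsLen_map {f : ℕ → ℕ} (hf : Function.Injective f) (x y : List ℕ) :
    lcsLen (x.map f) (y.map f) = lcsLen x y := by
  apply le_antisymm
  · obtain ⟨z, h1, h2, h⟩ := exists_lcs (x.map f) (y.map f)
    obtain ⟨u, hu, rfl⟩ := List.sublist_map_iff.1 h1
    obtain ⟨v, hv, e⟩ := List.sublist_map_iff.1 h2
    have := List.map_injective_iff.2 hf e
    subst this
    rw [← h, List.length_map]
    exact length_le_lcsLen hu hv
  · obtain ⟨z, h1, h2, h⟩ := exists_lcs x y
    rw [← h, ← z.length_map (f := f)]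
    exact length_le_lcsLen (h1.map f) (h2.map f)

theorem add_lcsLen_le (x₁ x₂ y₁ y₂ : List ℕ) :
    lcsLen x₁ y₁ + lcsLen x₂ y₂ ≤ lcsLen (x₁ ++ x₂) (y₁ ++ y₂) := by
  obtain ⟨z, h1, h2, h⟩ := exists_lcs x₁ y₁
  obtain ⟨w, h3, h4, h'⟩ := exists_lcs x₂ y₂
  rw [← h, ← h', ← List.length_append]
  exact length_le_lcsLen (h1.append h3) (h2.append h4)

theorem lcsLen_append_left_le (x₁ x₂ y : List ℕ) :
    lcsLen (x₁ ++ x₂) y ≤ lcsLen x₁ y + lcsLen x₂ y := by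
  obtain ⟨z, h1, h2, h⟩ := exists_lcs (x₁ ++ x₂) y
  obtain ⟨u, v, rfl, hu, hv⟩ := List.sublist_append_iff.1 h1
  rw [← h, List.length_append]
  exact add_le_add (length_le_lcsLen hu ((List.sublist_append_left u v).trans h2))
    (length_le_lcsLen hv ((List.sublist_append_right u v).trans h2))

theorem lcsLen_append_right_le (x y₁ y₂ : List ℕ) :
    lcsLen x (y₁ ++ y₂) ≤ lcsLen x y₁ + lcsLen x y₂ := by
  rw [lcsLen_comm, lcsLen_comm x y₁, lcsLen_comm x y₂]
  exact lcsLen_append_left_le y₁ y₂ x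

/-- Cut a common subsequence at the border of the first string and at the border of the second one.
The shorter of the two tails is a suffix of the other, hence common to `b` and `c`; what remains
before it is common to one of the two pairs in the maximum. -/
theorem lcsLen_append_append_le (x b y c : List ℕ) :
    lcsLen (x ++ b) (y ++ c) ≤
      max (lcsLen x (y ++ c)) (lcsLen (x ++ b) y) + lcsLen b c := by
  obtain ⟨z, h1, h2, h⟩ := exists_lcs (x ++ b) (y ++ c)
  obtain ⟨z₁, z₂, e, hz1, hz2⟩ := List.sublist_append_iff.1 h1
  obtain ⟨z₃, z₄, e', hz3, hz4⟩ := List.sublist_append_iff.1 h2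
  rcases le_total z₂.length z₄.length with hl | hl
  · have : z₂ <:+ z₄ := List.suffix_of_suffix_length_le (l₃ := z) ⟨z₁, e.symm⟩ ⟨z₃, e'.symm⟩ hl
    have k1 := length_le_lcsLen hz2 (this.sublist.trans hz4)
    have k2 : z₁.length ≤ lcsLen x (y ++ c) := length_le_lcsLen hz1
      (((e ▸ List.sublist_append_left z₁ z₂) : z₁.Sublist z).trans h2)
    have : z.length = z₁.length + z₂.length := by rw [e, List.length_append]
    omega
  · have : z₄ <:+ z₂ := List.suffix_of_suffix_length_le (l₃ := z) ⟨z₃, e'.symm⟩ ⟨z₁, e.symm⟩ hl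
    have k1 := length_le_lcsLen (this.sublist.trans hz2) hz4
    have k2 : z₃.length ≤ lcsLen (x ++ b) y := length_le_lcsLen
      (((e' ▸ List.sublist_append_left z₃ z₄) : z₃.Sublist z).trans h1) hz3
    have : z.length = z₃.length + z₄.length := by rw [e', List.length_append]
    omega

/-- The same two cuts: the shorter of the two heads is common to `x` and `y`, and the corresponding
tail is no longer than `b` or `c`. -/
theorem lcsLen_append_le_add_max (x b y c : List ℕ) :
    lcsLen (x ++ b) (y ++ c) ≤ lcsLen x y + max b.length c.length := by
  obtain ⟨z, h1, h2, h⟩ := exists_lcs (x ++ b) (y ++ c)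
  obtain ⟨z₁, z₂, e, hz1, hz2⟩ := List.sublist_append_iff.1 h1
  obtain ⟨z₃, z₄, e', hz3, hz4⟩ := List.sublist_append_iff.1 h2
  have l1 : z.length = z₁.length + z₂.length := by rw [e, List.length_append]
  have l2 : z.length = z₃.length + z₄.length := by rw [e', List.length_append]
  have := hz2.length_le
  have := hz4.length_le
  rcases le_total z₁.length z₃.length with hl | hl
  · have : z₁ <+: z₃ := List.prefix_of_prefix_length_le (l₃ := z) ⟨z₂, e.symm⟩ ⟨z₄, e'.symm⟩ hl
    have k1 := length_le_lcsLen hz1 (this.sublist.trans hz3)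
    omega
  · have : z₃ <+: z₁ := List.prefix_of_prefix_length_le (l₃ := z) ⟨z₄, e'.symm⟩ ⟨z₂, e.symm⟩ hl
    have k1 := length_le_lcsLen (this.sublist.trans hz1) hz3
    omega

/-- Filtering a common subsequence by the symbols below and above `s` splits it into common
subsequences of the two parts. -/
theorem lcsLen_append_of_disjoint {s : ℕ} (hx₁ : ∀ a ∈ x₁, a < s) (hy₁ : ∀ a ∈ y₁, a < s)
    (hx₂ : ∀ a ∈ x₂, s ≤ a) (hy₂ : ∀ a ∈ y₂, s ≤ a) :
    lcsLen (x₁ ++ x₂) (y₁ ++ y₂) = lcsLen x₁ y₁ + lcsLen x₂ y₂ := by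
  refine le_antisymm ?_ (add_lcsLen_le _ _ _ _)
  obtain ⟨z, h1, h2, h⟩ := exists_lcs (x₁ ++ x₂) (y₁ ++ y₂)
  have f1 : ∀ {u v : List ℕ}, (∀ a ∈ u, a < s) → (∀ a ∈ v, s ≤ a) →
      (u ++ v).filter (· < s) = u ∧ (u ++ v).filter (s ≤ ·) = v := by
    intro u v hu hv
    rw [List.filter_append, List.filter_append]
    constructor
    · rw [List.filter_eq_self.2 (by simpa using hu), List.filter_eq_nil_iff.2 (by simpa using hv),
        List.append_nil]
    · rw [List.filter_eq_nil_iff.2 (by simpa using hu), List.filter_eq_self.2 (by simpa using hv),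
        List.nil_append]
  have g1 := h1.filter (· < s)
  have g2 := h2.filter (· < s)
  have g3 := h1.filter (s ≤ ·)
  have g4 := h2.filter (s ≤ ·)
  rw [(f1 hx₁ hx₂).1] at g1
  rw [(f1 hy₁ hy₂).1] at g2
  rw [(f1 hx₁ hx₂).2] at g3
  rw [(f1 hy₁ hy₂).2] at g4
  have k1 := length_le_lcsLen g1 g2
  have k2 := length_le_lcsLen g3 g4
  have k3 := List.length_eq_length_filter_add (l := z) (· < s)
  have : z.filter (fun a => !decide (a < s)) = z.filter (s ≤ ·) := by
    congr 1; funext a; rw [← decide_not]; simp only [not_lt]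
  rw [this] at k3
  omega

/-- A common subsequence has at most as many `a` as `y`, and its other symbols come from `x`. -/
theorem lcsLen_le_count_add (a : ℕ) (x y : List ℕ) :
    lcsLen x y ≤ y.count a + (x.filter (· ≠ a)).length := by
  obtain ⟨z, h1, h2, h⟩ := exists_lcs x y
  have k3 := List.length_eq_length_filter_add (l := z) (· = a)
  have k1 := h2.count_le a
  have k2 := (h1.filter (· ≠ a)).length_le
  have e1 : z.count a = (z.filter (· = a)).length := by
    rw [List.count, List.countP_eq_length_filter]; congr 1
  have e2 : z.filter (fun b => !decide (b = a)) = z.filter (· ≠ a) := by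
    congr 1; funext b; simp
  rw [e2] at k3
  omega

theorem min_count_le_lcsLen (a : ℕ) (x y : List ℕ) :
    min (x.count a) (y.count a) ≤ lcsLen x y := by
  have := length_le_lcsLen (z := List.replicate (min (x.count a) (y.count a)) a) (x := x) (y := y)
    (List.replicate_sublist_iff.2 (min_le_left _ _))
    (List.replicate_sublist_iff.2 (min_le_right _ _))
  simpa using this

/-! ### Dominant pairs -/

theorem table_mono {i i' j j' : ℕ} (hi : i ≤ i') (hj : j ≤ j') : table x y i j ≤ table x y i' j' :=
  lcsLen_mono ((List.take_prefix_take_left hi).sublist) ((List.take_prefix_take_left hj).sublist)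

theorem take_succ_eq {i : ℕ} (h : i < x.length) : x.take (i + 1) = x.take i ++ [x[i]] :=
  (List.take_append_getElem h).symm

theorem table_succ_le (i j : ℕ) : table x y (i + 1) j ≤ table x y i j + 1 := by
  rcases lt_or_ge i x.length with h | h
  · rw [table, table, take_succ_eq h]
    exact (lcsLen_append_left_le _ _ _).trans
      (Nat.add_le_add_left (lcsLen_le_left _ _) _)
  · rw [table, table, List.take_of_length_le (by omega), List.take_of_length_le h]; omega

/-- The set of dominant pairs. -/
noncomputable def domSet (x y : List ℕ) : Finset (ℕ × ℕ) :=
  (Finset.Icc 1 x.length ×ˢ Finset.Icc 1 y.length).filter fun q : ℕ × ℕ =>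
    table x y (q.1 - 1) q.2 < table x y q.1 q.2 ∧ table x y q.1 (q.2 - 1) < table x y q.1 q.2

theorem mem_domSet {i j : ℕ} : (i, j) ∈ domSet x y ↔ ((1 ≤ i ∧ i ≤ x.length) ∧ 1 ≤ j ∧ j ≤ y.length) ∧
    table x y (i - 1) j < table x y i j ∧ table x y i (j - 1) < table x y i j := by
  simp [domSet]

theorem card_domSet (x y : List ℕ) : (domSet x y).card = dominantPairs x y := rfl

/-- If the last symbols differ, they have no common subsequence, and by `lcsLen_append_append_le`
the entry equals one of its two neighbours. -/
theorem domSet_symbol {i j : ℕ} (h : (i, j) ∈ domSet x y) :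
    ∃ a, x[i - 1]? = some a ∧ y[j - 1]? = some a := by
  rw [mem_domSet] at h
  obtain ⟨⟨⟨hi1, hi⟩, hj1, hj⟩, h1, h2⟩ := h
  obtain ⟨i, rfl⟩ := Nat.exists_eq_add_of_le' hi1
  obtain ⟨j, rfl⟩ := Nat.exists_eq_add_of_le' hj1
  simp only [Nat.add_sub_cancel] at *
  refine ⟨x[i], by simp, ?_⟩
  rw [List.getElem?_eq_getElem (by omega)]
  by_contra hne
  have h0 : lcsLen [x[i]] [y[j]] = 0 := lcsLen_eq_zero (by
    simp only [List.mem_singleton, forall_eq]; intro h; exact hne (by rw [h]))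
  have := lcsLen_append_append_le (x.take i) [x[i]] (y.take j) [y[j]]
  rw [h0, ← take_succ_eq (by omega), ← take_succ_eq (by omega)] at this
  simp only [table] at h1 h2
  omega

theorem domSet_lt_of_lt_left {i i' j : ℕ} (h : (i', j) ∈ domSet x y) (hlt : i < i') :
    table x y i j < table x y i' j :=
  (table_mono (by omega) le_rfl).trans_lt (mem_domSet.1 h).2.1

theorem domSet_lt_of_lt_right {i j j' : ℕ} (h : (i, j') ∈ domSet x y) (hlt : j < j') :
    table x y i j < table x y i j' :=
  (table_mono le_rfl (by omega)).trans_lt (mem_domSet.1 h).2.2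

/-- Dominant pairs in one column carry distinct table values, and likewise in one row. All counting
arguments for upper bounds on `d` by value rest on this. -/
theorem domSet_inj_left {i i' j : ℕ} (h : (i, j) ∈ domSet x y) (h' : (i', j) ∈ domSet x y)
    (e : table x y i j = table x y i' j) : i = i' := by
  rcases lt_trichotomy i i' with hlt | rfl | hlt
  · have := domSet_lt_of_lt_left h' hlt; omega
  · rfl
  · have := domSet_lt_of_lt_left h hlt; omega

theorem domSet_inj_right {i j j' : ℕ} (h : (i, j) ∈ domSet x y) (h' : (i, j') ∈ domSet x y)
    (e : table x y i j = table x y i j') : j = j' := by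
  rcases lt_trichotomy j j' with hlt | rfl | hlt
  · have := domSet_lt_of_lt_right h' hlt; omega
  · rfl
  · have := domSet_lt_of_lt_right h hlt; omega

/-- A rectangle of the table whose last entry exceeds the two neighbouring corners contains a
dominant pair. -/
theorem exists_domSet {i₁ i₂ j₁ j₂ k : ℕ} (hi₂ : i₂ ≤ x.length) (hj₂ : j₂ ≤ y.length)
    (h1 : table x y i₁ j₂ < k) (h2 : table x y i₂ j₁ < k) (h : k ≤ table x y i₂ j₂) :
    ∃ i j, (i, j) ∈ domSet x y ∧ i₁ < i ∧ i ≤ i₂ ∧ j₁ < j ∧ j ≤ j₂ ∧ table x y i j = k := by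
  classical
  have ex : ∃ i, k ≤ table x y i j₂ := ⟨i₂, h⟩
  -- The pair sought: the first row reaching `k` in column `j₂`, then the first column reaching `k`
  -- in that row. As a row step raises the table by at most one, the value there is exactly `k`.
  set i := Nat.find ex with hi
  have hi' : k ≤ table x y i j₂ := Nat.find_spec ex
  have himin : ∀ l < i, table x y l j₂ < k := fun l hl => not_le.1 (Nat.find_min ex hl)
  have hii₂ : i ≤ i₂ := Nat.find_min' ex h
  have hi₁ : i₁ < i := by
    by_contra hc
    have := table_mono (x := x) (y := y) (not_lt.1 hc) (le_refl j₂)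
    omega
  have ex' : ∃ j, k ≤ table x y i j := ⟨j₂, hi'⟩
  set j := Nat.find ex' with hj
  have hj' : k ≤ table x y i j := Nat.find_spec ex'
  have hjmin : ∀ l < j, table x y i l < k := fun l hl => not_le.1 (Nat.find_min ex' hl)
  have hjj₂ : j ≤ j₂ := Nat.find_min' ex' hi'
  have hj₁ : j₁ < j := by
    by_contra hc
    have := table_mono (x := x) (y := y) hii₂ (not_lt.1 hc)
    omega
  have a1 : table x y (i - 1) j < k :=
    (table_mono le_rfl hjj₂).trans_lt (himin (i - 1) (by omega))
  have a2 : table x y i (j - 1) < k := hjmin _ (by omega)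
  have a3 : table x y i j ≤ table x y (i - 1) j + 1 := by
    have := table_succ_le (x := x) (y := y) (i - 1) j
    rwa [Nat.sub_add_cancel (by omega)] at this
  exact ⟨i, j, mem_domSet.2 ⟨⟨⟨by omega, by omega⟩, by omega, by omega⟩, by omega, by omega⟩, hi₁,
    hii₂, hj₁, hjj₂, by omega⟩

theorem table_length (x y : List ℕ) : table x y x.length y.length = lcsLen x y := by
  simp [table]

theorem table_le_lcsLen (i j : ℕ) : table x y i j ≤ lcsLen x y :=
  lcsLen_mono (List.take_sublist _ _) (List.take_sublist _ _)

/-- By `exists_domSet` for the whole table, every value from 1 to `L` is taken at some dominant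
pair. -/
theorem lcsLen_le_dominantPairs (x y : List ℕ) : lcsLen x y ≤ dominantPairs x y := by
  have key : ∀ k ∈ Finset.Icc 1 (lcsLen x y), ∃ q ∈ domSet x y, table x y q.1 q.2 = k := by
    intro k hk
    rw [Finset.mem_Icc] at hk
    have e1 : ∀ j, table x y 0 j = 0 := fun j => by
      rw [table]; exact Nat.le_zero.1 ((lcsLen_le_left _ _).trans (by simp))
    have e2 : ∀ i, table x y i 0 = 0 := fun j => by
      rw [table]; exact Nat.le_zero.1 ((lcsLen_le_right _ _).trans (by simp))
    obtain ⟨i, j, h, -, -, -, -, e⟩ := exists_domSet (i₁ := 0) (j₁ := 0) (k := k) (le_refl x.length)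
      (le_refl y.length) (by rw [e1]; omega) (by rw [e2]; omega) (by rw [table_length]; exact hk.2)
    exact ⟨(i, j), h, e⟩
  have : Finset.Icc 1 (lcsLen x y) ⊆ (domSet x y).image fun q => table x y q.1 q.2 :=
    fun k hk => Finset.mem_image.2 (key k hk)
  rw [← card_domSet]
  simpa using (Finset.card_le_card this).trans Finset.card_image_le

theorem domSet_table_pos {i j : ℕ} (h : (i, j) ∈ domSet x y) : 1 ≤ table x y i j :=
  Nat.one_le_iff_ne_zero.2 (Nat.ne_zero_of_lt (mem_domSet.1 h).2.1)

/-- A dominant pair is determined by its value and its column. -/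
theorem dominantPairs_le_mul_length (x y : List ℕ) :
    dominantPairs x y ≤ lcsLen x y * y.length := by
  have : (domSet x y).card ≤ (Finset.Icc 1 (lcsLen x y) ×ˢ Finset.Icc 1 y.length).card := by
    refine Finset.card_le_card_of_injOn (fun q => (table x y q.1 q.2, q.2)) ?_ ?_
    · rintro ⟨i, j⟩ h
      have h' := mem_domSet.1 h
      simp only [Finset.coe_product, Finset.coe_Icc, Set.mem_prod, Set.mem_Icc]
      exact ⟨⟨domSet_table_pos h, table_le_lcsLen i j⟩, h'.1.2⟩
    · rintro ⟨i, j⟩ h ⟨i', j'⟩ h' e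
      simp only [Prod.mk.injEq] at e
      obtain ⟨e1, rfl⟩ := e
      rw [domSet_inj_left h h' e1]
  rw [← card_domSet]
  simpa using this

/-- Cutting both strings after `j` symbols gives L ≤ L[j, j] + (n - j), so a diagonal entry falls
short of `j` by at most Δ. -/
theorem sub_le_table {j : ℕ} (hxy : y.length ≤ x.length) (hj : j ≤ y.length) :
    j ≤ table x y j j + (x.length - lcsLen x y) := by
  have := lcsLen_append_le_add_max (x.take j) (x.drop j) (y.take j) (y.drop j)
  rw [List.take_append_drop, List.take_append_drop, List.length_drop, List.length_drop] at this
  rw [table]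
  have h1 := lcsLen_le_left x y
  have h2 : max (x.length - j) (y.length - j) = x.length - j := max_eq_left (by omega)
  omega

/-- Encode a dominant pair by its side of the diagonal, by min(i, j) and by the deficit min(i, j) -
L[i, j]. By `sub_le_table` the deficit is at most Δ. The code determines the value and one
coordinate, hence the pair. -/
theorem dominantPairs_le_mul_delta (hxy : y.length ≤ x.length) :
    dominantPairs x y ≤ 2 * y.length * (x.length - lcsLen x y + 1) := by
  set D := x.length - lcsLen x y with hD
  have : (domSet x y).card ≤
      (Finset.range 2 ×ˢ Finset.Icc 1 y.length ×ˢ Finset.range (D + 1)).card := by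
    refine Finset.card_le_card_of_injOn
      (fun q => (if q.2 ≤ q.1 then 0 else 1, min q.1 q.2, min q.1 q.2 - table x y q.1 q.2)) ?_ ?_
    · rintro ⟨i, j⟩ h
      have h' := (mem_domSet.1 h).1
      have h3 := sub_le_table hxy (j := min i j) (by omega)
      have h4 := table_mono (x := x) (y := y) (min_le_left i j) (min_le_right i j)
      simp only [Finset.coe_product, Finset.coe_Icc, Set.mem_prod, Set.mem_Icc, Finset.coe_range,
        Set.mem_Iio]
      refine ⟨by split_ifs <;> omega, by omega, by omega⟩
    · rintro ⟨i, j⟩ h ⟨i', j'⟩ h' e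
      simp only [Prod.mk.injEq] at e
      obtain ⟨e1, e2, e3⟩ := e
      have t1 : table x y i j ≤ min i j := le_min
        ((lcsLen_le_left _ _).trans (by simp)) ((lcsLen_le_right _ _).trans (by simp))
      have t2 : table x y i' j' ≤ min i' j' := le_min
        ((lcsLen_le_left _ _).trans (by simp)) ((lcsLen_le_right _ _).trans (by simp))
      have e4 : table x y i j = table x y i' j' := by omega
      by_cases a1 : j ≤ i <;> by_cases a2 : j' ≤ i' <;> simp [a1, a2] at e1
      · rw [min_eq_right a1, min_eq_right a2] at e2
        subst e2
        rw [domSet_inj_left h h' e4]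
      · rw [min_eq_left (by omega), min_eq_left (by omega)] at e2
        subst e2
        rw [domSet_inj_right h h' e4]
  rw [← card_domSet]
  simpa [mul_assoc] using this

end LCS

section LCS
variable {x y x₁ x₂ y₁ y₂ z : List ℕ}

/-! ### Matching pairs -/

theorem card_filter_get_eq (a : ℕ) (y : List ℕ) :
    (Finset.univ.filter fun j : Fin y.length => a = y.get j).card = y.count a := by
  induction y with
  | nil => rfl
  | cons b y ih =>
    rw [List.count_cons, ← ih]
    have := Fin.card_filter_univ_succ (fun j : Fin (y.length + 1) => a = (b :: y).get j)
    simp only [List.length_cons] at this ⊢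
    rw [this]
    by_cases h : a = b
    · simp [h]
    · simp [h, Ne.symm h]

theorem matchingPairs_eq_sum (x y : List ℕ) :
    matchingPairs x y = (x.map fun a => y.count a).sum := by
  have h1 : matchingPairs x y = ∑ i : Fin x.length, y.count (x.get i) := by
    rw [matchingPairs, Finset.card_filter, Fintype.sum_prod_type]
    refine Finset.sum_congr rfl fun i _ => ?_
    rw [← card_filter_get_eq, Finset.card_filter]
  rw [h1]
  simp only [List.get_eq_getElem]
  exact Fin.sum_univ_fun_getElem x fun a => y.count a

theorem dominantPairs_le_matchingPairs (x y : List ℕ) : dominantPairs x y ≤ matchingPairs x y := by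
  rw [← card_domSet, matchingPairs]
  refine Finset.card_le_card_of_surjOn
    (fun q : Fin x.length × Fin y.length => ((q.1 : ℕ) + 1, (q.2 : ℕ) + 1)) ?_
  rintro ⟨i, j⟩ h
  have h' := (mem_domSet.1 h).1
  obtain ⟨a, h1, h2⟩ := domSet_symbol h
  obtain ⟨l1, e1⟩ := List.getElem?_eq_some_iff.1 h1
  obtain ⟨l2, e2⟩ := List.getElem?_eq_some_iff.1 h2
  refine ⟨(⟨i - 1, l1⟩, ⟨j - 1, l2⟩), by simp [e1, e2], ?_⟩
  simp only [Prod.mk.injEq]; omega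

theorem length_le_matchingPairs (h : ∀ a ∈ x, a ∈ y) : x.length ≤ matchingPairs x y := by
  rw [matchingPairs_eq_sum]
  have := List.card_nsmul_le_sum (x.map fun a => y.count a) 1 (by
    simp only [List.mem_map, forall_exists_index, and_imp, forall_apply_eq_imp_iff₂]
    exact fun a ha => List.count_pos_iff.2 (h a ha))
  simpa using this

theorem matchingPairs_append (h₁₂ : ∀ a ∈ x₁, a ∉ y₂) (h₂₁ : ∀ a ∈ x₂, a ∉ y₁) :
    matchingPairs (x₁ ++ x₂) (y₁ ++ y₂) = matchingPairs x₁ y₁ + matchingPairs x₂ y₂ := by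
  simp only [matchingPairs_eq_sum, List.map_append, List.sum_append, List.count_append]
  congr 2
  · exact List.map_congr_left fun a ha => by rw [List.count_eq_zero.2 (h₁₂ a ha), add_zero]
  · exact List.map_congr_left fun a ha => by rw [List.count_eq_zero.2 (h₂₁ a ha), zero_add]

theorem matchingPairs_map {f : ℕ → ℕ} (hf : Function.Injective f) (x y : List ℕ) :
    matchingPairs (x.map f) (y.map f) = matchingPairs x y := by
  simp only [matchingPairs_eq_sum, List.map_map]
  congr 1
  exact List.map_congr_left fun a _ => by simp [List.count_map_of_injective _ _ hf]

theorem matchingPairs_eq_sum_range {s : ℕ} (hx : ∀ a ∈ x, a < s) :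
    matchingPairs x y = ∑ a ∈ Finset.range s, x.count a * y.count a := by
  rw [matchingPairs_eq_sum, Finset.sum_list_map_count]
  simp only [smul_eq_mul]
  refine Finset.sum_subset (fun a ha => by simpa using hx a (by simpa using ha)) fun a _ ha => ?_
  rw [List.count_eq_zero.2 (by simpa using ha), zero_mul]

theorem length_eq_sum_range {s : ℕ} (hx : ∀ a ∈ x, a < s) :
    x.length = ∑ a ∈ Finset.range s, x.count a := by
  have := Finset.sum_list_map_count x fun _ => 1
  simp only [List.map_const', List.sum_replicate, smul_eq_mul, mul_one] at this
  rw [this]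
  refine Finset.sum_subset (fun a ha => by simpa using hx a (by simpa using ha)) fun a _ ha => ?_
  rw [List.count_eq_zero.2 (by simpa using ha)]

/-- Cauchy–Schwarz for the symbol counts of a longest common subsequence, each of which is at most
the corresponding count in `x` and in `y`. -/
theorem lcsLen_sq_le {s : ℕ} (hx : ∀ a ∈ x, a < s) :
    lcsLen x y ^ 2 ≤ s * matchingPairs x y := by
  obtain ⟨z, h1, h2, h⟩ := exists_lcs x y
  rw [← h, length_eq_sum_range (s := s) fun a ha => hx a (h1.subset ha),
    matchingPairs_eq_sum_range hx]
  refine (sq_sum_le_card_mul_sum_sq (s := Finset.range s) (f := fun a => z.count a)).trans ?_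
  rw [Finset.card_range]
  refine Nat.mul_le_mul_left s (Finset.sum_le_sum fun a _ => ?_)
  rw [sq]
  exact Nat.mul_le_mul (h1.count_le a) (h2.count_le a)

/-- A symbol occurring p and q times contributes pq = min(p, q)·max(p, q) ≤ L·(p + q). Summation
yields L·(n + m). -/
theorem matchingPairs_le (hxy : y.length ≤ x.length) {s : ℕ} (hx : ∀ a ∈ x, a < s)
    (hy : ∀ a ∈ y, a < s) : matchingPairs x y ≤ 2 * lcsLen x y * x.length := by
  have h1 : matchingPairs x y ≤ lcsLen x y * (x.length + y.length) := by
    rw [matchingPairs_eq_sum_range hx, length_eq_sum_range hx, length_eq_sum_range hy,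
      ← Finset.sum_add_distrib, Finset.mul_sum]
    refine Finset.sum_le_sum fun a _ => ?_
    have := min_count_le_lcsLen a x y
    rcases le_total (x.count a) (y.count a) with hle | hle
    · rw [min_eq_left hle] at this
      exact Nat.mul_le_mul this (by omega)
    · rw [min_eq_right hle] at this
      rw [mul_comm]
      exact Nat.mul_le_mul this (by omega)
  nlinarith [Nat.zero_le (lcsLen x y)]

/-! ### Dominant pairs and the alphabet -/

theorem alphabetSize_eq {s : ℕ} (hx : ∀ a, a ∈ x ↔ a < s) (hy : ∀ a, a ∈ y ↔ a < s) :
    alphabetSize x y = s := by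
  have : x.toFinset ∩ y.toFinset = Finset.range s := by
    ext a; simp [hx, hy]
  rw [alphabetSize, this, Finset.card_range]

/-- The first occurrences of a symbol in both strings form a dominant pair: without that symbol at
the end of one string, it is useless at the end of the other. -/
theorem alphabetSize_le_dominantPairs (x y : List ℕ) : alphabetSize x y ≤ dominantPairs x y := by
  rw [← card_domSet, alphabetSize]
  refine Finset.card_le_card_of_injOn (fun a => (x.idxOf a + 1, y.idxOf a + 1)) ?_ ?_
  · intro a ha
    simp only [Finset.coe_inter, List.coe_toFinset, Set.mem_inter_iff, Set.mem_ofPred_eq] at ha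
    have hx := List.idxOf_lt_length_iff.2 ha.1
    have hy := List.idxOf_lt_length_iff.2 ha.2
    have ex : x.take (x.idxOf a + 1) = x.take (x.idxOf a) ++ [a] := by
      rw [take_succ_eq hx, List.getElem_idxOf]
    have ey : y.take (y.idxOf a + 1) = y.take (y.idxOf a) ++ [a] := by
      rw [take_succ_eq hy, List.getElem_idxOf]
    have nx : ∀ {x : List ℕ}, a ∉ x.take (x.idxOf a) := fun {x} h => by
      have := List.idxOf_lt_length_iff.2 h
      have e := (List.take_prefix (x.idxOf a) x).idxOf_eq_of_mem h
      simp only [List.length_take] at this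
      omega
    have l0 : ∀ {u : List ℕ}, a ∉ u → lcsLen u [a] = 0 := fun h =>
      lcsLen_eq_zero fun b hb hb' => h (by rw [List.mem_singleton] at hb'; rwa [← hb'])
    have l1 : lcsLen [a] [a] = 1 := lcsLen_of_sublist (List.Sublist.refl _)
    have low := add_lcsLen_le (x.take (x.idxOf a)) [a] (y.take (y.idxOf a)) [a]
    have u1 := lcsLen_append_right_le (x.take (x.idxOf a)) (y.take (y.idxOf a)) [a]
    have u2 := lcsLen_append_left_le (x.take (x.idxOf a)) [a] (y.take (y.idxOf a))
    rw [l0 nx] at u1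
    rw [lcsLen_comm [a], l0 nx] at u2
    simp only [Finset.mem_coe, mem_domSet, table, Nat.add_sub_cancel, ex, ey]
    omega
  · intro a ha b hb e
    simp only [Finset.coe_inter, List.coe_toFinset, Set.mem_inter_iff, Set.mem_ofPred_eq] at ha
    simp only [Prod.mk.injEq, Nat.add_right_cancel_iff] at e
    exact (List.idxOf_inj ha.1).1 e.1

theorem card_filter_getElem?_eq (a : ℕ) (y : List ℕ) :
    ((Finset.range y.length).filter fun j => y[j]? = some a).card = y.count a := by
  rw [← card_filter_get_eq]
  refine (Finset.card_nbij (fun j : Fin y.length => (j : ℕ)) ?_ ?_ ?_).symm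
  · intro j hj
    have hj' := (Finset.mem_filter.1 hj).2
    simp [hj']
  · exact fun j _ j' _ e => Fin.ext e
  · intro j hj
    simp only [Finset.coe_filter, Finset.mem_range, Set.mem_ofPred_eq] at hj
    obtain ⟨l, e⟩ := List.getElem?_eq_some_iff.1 hj.2
    exact ⟨⟨j, l⟩, by simp [e], rfl⟩

/-- Group the dominant pairs by table value and symbol. Within a group all rows and all columns are
distinct, so the group has at most as many members as the symbol has occurrences in either string,
and the minimum of these counts is at most `L`. -/
theorem dominantPairs_le_sq_mul {s : ℕ} (hx : ∀ a ∈ x, a < s) :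
    dominantPairs x y ≤ lcsLen x y * (lcsLen x y * s) := by
  rw [← card_domSet]
  have := Finset.card_le_mul_card_image_of_maps_to (s := domSet x y)
    (t := Finset.Icc 1 (lcsLen x y) ×ˢ Finset.range s)
    (f := fun q => (table x y q.1 q.2, x.getD (q.1 - 1) 0)) (n := lcsLen x y) ?_ ?_
  · simpa using this
  · rintro ⟨i, j⟩ h
    obtain ⟨a, h1, -⟩ := domSet_symbol h
    simp only [Finset.mem_product, Finset.mem_Icc, Finset.mem_range]
    refine ⟨⟨domSet_table_pos h, table_le_lcsLen i j⟩, ?_⟩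
    rw [List.getD_eq_getElem?_getD, h1]
    exact hx a (List.mem_of_getElem? h1)
  · rintro ⟨k, a⟩ -
    have sym : ∀ {i j}, (i, j) ∈ domSet x y → x.getD (i - 1) 0 = a →
        x[i - 1]? = some a ∧ y[j - 1]? = some a := fun h e => by
      obtain ⟨b, h1, h2⟩ := domSet_symbol h
      rw [List.getD_eq_getElem?_getD, h1] at e
      simp only [Option.getD_some] at e
      exact e ▸ ⟨h1, h2⟩
    refine le_trans (le_min ?_ ?_) (min_count_le_lcsLen a x y)
    · rw [← card_filter_getElem?_eq]
      refine Finset.card_le_card_of_injOn (fun q => q.1 - 1) ?_ ?_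
      · rintro ⟨i, j⟩ h
        simp only [Finset.coe_filter, Set.mem_ofPred_eq, Prod.mk.injEq] at h
        have := (mem_domSet.1 h.1).1
        simp only [Finset.coe_filter, Finset.mem_range, Set.mem_ofPred_eq]
        exact ⟨by omega, (sym h.1 h.2.2).1⟩
      · rintro ⟨i, j⟩ h ⟨i', j'⟩ h' e
        simp only [Finset.coe_filter, Set.mem_ofPred_eq, Prod.mk.injEq] at h h' e
        have := (mem_domSet.1 h.1).1
        have := (mem_domSet.1 h'.1).1
        obtain rfl : i = i' := by omega
        rw [domSet_inj_right h.1 h'.1 (by omega)]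
    · rw [← card_filter_getElem?_eq]
      refine Finset.card_le_card_of_injOn (fun q => q.2 - 1) ?_ ?_
      · rintro ⟨i, j⟩ h
        simp only [Finset.coe_filter, Set.mem_ofPred_eq, Prod.mk.injEq] at h
        have := (mem_domSet.1 h.1).1
        simp only [Finset.coe_filter, Finset.mem_range, Set.mem_ofPred_eq]
        exact ⟨by omega, (sym h.1 h.2.2).2⟩
      · rintro ⟨i, j⟩ h ⟨i', j'⟩ h' e
        simp only [Finset.coe_filter, Set.mem_ofPred_eq, Prod.mk.injEq] at h h' e
        have := (mem_domSet.1 h.1).1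
        have := (mem_domSet.1 h'.1).1
        obtain rfl : j = j' := by omega
        rw [domSet_inj_left h.1 h'.1 (by omega)]

/-! ### Concatenation over disjoint alphabets -/

theorem table_map {f : ℕ → ℕ} (hf : Function.Injective f) (x y : List ℕ) (i j : ℕ) :
    table (x.map f) (y.map f) i j = table x y i j := by
  rw [table, ← List.map_take, ← List.map_take, lcsLen_map hf, table]

theorem dominantPairs_map {f : ℕ → ℕ} (hf : Function.Injective f) (x y : List ℕ) :
    dominantPairs (x.map f) (y.map f) = dominantPairs x y := by
  simp only [dominantPairs, table_map hf, List.length_map]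

theorem table_append_left {i j : ℕ} (hi : i ≤ x₁.length) (hj : j ≤ y₁.length) :
    table (x₁ ++ x₂) (y₁ ++ y₂) i j = table x₁ y₁ i j := by
  rw [table, table, List.take_append_of_le_length hi, List.take_append_of_le_length hj]

theorem table_append_right {s : ℕ} (hx₁ : ∀ a ∈ x₁, a < s) (hy₁ : ∀ a ∈ y₁, a < s)
    (hx₂ : ∀ a ∈ x₂, s ≤ a) (hy₂ : ∀ a ∈ y₂, s ≤ a) (i j : ℕ) :
    table (x₁ ++ x₂) (y₁ ++ y₂) (x₁.length + i) (y₁.length + j) =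
      lcsLen x₁ y₁ + table x₂ y₂ i j := by
  rw [table, List.take_length_add_append, List.take_length_add_append, table]
  exact lcsLen_append_of_disjoint hx₁ hy₁ (fun a ha => hx₂ a (List.mem_of_mem_take ha))
    (fun a ha => hy₂ a (List.mem_of_mem_take ha))

/-- In the two mixed quadrants of the table no symbols match, so no pair is dominant there. The last
quadrant is the table of the second pair raised by a constant, which does not affect dominance. -/
theorem dominantPairs_append {s : ℕ} (hx₁ : ∀ a ∈ x₁, a < s) (hy₁ : ∀ a ∈ y₁, a < s)
    (hx₂ : ∀ a ∈ x₂, s ≤ a) (hy₂ : ∀ a ∈ y₂, s ≤ a) :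
    dominantPairs (x₁ ++ x₂) (y₁ ++ y₂) = dominantPairs x₁ y₁ + dominantPairs x₂ y₂ := by
  classical
  have tr := table_append_right hx₁ hy₁ hx₂ hy₂
  have e : domSet (x₁ ++ x₂) (y₁ ++ y₂) = domSet x₁ y₁ ∪
      (domSet x₂ y₂).image fun q => (x₁.length + q.1, y₁.length + q.2) := by
    ext ⟨i, j⟩
    simp only [Finset.mem_union, Finset.mem_image, Prod.exists, Prod.mk.injEq]
    constructor
    · intro h
      obtain ⟨a, h1, h2⟩ := domSet_symbol h
      rw [mem_domSet, List.length_append, List.length_append] at h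
      obtain ⟨hij, h3, h4⟩ := h
      rcases le_or_gt i x₁.length with hi | hi <;> rcases le_or_gt j y₁.length with hj | hj
      · left
        rw [table_append_left (by omega) hj, table_append_left hi hj] at h3
        rw [table_append_left hi (by omega), table_append_left hi hj] at h4
        exact mem_domSet.2 ⟨by omega, h3, h4⟩
      · rw [List.getElem?_append_left (by omega)] at h1
        rw [List.getElem?_append_right (by omega)] at h2
        have := hx₁ a (List.mem_of_getElem? h1)
        have := hy₂ a (List.mem_of_getElem? h2)
        omega
      · rw [List.getElem?_append_right (by omega)] at h1
        rw [List.getElem?_append_left (by omega)] at h2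
        have := hx₂ a (List.mem_of_getElem? h1)
        have := hy₁ a (List.mem_of_getElem? h2)
        omega
      · right
        obtain ⟨i', rfl⟩ := Nat.exists_eq_add_of_lt hi
        obtain ⟨j', rfl⟩ := Nat.exists_eq_add_of_lt hj
        simp only [add_assoc] at h3 h4
        rw [Nat.add_sub_assoc (by omega), tr, tr] at h3 h4
        exact ⟨i' + 1, j' + 1, mem_domSet.2 ⟨by omega, by omega, by omega⟩, rfl, rfl⟩
    · rintro (h | ⟨i', j', h, rfl, rfl⟩)
      · obtain ⟨hij, h3, h4⟩ := mem_domSet.1 h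
        rw [mem_domSet, List.length_append, List.length_append,
          table_append_left (by omega) (by omega), table_append_left (by omega) (by omega),
          table_append_left (by omega) (by omega)]
        exact ⟨by omega, h3, h4⟩
      · obtain ⟨hij, h3, h4⟩ := mem_domSet.1 h
        rw [mem_domSet, List.length_append, List.length_append,
          Nat.add_sub_assoc (by omega), Nat.add_sub_assoc (by omega), tr, tr, tr]
        exact ⟨by omega, by omega, by omega⟩
  rw [← card_domSet, e, Finset.card_union_of_disjoint, Finset.card_image_of_injective,
    card_domSet, card_domSet]
  · rintro ⟨a, b⟩ ⟨c, d⟩ h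
    simpa using h
  · rw [Finset.disjoint_left]
    rintro ⟨i, j⟩ h h'
    simp only [Finset.mem_image, Prod.exists, Prod.mk.injEq] at h'
    obtain ⟨i', j', h', rfl, rfl⟩ := h'
    have := (mem_domSet.1 h).1
    have := (mem_domSet.1 h').1
    omega

end LCS

/-! ### Periodic strings -/

/-- The string `w` repeated `k` times. -/
def rep (k : ℕ) (w : List ℕ) : List ℕ := (List.replicate k w).flatten

section Rep
variable (w : List ℕ)

@[simp] theorem rep_zero : rep 0 w = [] := rfl

theorem rep_succ (k : ℕ) : rep (k + 1) w = w ++ rep k w := by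
  simp [rep, List.replicate_succ]

theorem rep_add (k l : ℕ) : rep (k + l) w = rep k w ++ rep l w := by
  rw [rep, List.replicate_add, List.flatten_append]; rfl

theorem rep_succ' (k : ℕ) : rep (k + 1) w = rep k w ++ w := by
  rw [rep_add]; simp [rep_succ]

@[simp] theorem length_rep (k : ℕ) : (rep k w).length = k * w.length := by
  simp [rep]

theorem count_rep (a k : ℕ) : (rep k w).count a = k * w.count a := by
  induction k with
  | zero => simp
  | succ k ih => rw [rep_succ, List.count_append, ih]; ring

variable {w}

theorem mem_of_mem_rep {a k : ℕ} (h : a ∈ rep k w) : a ∈ w := by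
  simp only [rep, List.mem_flatten, List.mem_replicate] at h
  obtain ⟨l, ⟨-, rfl⟩, h⟩ := h
  exact h

theorem mem_rep {a k : ℕ} (hk : 1 ≤ k) : a ∈ rep k w ↔ a ∈ w := by
  refine ⟨mem_of_mem_rep, fun h => ?_⟩
  obtain ⟨k, rfl⟩ := Nat.exists_eq_add_of_le' hk
  rw [rep_succ]; exact List.mem_append_left _ h

theorem rep_sublist {u : List ℕ} (h : u.Sublist w) (k : ℕ) : (rep k u).Sublist (rep k w) := by
  induction k with
  | zero => exact List.Sublist.refl _
  | succ k ih => rw [rep_succ, rep_succ]; exact h.append ih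

theorem replicate_sublist_rep {a : ℕ} (h : a ∈ w) (k : ℕ) :
    (List.replicate k a).Sublist (rep k w) := by
  have := rep_sublist (List.singleton_sublist.2 h) k
  rwa [show rep k [a] = List.replicate k a by simp [rep]] at this

theorem take_rep {k u p n : ℕ} (hn : w.length = n) (hu : u < k) (hp : p ≤ n) :
    (rep k w).take (u * n + p) = rep u w ++ w.take p := by
  subst hn
  obtain ⟨v, rfl⟩ := Nat.exists_eq_add_of_lt hu
  rw [add_assoc u, rep_add, ← length_rep, List.take_length_add_append, rep_succ,
    List.take_append_of_le_length hp]

theorem take_rep' {k u n : ℕ} (hn : w.length = n) (hu : u ≤ k) :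
    (rep k w).take (u * n) = rep u w := by
  subst hn
  obtain ⟨v, rfl⟩ := Nat.exists_eq_add_of_le hu
  rw [rep_add, ← length_rep, List.take_left]

end Rep

theorem sublist_of_subset_of_pairwise {l₁ l₂ : List ℕ} (h₁ : l₁.Pairwise (· < ·))
    (h₂ : l₂.Pairwise (· < ·)) (h : l₁ ⊆ l₂) : l₁.Sublist l₂ :=
  List.sublist_of_subperm_of_pairwise (List.subperm_of_subset (h₁.imp (fun h => h.ne)) h) h₁ h₂

theorem lcsLen_add_count_le (a : ℕ) (x y : List ℕ) :
    lcsLen x y + x.count a ≤ y.count a + x.length := by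
  have h := lcsLen_le_count_add a x y
  have k3 := List.length_eq_length_filter_add (l := x) (· = a)
  have e1 : x.count a = (x.filter (· = a)).length := by
    rw [List.count, List.countP_eq_length_filter]; congr 1
  have e2 : x.filter (fun b => !decide (b = a)) = x.filter (· ≠ a) := by
    congr 1; funext b; simp
  rw [e2] at k3
  omega

theorem count_zero_range {p : ℕ} (hp : 1 ≤ p) : (List.range p).count 0 = 1 :=
  List.count_eq_one_of_mem List.nodup_range (by rw [List.mem_range]; omega)

/-- The longer string of a padding block. -/
def blockX (R S t : ℕ) : List ℕ := List.replicate R 0 ++ rep S (List.range t)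

/-- The shorter string of a padding block. -/
def blockY (up : Bool) (S t : ℕ) : List ℕ :=
  rep S (if up then List.range t else (List.range t).reverse)

@[simp] theorem length_blockX (R S t : ℕ) : (blockX R S t).length = R + S * t := by simp [blockX]

@[simp] theorem length_blockY (up : Bool) (S t : ℕ) : (blockY up S t).length = S * t := by
  cases up <;> simp [blockY]

theorem mem_blockX {R S t a : ℕ} (hS : 1 ≤ S) (ht : 1 ≤ t) : a ∈ blockX R S t ↔ a < t := by
  rw [blockX, List.mem_append, mem_rep hS, List.mem_range, List.mem_replicate]
  omega

theorem mem_blockY {up : Bool} {S t a : ℕ} (hS : 1 ≤ S) : a ∈ blockY up S t ↔ a < t := by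
  cases up <;> simp [blockY, mem_rep hS]

/-- Every symbol below `t` occurs exactly `S` times in the shorter string. -/
theorem matchingPairs_block (up : Bool) {R S t : ℕ} (hS : 1 ≤ S) (ht : 1 ≤ t) :
    matchingPairs (blockX R S t) (blockY up S t) = (R + S * t) * S := by
  rw [matchingPairs_eq_sum, List.map_congr_left (g := fun _ => S)]
  · simp
  · intro a ha
    rw [mem_blockX hS ht] at ha
    have h1 : (List.range t).count a = 1 :=
      List.count_eq_one_of_mem List.nodup_range (by simpa using ha)
    cases up <;> simp [blockY, count_rep, h1]

theorem take_blockX {R S t u p : ℕ} (hu : u < S) (hp : p ≤ t) :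
    (blockX R S t).take (R + (u * t + p)) =
      List.replicate R 0 ++ (rep u (List.range t) ++ List.range p) := by
  have := List.take_length_add_append (l₁ := List.replicate R 0) (l₂ := rep S (List.range t))
    (u * t + p)
  rw [List.length_replicate] at this
  rw [blockX, this, take_rep (by simp) hu hp, List.take_range, min_eq_left hp]

/-! ### Ascending blocks -/

theorem lcsLen_block_up (R S t : ℕ) : lcsLen (blockX R S t) (blockY true S t) = S * t := by
  rw [lcsLen_of_sublist (by simp [blockX, blockY]), length_blockY]

/-- The first `s - u - 1` periods of the shorter string are matched with zeros of the prefix, the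
other `u + 1` periods are read in parallel with the longer string. Together with `table_up_le` this
determines the entry. -/
theorem le_table_up {R S t u p s : ℕ} (hu : u < S) (hp1 : 1 ≤ p) (hp : p ≤ t) (hus : u + 1 ≤ s)
    (hs : s ≤ S) (hR : s - u - 1 ≤ R) :
    s + u * t + p ≤ table (blockX R S t) (blockY true S t) (R + (u * t + p)) (s * t) + u + 1 := by
  have e : (blockY true S t).take (s * t) = rep s (List.range t) := by
    simp only [blockY, if_true]; exact take_rep' (by simp) hs
  rw [table, take_blockX hu hp, e]
  have hs' : s = (s - u - 1) + (u + 1) := by omega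
  have := length_le_lcsLen
    (z := List.replicate (s - u - 1) 0 ++ (rep u (List.range t) ++ List.range p))
    (x := List.replicate R 0 ++ (rep u (List.range t) ++ List.range p))
    (y := rep s (List.range t))
    ((List.replicate_sublist_replicate 0 |>.2 hR).append (List.Sublist.refl _)) (by
      conv_rhs => rw [hs', rep_add, rep_succ']
      refine (replicate_sublist_rep (by simp; omega) _).append
        ((List.Sublist.refl _).append ?_)
      exact (List.range_sublist.2 hp))
  simp only [List.length_append, List.length_replicate, length_rep, List.length_range] at this
  omega

/-- Count by the symbol `0`: there are `s` zeros on one side, and the other side has `u * (t - 1) +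
p - 1` non-zero symbols. -/
theorem table_up_le {R S t u p s : ℕ} (hu : u < S) (hp1 : 1 ≤ p) (hp : p ≤ t) (hs : s ≤ S) :
    table (blockX R S t) (blockY true S t) (R + (u * t + p)) (s * t) + u + 1 ≤ s + u * t + p := by
  have e : (blockY true S t).take (s * t) = rep s (List.range t) := by
    simp only [blockY, if_true]; exact take_rep' (by simp) hs
  rw [table, take_blockX hu hp, e]
  have := lcsLen_add_count_le 0 (List.replicate R 0 ++ (rep u (List.range t) ++ List.range p))
    (rep s (List.range t))
  simp only [List.count_append, count_rep, List.count_replicate_self, List.length_append,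
    List.length_replicate, length_rep, List.length_range, count_zero_range hp1,
    count_zero_range (hp1.trans hp)] at this
  omega

theorem eq_of_mul_add_eq {t u u' p p' : ℕ} (hp : p < t) (hp' : p' < t)
    (h : u * t + p = u' * t + p') : u = u' ∧ p = p' := by
  have h1 : (u * t + p) / t = u := by
    rw [Nat.mul_comm, Nat.mul_add_div (by omega), Nat.div_eq_of_lt hp, add_zero]
  have h2 : (u' * t + p') / t = u' := by
    rw [Nat.mul_comm, Nat.mul_add_div (by omega), Nat.div_eq_of_lt hp', add_zero]
  have : u = u' := by rw [← h1, ← h2, h]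
  subst this
  exact ⟨rfl, by omega⟩

theorem eq_of_mem_block {t s s' j : ℕ} (h1 : (s - 1) * t < j) (h2 : j ≤ s * t)
    (h1' : (s' - 1) * t < j) (h2' : j ≤ s' * t) : s = s' := by
  rcases lt_trichotomy s s' with h | h | h
  · have := Nat.mul_le_mul_right t (show s ≤ s' - 1 by omega); omega
  · exact h
  · have := Nat.mul_le_mul_right t (show s' ≤ s - 1 by omega); omega

/-- For s = u + c + 1, the entry in column s·t grows by one from the row above, and by one from
column (s - 1)·t. So this row has a dominant pair among the columns of the s-th period. Row and
period determine u, p and c. The condition c ≤ R supplies the zeros needed in `le_table_up`. -/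
theorem le_dominantPairs_up {R S t h : ℕ} (hh : 2 * h ≤ S + 1) :
    h * (min (R + 1) h * (t - 1)) ≤ dominantPairs (blockX R S t) (blockY true S t) := by
  have key : ∀ q ∈ Finset.range h ×ˢ Finset.range (min (R + 1) h) ×ˢ Finset.range (t - 1), ∃ j,
      (R + (q.1 * t + (q.2.2 + 2)), j) ∈ domSet (blockX R S t) (blockY true S t) ∧
      (q.1 + q.2.1 + 1 - 1) * t < j ∧ j ≤ (q.1 + q.2.1 + 1) * t := by
    rintro ⟨u, c, p⟩ hq
    simp only [Finset.mem_product, Finset.mem_range] at hq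
    obtain ⟨hu, hc, hp⟩ := hq
    have hS : u + c + 1 ≤ S := by omega
    have l1 := le_table_up (R := R) (S := S) (t := t) (u := u) (p := p + 2) (s := u + c + 1)
      (by omega) (by omega) (by omega) (by omega) hS (by omega)
    have l2 := table_up_le (R := R) (S := S) (t := t) (u := u) (p := p + 1) (s := u + c + 1)
      (by omega) (by omega) (by omega) hS
    have l3 := table_up_le (R := R) (S := S) (t := t) (u := u) (p := p + 2) (s := u + c)
      (by omega) (by omega) (by omega) (by omega)
    obtain ⟨i, j, hd, hi1, hi2, hj1, hj2, -⟩ := exists_domSet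
      (x := blockX R S t) (y := blockY true S t)
      (i₁ := R + (u * t + (p + 1))) (i₂ := R + (u * t + (p + 2))) (j₁ := (u + c) * t)
      (j₂ := (u + c + 1) * t)
      (k := table (blockX R S t) (blockY true S t) (R + (u * t + (p + 2))) ((u + c + 1) * t))
      (by
        rw [length_blockX]
        have := Nat.mul_le_mul_right t (show u + 1 ≤ S by omega)
        rw [Nat.add_mul, one_mul] at this; omega)
      (by rw [length_blockY]; exact Nat.mul_le_mul_right t hS) (by omega) (by omega) le_rfl
    -- The rectangle is a single row, so the dominant pair lies in it.
    obtain rfl : i = R + (u * t + (p + 2)) := by omega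
    exact ⟨j, hd, hj1, hj2⟩
  choose! f hf using key
  have := Finset.card_le_card_of_injOn (s := Finset.range h ×ˢ Finset.range (min (R + 1) h) ×ˢ
      Finset.range (t - 1)) (t := domSet (blockX R S t) (blockY true S t))
    (fun q => (R + (q.1 * t + (q.2.2 + 2)), f q)) (fun q hq => (hf q hq).1) (by
      intro q hq q' hq' e
      have a := (hf q hq).2
      have a' := (hf q' hq').2
      simp only [Prod.mk.injEq] at e
      rw [e.2] at a
      have b := eq_of_mem_block a.1 a.2 a'.1 a'.2
      simp only [Finset.coe_product, Set.mem_prod, Finset.coe_range, Set.mem_Iio] at hq hq'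
      have c := eq_of_mul_add_eq (t := t) (u := q.1) (u' := q'.1) (p := q.2.2) (p' := q'.2.2)
        (by omega) (by omega) (by omega)
      exact Prod.ext c.1 (Prod.ext (by omega) c.2))
  rw [← card_domSet]
  simpa using this

/-- An entry of a unary table is the smaller index, so all dominant pairs lie on the diagonal. -/
theorem dominantPairs_replicate_le (a b : ℕ) :
    dominantPairs (List.replicate a 0) (List.replicate b 0) ≤ b := by
  have low : ∀ k i j, k ≤ i → k ≤ j → k ≤ a → k ≤ b →
      k ≤ table (List.replicate a 0) (List.replicate b 0) i j := by
    intro k i j h1 h2 h3 h4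
    have := length_le_lcsLen (z := List.replicate k 0) (x := (List.replicate a 0).take i)
      (y := (List.replicate b 0).take j)
      (by rw [List.take_replicate]; exact (List.replicate_sublist_replicate 0).2 (by omega))
      (by rw [List.take_replicate]; exact (List.replicate_sublist_replicate 0).2 (by omega))
    rwa [List.length_replicate] at this
  have diag : ∀ i j, (i, j) ∈ domSet (List.replicate a 0) (List.replicate b 0) → i = j := by
    intro i j h
    obtain ⟨⟨h1, h2⟩, h3, h4⟩ := mem_domSet.1 h
    simp only [List.length_replicate] at h1 h2
    have t1 : table (List.replicate a 0) (List.replicate b 0) i j ≤ i :=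
      (lcsLen_le_left _ _).trans (by simp)
    have t2 : table (List.replicate a 0) (List.replicate b 0) i j ≤ j :=
      (lcsLen_le_right _ _).trans (by simp)
    rcases lt_trichotomy i j with h | h | h
    · have := low i i (j - 1) le_rfl (by omega) h1.2 (by omega); omega
    · exact h
    · have := low j (i - 1) j (by omega) le_rfl (by omega) h2.2; omega
  rw [← card_domSet]
  have := Finset.card_le_card_of_injOn (s := domSet (List.replicate a 0) (List.replicate b 0))
    (t := Finset.Icc 1 b) (fun q => q.2) (by
      rintro ⟨i, j⟩ h
      have := (mem_domSet.1 h).1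
      simpa using this.2) (by
      rintro ⟨i, j⟩ h ⟨i', j'⟩ h' e
      rw [diag i j h, diag i' j' h', show j = j' from e])
  simpa using this

theorem blockX_one (R S : ℕ) : blockX R S 1 = List.replicate (R + S) 0 := by
  simp [blockX, rep]

theorem blockY_one (up : Bool) (S : ℕ) : blockY up S 1 = List.replicate S 0 := by
  cases up <;> simp [blockY, rep]

/-! ### Descending blocks -/

section Down
variable {R S t : ℕ}

theorem lcsLen_le_one {x y : List ℕ} (hx : x.Pairwise (· ≤ ·)) (hy : y.Pairwise (· > ·)) :
    lcsLen x y ≤ 1 := by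
  obtain ⟨z, h1, h2, h⟩ := exists_lcs x y
  rw [← h]
  have p1 := hx.sublist h1
  have p2 := hy.sublist h2
  match z, p1, p2 with
  | [], _, _ => simp
  | [_], _, _ => simp
  | a :: b :: l, p1, p2 =>
    have q1 := (List.pairwise_cons.1 p1).1 b (by simp)
    have q2 := (List.pairwise_cons.1 p2).1 b (by simp)
    omega

theorem pairwise_reverse_range (t : ℕ) : (List.range t).reverse.Pairwise (· > ·) := by
  rw [List.pairwise_reverse]; exact List.pairwise_lt_range

theorem pairwise_replicate_append_range (R t : ℕ) :
    (List.replicate R 0 ++ List.range t).Pairwise (· ≤ ·) := by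
  rw [List.pairwise_append]
  refine ⟨List.pairwise_replicate.2 (Or.inr le_rfl), List.pairwise_lt_range.imp fun h => h.le, ?_⟩
  intro a ha b _
  rw [List.eq_of_mem_replicate ha]; exact Nat.zero_le b

theorem lcsLen_rep_le {x w : List ℕ} (h : lcsLen x w ≤ 1) (s : ℕ) : lcsLen x (rep s w) ≤ s := by
  induction s with
  | zero => exact lcsLen_le_right _ _
  | succ s ih =>
    rw [rep_succ']
    exact (lcsLen_append_right_le _ _ _).trans (by omega)

/-- An ascending and a descending run share at most one symbol, and a common subsequence passes
through the pairs of runs along a staircase, which has at most (r + 1) + s - 1 places. The leading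
zeros belong to the first ascending run, since it remains non-decreasing with them. -/
theorem lcsLen_down_le (R t r s : ℕ) :
    lcsLen (List.replicate R 0 ++ rep (r + 1) (List.range t)) (rep s (List.range t).reverse)
      ≤ r + s := by
  induction r generalizing s with
  | zero =>
    rw [zero_add, zero_add]
    refine lcsLen_rep_le ?_ s
    rw [show rep 1 (List.range t) = List.range t by simp [rep_succ]]
    exact lcsLen_le_one (pairwise_replicate_append_range R t) (pairwise_reverse_range t)
  | succ r ih =>
    induction s with
    | zero => exact (lcsLen_le_right _ _).trans (by simp)
    | succ s ihs =>
      have h0 : lcsLen (List.range t) (List.range t).reverse ≤ 1 :=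
        lcsLen_le_one (List.pairwise_lt_range.imp fun h => h.le) (pairwise_reverse_range t)
      have h1 := lcsLen_append_append_le (List.replicate R 0 ++ rep (r + 1) (List.range t))
        (List.range t) (rep s (List.range t).reverse) (List.range t).reverse
      rw [← rep_succ', List.append_assoc, ← rep_succ'] at h1
      have h2 := ih (s + 1)
      omega

theorem le_of_mem_take_reverse_range {q a : ℕ} (h : a ∈ (List.range t).reverse.take q) :
    t ≤ a + q := by
  rw [List.take_reverse, List.mem_reverse, List.length_range, List.range_eq_range',
    List.drop_range', List.mem_range'_1] at h
  omega

theorem mem_take_reverse_range {q a : ℕ} (ha : a < t) (h : t ≤ a + q) :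
    a ∈ (List.range t).reverse.take q := by
  rw [List.take_reverse, List.mem_reverse, List.length_range, List.range_eq_range',
    List.drop_range', List.mem_range'_1]
  omega

theorem pair_sublist_take_reverse_range {q a : ℕ} (ha : a + 1 < t) (h : t ≤ a + q) :
    [a + 1, a].Sublist ((List.range t).reverse.take q) := by
  rw [← List.reverse_sublist]
  refine sublist_of_subset_of_pairwise (by simp) ?_ ?_
  · rw [List.pairwise_reverse]
    exact (pairwise_reverse_range t).sublist (List.take_sublist _ _)
  · intro b hb
    rw [List.mem_reverse]
    simp only [List.reverse_cons, List.reverse_nil, List.nil_append, List.singleton_append,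
      List.mem_cons, List.not_mem_nil, or_false] at hb
    rcases hb with rfl | rfl
    · exact mem_take_reverse_range (by omega) h
    · exact mem_take_reverse_range ha (by omega)

/-- For p + q ≤ t the two incomplete runs have no common symbol, so the last place of the staircase
contributes nothing. -/
theorem lcsLen_down_partial_le {r s p q : ℕ} (hp : 1 ≤ p) (hpq : p + q ≤ t) :
    lcsLen (List.replicate R 0 ++ (rep r (List.range t) ++ List.range p))
      (rep s (List.range t).reverse ++ (List.range t).reverse.take q) ≤ r + s := by
  set v := (List.range t).reverse with hv
  have h0 : lcsLen (List.range p) (v.take q) = 0 := lcsLen_eq_zero fun a ha ha' => by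
    have := le_of_mem_take_reverse_range ha'
    have := List.mem_range.1 ha
    omega
  have h1 := lcsLen_append_append_le (List.replicate R 0 ++ rep r (List.range t))
    (List.range p) (rep s v) (v.take q)
  rw [h0, List.append_assoc, add_zero] at h1
  have h2 : lcsLen (List.replicate R 0 ++ (rep r (List.range t) ++ List.range p)) (rep s v)
      ≤ r + s := by
    refine (lcsLen_mono ?_ (List.Sublist.refl _)).trans (lcsLen_down_le R t r s)
    rw [rep_succ']
    exact (List.Sublist.refl _).append ((List.Sublist.refl _).append
      (List.range_sublist.2 (by omega)))
  have h3 : lcsLen (List.replicate R 0 ++ rep r (List.range t)) (rep s v ++ v.take q) ≤ r + s := by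
    cases r with
    | succ r =>
      refine (lcsLen_mono (List.Sublist.refl _) ?_).trans
        ((lcsLen_down_le R t r (s + 1)).trans (by omega))
      rw [rep_succ']
      exact (List.Sublist.refl _).append (List.take_sublist _ _)
    | zero =>
      rw [rep_zero, List.append_nil]
      have h4 := lcsLen_append_right_le (List.replicate R 0) (rep s v) (v.take q)
      have h5 : lcsLen (List.replicate R 0) (v.take q) = 0 := lcsLen_eq_zero fun a ha ha' => by
        have := le_of_mem_take_reverse_range ha'
        have := List.eq_of_mem_replicate ha
        omega
      have h6 : lcsLen (List.replicate R 0) (rep s v) ≤ s := by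
        refine (lcsLen_mono (List.sublist_append_left _ _) (List.Sublist.refl _)).trans
          ((lcsLen_down_le R t 0 s).trans (by omega))
      omega
  exact h1.trans (max_le h3 h2)

/-- Here the incomplete runs share the symbol `a`, which gains one symbol over
`lcsLen_down_partial_le`. The witness consists of s - r zeros followed by (a, a + 1)^r a. -/
theorem le_lcsLen_down {r s a q : ℕ} (ha : a + 1 < t) (hq : t ≤ a + q) (hrs : r ≤ s)
    (hR : s - r ≤ R) :
    r + s + 1 ≤ lcsLen (List.replicate R 0 ++ (rep r (List.range t) ++ List.range (a + 1)))
      (rep s (List.range t).reverse ++ (List.range t).reverse.take q) := by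
  set v := (List.range t).reverse with hv
  -- Each ascending run reads a, a + 1; regrouped in this way, each descending run after the first
  -- reads a + 1, a, including the final incomplete one.
  have comm : ∀ r, rep r [a, a + 1] ++ [a] = a :: rep r [a + 1, a] := by
    intro r
    induction r with
    | zero => rfl
    | succ r ih => rw [rep_succ, rep_succ, List.append_assoc, ih]; rfl
  have down : ∀ r, (rep r [a, a + 1] ++ [a]).Sublist (rep r v ++ v.take q) := by
    intro r
    have hpair := pair_sublist_take_reverse_range ha hq
    cases r with
    | zero => simpa using mem_take_reverse_range (by omega) hq
    | succ r =>
      rw [comm, rep_succ', rep_succ, List.append_assoc]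
      refine (List.singleton_sublist.2 ?_).append ((rep_sublist ?_ r).append hpair)
      · simp [hv]; omega
      · exact hpair.trans (List.take_sublist _ _)
  have h1 := length_le_lcsLen (z := List.replicate (s - r) 0 ++ (rep r [a, a + 1] ++ [a]))
    (x := List.replicate R 0 ++ (rep r (List.range t) ++ List.range (a + 1)))
    (y := rep s v ++ v.take q)
    (((List.replicate_sublist_replicate 0).2 hR).append ((rep_sublist
      (sublist_of_subset_of_pairwise (by simp) List.pairwise_lt_range (by
        intro b hb; simp at hb ⊢; omega)) r).append (by simp)))
    (by
      have : s = (s - r) + r := by omega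
      conv_rhs => rw [this, rep_add, List.append_assoc]
      exact (replicate_sublist_rep (by simp [hv]; omega) _).append (down r))
  simp only [List.length_append, List.length_replicate, length_rep, List.length_cons,
    List.length_nil] at h1
  omega

theorem lcsLen_block_down (hS : 1 ≤ S) (ht : 2 ≤ t) :
    lcsLen (blockX R S t) (blockY false S t) = 2 * S - 1 := by
  obtain ⟨r, rfl⟩ := Nat.exists_eq_add_of_le' hS
  simp only [blockX, blockY, Bool.false_eq_true, if_false]
  refine le_antisymm ((lcsLen_down_le R t r (r + 1)).trans (by omega)) ?_
  have h1 := le_lcsLen_down (R := R) (t := t) (r := r) (s := r) (a := 0) (q := t) (by omega)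
    (by omega) le_rfl (by omega)
  rw [List.take_of_length_le (by simp), ← rep_succ'] at h1
  refine le_trans (by omega) (h1.trans (lcsLen_mono ?_ (List.Sublist.refl _)))
  rw [rep_succ']
  exact (List.Sublist.refl _).append ((List.Sublist.refl _).append
    (List.range_sublist.2 (by omega)))

theorem take_blockY_down {s q : ℕ} (hs : s < S) (hq : q ≤ t) :
    (blockY false S t).take (s * t + q) =
      rep s (List.range t).reverse ++ (List.range t).reverse.take q := by
  simp only [blockY, Bool.false_eq_true, if_false]
  exact take_rep (by simp) hs hq

/-- The incomplete runs have lengths p + 2 and t - 1 - p, which sum to t + 1: they just overlap, in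
the symbol p + 1. Shortening either run by one symbol removes the overlap and lowers the table
value, so the pair is dominant. The condition S ≤ R supplies the c zeros of the witness. -/
theorem le_dominantPairs_down {h : ℕ} (hh : 2 * h ≤ S + 1) (hR : S ≤ R) :
    h * (h * (t - 2)) ≤ dominantPairs (blockX R S t) (blockY false S t) := by
  have key : ∀ q ∈ Finset.range h ×ˢ Finset.range h ×ˢ Finset.range (t - 2),
      (R + (q.1 * t + (q.2.2 + 2)), (q.1 + q.2.1) * t + (t - 1 - q.2.2)) ∈
        domSet (blockX R S t) (blockY false S t) := by
    rintro ⟨r, c, p⟩ hq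
    simp only [Finset.mem_product, Finset.mem_range] at hq
    obtain ⟨hr, hc, hp⟩ := hq
    set s := r + c with hs
    have hS : s + 1 ≤ S := by omega
    have b1 : r * t + t ≤ S * t := by
      have := Nat.mul_le_mul_right t (show r + 1 ≤ S by omega)
      rwa [Nat.add_mul, one_mul] at this
    have b2 : s * t + t ≤ S * t := by
      have := Nat.mul_le_mul_right t hS
      rwa [Nat.add_mul, one_mul] at this
    have l1 : r + s + 1 ≤ table (blockX R S t) (blockY false S t) (R + (r * t + (p + 2)))
        (s * t + (t - 1 - p)) := by
      rw [table, take_blockX (by omega) (by omega), take_blockY_down (by omega) (by omega)]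
      exact le_lcsLen_down (a := p + 1) (by omega) (by omega) (by omega) (by omega)
    have l2 : table (blockX R S t) (blockY false S t) (R + (r * t + (p + 1)))
        (s * t + (t - 1 - p)) ≤ r + s := by
      rw [table, take_blockX (by omega) (by omega), take_blockY_down (by omega) (by omega)]
      exact lcsLen_down_partial_le (by omega) (by omega)
    have l3 : table (blockX R S t) (blockY false S t) (R + (r * t + (p + 2)))
        (s * t + (t - 1 - p - 1)) ≤ r + s := by
      rw [table, take_blockX (by omega) (by omega), take_blockY_down (by omega) (by omega)]
      exact lcsLen_down_partial_le (by omega) (by omega)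
    change (R + (r * t + (p + 2)), s * t + (t - 1 - p)) ∈ _
    rw [mem_domSet, length_blockX, length_blockY,
      show R + (r * t + (p + 2)) - 1 = R + (r * t + (p + 1)) by omega,
      show s * t + (t - 1 - p) - 1 = s * t + (t - 1 - p - 1) by omega]
    exact ⟨⟨⟨by omega, by omega⟩, by omega, by omega⟩, by omega, by omega⟩
  have := Finset.card_le_card_of_injOn (s := Finset.range h ×ˢ Finset.range h ×ˢ
      Finset.range (t - 2)) (t := domSet (blockX R S t) (blockY false S t)) _ key (by
      rintro ⟨r, c, p⟩ hq ⟨r', c', p'⟩ hq' e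
      simp only [Finset.coe_product, Set.mem_prod, Finset.coe_range, Set.mem_Iio] at hq hq'
      simp only [Prod.mk.injEq] at e ⊢
      have a := eq_of_mul_add_eq (t := t) (u := r) (u' := r') (p := p) (p' := p')
        (by omega) (by omega) (by omega)
      have b := eq_of_mul_add_eq (t := t) (u := r + c) (u' := r' + c') (p := t - 1 - p)
        (p' := t - 1 - p') (by omega) (by omega) e.2
      omega)
  rw [← card_domSet]
  simpa using this

end Down

/-! ### Blocks with large `δ` and `Δ` -/

/-- After its first symbol, a common subsequence would have to consist of ones as well as of zeros.
-/
theorem lcsLen_delta {a b : ℕ} (ha : 1 ≤ a) :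
    lcsLen (0 :: List.replicate a 1) (1 :: List.replicate b 0) = 1 := by
  apply le_antisymm
  · obtain ⟨z, h1, h2, h⟩ := exists_lcs (0 :: List.replicate a 1) (1 :: List.replicate b 0)
    rw [← h]
    match z, h1, h2 with
    | [], _, _ => simp
    | [_], _, _ => simp
    | c :: d :: l, h1, h2 =>
      have p1 : (d :: l).Sublist (List.replicate a 1) := by
        simpa using h1.tail
      have p2 : (d :: l).Sublist (List.replicate b 0) := by
        simpa using h2.tail
      have q1 := List.eq_of_mem_replicate (p1.subset (List.mem_cons_self))
      have q2 := List.eq_of_mem_replicate (p2.subset (List.mem_cons_self))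
      omega
  · have := length_le_lcsLen (z := [1]) (x := 0 :: List.replicate a 1) (y := 1 :: List.replicate b 0)
      (by simp; omega) (by simp)
    simpa using this

theorem matchingPairs_delta (a b : ℕ) :
    matchingPairs (0 :: List.replicate a 1) (1 :: List.replicate b 0) = a + b := by
  rw [matchingPairs_eq_sum]
  simp [List.count_cons, List.count_replicate, add_comm]

/-! ### Concatenation over disjoint alphabets -/

/-- Both strings use exactly the symbols below `s`, and the first one is the longer one. -/
def OnAlphabet (s : ℕ) (x y : List ℕ) : Prop :=
  y.length ≤ x.length ∧ (∀ a, a ∈ x ↔ a < s) ∧ (∀ a, a ∈ y ↔ a < s)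

theorem OnAlphabet.isStringPair {s : ℕ} {x y : List ℕ} (h : OnAlphabet s x y) :
    IsStringPair x y := ⟨h.1, s, h.2⟩

/-- The concatenation of `u` and a copy of `v` over the symbols from `s` on. -/
def glue (s : ℕ) (u v : List ℕ) : List ℕ := u ++ v.map (· + s)

@[simp] theorem length_glue (s : ℕ) (u v : List ℕ) :
    (glue s u v).length = u.length + v.length := by simp [glue]

section Glue
variable {s t : ℕ} {x₁ x₂ y₁ y₂ : List ℕ}

theorem mem_glue {u v : List ℕ} (hu : ∀ a, a ∈ u ↔ a < s) (hv : ∀ a, a ∈ v ↔ a < t) (a : ℕ) :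
    a ∈ glue s u v ↔ a < s + t := by
  simp only [glue, List.mem_append, hu, List.mem_map, hv]
  constructor
  · rintro (h | ⟨b, h, rfl⟩) <;> omega
  · intro h
    rcases lt_or_ge a s with h' | h'
    · exact Or.inl h'
    · exact Or.inr ⟨a - s, by omega, by omega⟩

theorem OnAlphabet.glue (h₁ : OnAlphabet s x₁ y₁) (h₂ : OnAlphabet t x₂ y₂) :
    OnAlphabet (s + t) (glue s x₁ x₂) (LCSMono.glue s y₁ y₂) := by
  refine ⟨?_, mem_glue h₁.2.1 h₂.2.1, mem_glue h₁.2.2 h₂.2.2⟩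
  have := h₁.1
  have := h₂.1
  rw [length_glue, length_glue]; omega

/-- Truncated subtraction does no harm for δ and Δ, because L ≤ m ≤ n in each part separately. -/
theorem Param.val_glue (p : Param) (h₁ : OnAlphabet s x₁ y₁) (h₂ : OnAlphabet t x₂ y₂) :
    p.val (glue s x₁ x₂) (glue s y₁ y₂) = p.val x₁ y₁ + p.val x₂ y₂ := by
  have inj : Function.Injective (· + s : ℕ → ℕ) := add_left_injective s
  have a1 : ∀ a ∈ x₁, a < s := fun a h => (h₁.2.1 a).1 h
  have a2 : ∀ a ∈ y₁, a < s := fun a h => (h₁.2.2 a).1 h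
  have ge : ∀ v : List ℕ, ∀ a ∈ v.map (· + s), s ≤ a := by
    intro v a h
    obtain ⟨b, -, rfl⟩ := List.mem_map.1 h
    exact Nat.le_add_left _ _
  have hL : lcsLen (glue s x₁ x₂) (glue s y₁ y₂) = lcsLen x₁ y₁ + lcsLen x₂ y₂ := by
    rw [glue, glue, lcsLen_append_of_disjoint a1 a2 (ge _) (ge _), lcsLen_map inj]
  have l1 := lcsLen_le_right x₁ y₁
  have l2 := lcsLen_le_right x₂ y₂
  have l3 := h₁.1
  have l4 := h₂.1
  cases p with
  | m => simp [Param.val]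
  | L => exact hL
  | smallDelta => simp only [Param.val, hL, length_glue]; omega
  | bigDelta => simp only [Param.val, hL, length_glue]; omega
  | sigma =>
    simp only [Param.val]
    rw [alphabetSize_eq h₁.2.1 h₁.2.2, alphabetSize_eq h₂.2.1 h₂.2.2,
      alphabetSize_eq (h₁.glue h₂).2.1 (h₁.glue h₂).2.2]
  | M =>
    simp only [Param.val, glue]
    rw [matchingPairs_append, matchingPairs_map inj]
    · exact fun a h h' => absurd (ge _ a h') (by have := a1 a h; omega)
    · exact fun a h h' => absurd (ge _ a h) (by have := a2 a h'; omega)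
  | d =>
    simp only [Param.val, glue]
    rw [dominantPairs_append a1 a2 (ge _) (ge _), dominantPairs_map inj]

end Glue

theorem onAlphabet_delta {a b : ℕ} (hb : 1 ≤ b) (hab : b ≤ a) :
    OnAlphabet 2 (0 :: List.replicate a 1) (1 :: List.replicate b 0) := by
  refine ⟨by simpa using hab, fun c => ?_, fun c => ?_⟩ <;>
  · simp only [List.mem_cons, List.mem_replicate]; omega

theorem onAlphabet_block (R : ℕ) (up : Bool) {S t : ℕ} (hS : 1 ≤ S) (ht : 1 ≤ t) :
    OnAlphabet t (blockX R S t) (blockY up S t) :=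
  ⟨by simp, fun _ => mem_blockX hS ht, fun _ => mem_blockY hS⟩

/-! ### The padding -/

/-- The sizes and directions of the blocks of a padding. -/
structure Pad where
  a : ℕ
  b : ℕ
  R : ℕ
  S : ℕ
  t : ℕ
  up : Bool
  k : ℕ
  up' : Bool
  R' : ℕ
  S' : ℕ

namespace Pad
variable (D : Pad)

/-- The padded first string. -/
def X (x : List ℕ) : List ℕ :=
  glue 2 (0 :: List.replicate D.a 1) <| glue D.t (blockX D.R D.S D.t) <|
    glue D.k (blockX 0 1 D.k) <| glue 1 (blockX D.R' D.S' 1) x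

/-- The padded second string. -/
def Y (y : List ℕ) : List ℕ :=
  glue 2 (1 :: List.replicate D.b 0) <| glue D.t (blockY D.up D.S D.t) <|
    glue D.k (blockY D.up' 1 D.k) <| glue 1 (blockY true D.S' 1) y

/-- The conditions under which all blocks are string pairs. -/
structure Valid : Prop where
  b_pos : 1 ≤ D.b
  b_le : D.b ≤ D.a
  S_pos : 1 ≤ D.S
  t_ge : 2 ≤ D.t
  k_ge : 2 ≤ D.k
  S'_pos : 1 ≤ D.S'

/-- The contribution of the blocks to a parameter. -/
noncomputable def val (p : Param) : ℕ :=
  p.val (0 :: List.replicate D.a 1) (1 :: List.replicate D.b 0) +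
    (p.val (blockX D.R D.S D.t) (blockY D.up D.S D.t) +
      (p.val (blockX 0 1 D.k) (blockY D.up' 1 D.k) +
        p.val (blockX D.R' D.S' 1) (blockY true D.S' 1)))

variable {D}

theorem onAlphabet (h : D.Valid) {s : ℕ} {x y : List ℕ} (hxy : OnAlphabet s x y) :
    OnAlphabet (2 + (D.t + (D.k + (1 + s)))) (D.X x) (D.Y y) :=
  (onAlphabet_delta h.b_pos h.b_le).glue <|
    (onAlphabet_block D.R D.up h.S_pos (by have := h.t_ge; omega)).glue <|
    (onAlphabet_block 0 D.up' le_rfl (by have := h.k_ge; omega)).glue <|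
    (onAlphabet_block D.R' true h.S'_pos le_rfl).glue hxy

theorem val_eq (h : D.Valid) {s : ℕ} {x y : List ℕ} (hxy : OnAlphabet s x y) (p : Param) :
    p.val (D.X x) (D.Y y) = D.val p + p.val x y := by
  have h4 := onAlphabet_block D.R' true h.S'_pos le_rfl
  have h3 := onAlphabet_block 0 D.up' le_rfl (show 1 ≤ D.k by have := h.k_ge; omega)
  have h2 := onAlphabet_block D.R D.up h.S_pos (show 1 ≤ D.t by have := h.t_ge; omega)
  have h1 := onAlphabet_delta h.b_pos h.b_le
  rw [X, Y, Param.val_glue p h1 (h2.glue (h3.glue (h4.glue hxy))),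
    Param.val_glue p h2 (h3.glue (h4.glue hxy)), Param.val_glue p h3 (h4.glue hxy),
    Param.val_glue p h4 hxy, val]
  omega

theorem length_X (x : List ℕ) : (D.X x).length =
    (D.a + 1) + ((D.R + D.S * D.t) + (D.k + (D.R' + D.S'))) + x.length := by
  simp [X]; omega

theorem length_Y (y : List ℕ) : (D.Y y).length =
    (D.b + 1) + (D.S * D.t + (D.k + D.S')) + y.length := by
  simp [Y]; omega

/-- The length of a longest common subsequence of the blocks. -/
def lcs (D : Pad) : ℕ :=
  1 + ((if D.up then D.S * D.t else 2 * D.S - 1) + ((if D.up' then D.k else 1) + D.S'))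

/-- The other parameters of the padding matter up to constant factors only; this one is needed
exactly, because it is subtracted in the end. -/
theorem val_L (h : D.Valid) : D.val .L = D.lcs := by
  have h1 := lcsLen_delta (b := D.b) (h.b_pos.trans h.b_le)
  have h2 : lcsLen (blockX D.R D.S D.t) (blockY D.up D.S D.t) =
      if D.up then D.S * D.t else 2 * D.S - 1 := by
    cases hu : D.up
    · simpa [hu] using lcsLen_block_down h.S_pos h.t_ge
    · simpa [hu] using lcsLen_block_up _ _ _
  have h3 : lcsLen (blockX 0 1 D.k) (blockY D.up' 1 D.k) = if D.up' then D.k else 1 := by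
    cases hu : D.up'
    · simpa [hu] using lcsLen_block_down (R := 0) le_rfl h.k_ge
    · simpa [hu] using lcsLen_block_up 0 1 D.k
  have h4 : lcsLen (blockX D.R' D.S' 1) (blockY true D.S' 1) = D.S' := by
    rw [lcsLen_block_up, mul_one]
  simp only [val, Param.val, h1, h2, h3, h4, lcs]

end Pad

/-! ### Growth rates -/

/-- `f N = O(N ^ a)`. -/
def UB (a : ℝ) (f : ℕ → ℕ) : Prop := ∃ c : ℝ, 0 < c ∧ ∀ N : ℕ, 1 ≤ N → (f N : ℝ) ≤ c * (N : ℝ) ^ a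

/-- `f N = Ω(N ^ a)`. -/
def LB (a : ℝ) (f : ℕ → ℕ) : Prop := ∃ c : ℝ, 0 < c ∧ ∀ N : ℕ, 1 ≤ N → c * (N : ℝ) ^ a ≤ f N

section Growth
variable {a b : ℝ} {f g : ℕ → ℕ}

theorem UB.of_le (h : UB a g) (hfg : ∀ N, 1 ≤ N → f N ≤ g N) : UB a f := by
  obtain ⟨c, hc, h⟩ := h
  exact ⟨c, hc, fun N hN => (Nat.cast_le.2 (hfg N hN)).trans (h N hN)⟩

theorem LB.of_le (h : LB a f) (hfg : ∀ N, 1 ≤ N → f N ≤ g N) : LB a g := by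
  obtain ⟨c, hc, h⟩ := h
  exact ⟨c, hc, fun N hN => (h N hN).trans (Nat.cast_le.2 (hfg N hN))⟩

theorem UB.mono (h : UB a f) (hab : a ≤ b) : UB b f := by
  obtain ⟨c, hc, h⟩ := h
  refine ⟨c, hc, fun N hN => (h N hN).trans ?_⟩
  gcongr
  exact_mod_cast hN

theorem LB.mono (h : LB a f) (hab : b ≤ a) : LB b f := by
  obtain ⟨c, hc, h⟩ := h
  refine ⟨c, hc, fun N hN => le_trans ?_ (h N hN)⟩
  gcongr
  exact_mod_cast hN

theorem UB.add (hf : UB a f) (hg : UB a g) : UB a fun N => f N + g N := by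
  obtain ⟨c, hc, hf⟩ := hf
  obtain ⟨c', hc', hg⟩ := hg
  refine ⟨c + c', by positivity, fun N hN => ?_⟩
  have := hf N hN
  have := hg N hN
  push_cast
  linarith

theorem UB.mul (hf : UB a f) (hg : UB b g) : UB (a + b) fun N => f N * g N := by
  obtain ⟨c, hc, hf⟩ := hf
  obtain ⟨c', hc', hg⟩ := hg
  refine ⟨c * c', by positivity, fun N hN => ?_⟩
  have hN0 : (0 : ℝ) < N := by exact_mod_cast hN
  rw [Real.rpow_add hN0, mul_mul_mul_comm]
  push_cast
  exact mul_le_mul (hf N hN) (hg N hN) (by positivity) (by positivity)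

theorem LB.mul (hf : LB a f) (hg : LB b g) : LB (a + b) fun N => f N * g N := by
  obtain ⟨c, hc, hf⟩ := hf
  obtain ⟨c', hc', hg⟩ := hg
  refine ⟨c * c', by positivity, fun N hN => ?_⟩
  have hN0 : (0 : ℝ) < N := by exact_mod_cast hN
  rw [Real.rpow_add hN0, mul_mul_mul_comm]
  push_cast
  exact mul_le_mul (hf N hN) (hg N hN) (by positivity) (by positivity)

theorem LB.min (hf : LB a f) (hg : LB a g) : LB a fun N => min (f N) (g N) := by
  obtain ⟨c, hc, hf⟩ := hf
  obtain ⟨c', hc', hg⟩ := hg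
  refine ⟨Min.min c c', lt_min hc hc', fun N hN => ?_⟩
  rw [Nat.cast_min]
  refine le_min (le_trans ?_ (hf N hN)) (le_trans ?_ (hg N hN))
  · gcongr; exact min_le_left _ _
  · gcongr; exact min_le_right _ _

theorem UB.const (ha : 0 ≤ a) (k : ℕ) : UB a fun _ => k := by
  refine ⟨k + 1, by positivity, fun N hN => ?_⟩
  have : (1 : ℝ) ≤ (N : ℝ) ^ a := Real.one_le_rpow (by exact_mod_cast hN) ha
  nlinarith [show (0 : ℝ) ≤ k from k.cast_nonneg]

theorem LB.one (h : ∀ N, 1 ≤ N → 1 ≤ f N) : LB 0 f :=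
  ⟨1, one_pos, fun N hN => by simpa using h N hN⟩

theorem LB.pos (h : LB a f) {N : ℕ} (hN : 1 ≤ N) : 1 ≤ f N := by
  obtain ⟨c, hc, h⟩ := h
  have hN0 : (0 : ℝ) < N := by exact_mod_cast hN
  have : (0 : ℝ) < f N := lt_of_lt_of_le (by positivity) (h N hN)
  exact_mod_cast this

theorem UB.div (hf : UB a f) (hg : LB b g) : UB (a - b) fun N => f N / g N := by
  obtain ⟨c, hc, hf⟩ := hf
  obtain ⟨c', hc', hg⟩ := hg
  refine ⟨c / c', by positivity, fun N hN => ?_⟩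
  have hN0 : (0 : ℝ) < N := by exact_mod_cast hN
  rw [Real.rpow_sub hN0, div_mul_div_comm]
  exact Nat.cast_div_le.trans (div_le_div₀ (by positivity) (hf N hN) (by positivity) (hg N hN))

/-- The `+ 1` compensates for rounding down, so the lower bound survives even if the quotient is
zero. -/
theorem LB.div_succ (hf : LB a f) (hg : UB b g) (hg' : ∀ N, 1 ≤ N → 1 ≤ g N) :
    LB (a - b) fun N => f N / g N + 1 := by
  obtain ⟨c, hc, hf⟩ := hf
  obtain ⟨c', hc', hg⟩ := hg
  refine ⟨c / c', by positivity, fun N hN => ?_⟩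
  have hN0 : (0 : ℝ) < N := by exact_mod_cast hN
  rw [Real.rpow_sub hN0, div_mul_div_comm]
  have h0 : 0 < g N := hg' N hN
  have h1 : (f N : ℝ) / g N ≤ ((f N / g N + 1 : ℕ) : ℝ) := by
    rw [div_le_iff₀ (by exact_mod_cast h0)]
    have := Nat.lt_div_mul_add (a := f N) h0
    have : f N ≤ (f N / g N + 1) * g N := by rw [add_mul, one_mul]; exact this.le
    exact_mod_cast this
  exact (div_le_div₀ (by positivity) (hf N hN) (by exact_mod_cast h0) (hg N hN)).trans h1

theorem UB.of_le_mul (k : ℕ) (h : UB a g) (hfg : ∀ N, 1 ≤ N → f N ≤ k * g N) : UB a f :=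
  (zero_add a ▸ (UB.const le_rfl k).mul h).of_le hfg

theorem LB.of_le_mul (k : ℕ) (h : LB a f) (hfg : ∀ N, 1 ≤ N → f N ≤ k * g N) : LB a g := by
  obtain ⟨c, hc, h⟩ := h
  refine ⟨c / (k + 1), by positivity, fun N hN => ?_⟩
  have h1 : (f N : ℝ) ≤ k * g N := by exact_mod_cast hfg N hN
  have h2 := h N hN
  rw [div_mul_eq_mul_div, div_le_iff₀ (by positivity)]
  nlinarith [show (0 : ℝ) ≤ g N from (g N).cast_nonneg]

theorem UB.self : UB 1 fun N => N := ⟨1, one_pos, fun N _ => by simp⟩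

theorem LB.self : LB 1 fun N => N := ⟨1, one_pos, fun N _ => by simp⟩

end Growth

/-- The relations between the exponents of a non-trivial parameter setting. -/
structure Feasible (α : Param → ℝ) : Prop where
  nonneg : ∀ p, 0 ≤ α p
  m_le : α .m ≤ 1
  L_le : α .L ≤ α .m
  smallDelta_le : α .smallDelta ≤ α .m
  smallDelta_le' : α .smallDelta ≤ α .bigDelta
  bigDelta_le : α .bigDelta ≤ 1
  one_le : 1 ≤ max (α .L) (α .bigDelta)
  m_le' : α .m ≤ max (α .L) (α .smallDelta)
  sigma_le : α .sigma ≤ α .m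
  sigma_le' : α .sigma ≤ α .d
  L_le' : α .L ≤ α .d
  d_le : α .d ≤ α .M
  d_le_add : α .d ≤ α .L + α .m
  d_le_add' : α .d ≤ α .m + α .bigDelta
  d_le_add_sigma : α .d ≤ 2 * α .L + α .sigma
  one_le_M : 1 ≤ α .M
  L_le_add : 2 * α .L ≤ α .sigma + α .M
  M_le : α .M ≤ α .L + 1

/-! ### Upper bounds for single blocks -/

section Block
variable {α : Param → ℝ} {f : Param → ℕ → ℕ}

/-- If α_m ≤ α_L, use d ≤ m + Δ for the exponents; otherwise α_m ≤ α_δ ≤ α_Δ, and d ≤ L + m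
suffices. -/
theorem Feasible.d_le_add_bigDelta (h : Feasible α) : α .d ≤ α .L + α .bigDelta := by
  have h1 := h.d_le_add
  have h2 := h.d_le_add'
  have h3 := h.smallDelta_le'
  rcases le_max_iff.1 h.m_le' with h4 | h4 <;> linarith

/-- If the common subsequence is short, almost everything is unmatched: δ has to make up m, and Δ
has to make up n. Hence blocks with few matched symbols are harmless in this case. -/
theorem Feasible.eq_of_L_lt (h : Feasible α) (hL : α .L < α .m) :
    α .smallDelta = α .m ∧ α .bigDelta = 1 := by
  have h1 := h.smallDelta_le
  have h2 := h.m_le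
  have h3 := h.bigDelta_le
  rcases le_max_iff.1 h.m_le' with h4 | h4 <;> rcases le_max_iff.1 h.one_le with h5 | h5 <;>
    constructor <;> linarith

/-- All contributions of a sequence of blocks are as small as the exponents allow. -/
def BlockUB (α : Param → ℝ) (x y : ℕ → List ℕ) : Prop :=
  UB 1 (fun N => (x N).length) ∧ ∀ p : Param, UB (α p) fun N => p.val (x N) (y N)

theorem blockUB_delta (h : Feasible α) (hf : ∀ p, UB (α p) (f p)) (hf' : ∀ p, LB (α p) (f p)) :
    BlockUB α (fun N => 0 :: List.replicate (f .bigDelta N + f .smallDelta N) 1)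
      fun N => 1 :: List.replicate (f .smallDelta N) 0 := by
  have hn := h.nonneg
  have ha : UB (α .bigDelta) fun N => f .bigDelta N + f .smallDelta N :=
    (hf _).add ((hf _).mono h.smallDelta_le')
  have hL : ∀ N, 1 ≤ N → lcsLen (0 :: List.replicate (f .bigDelta N + f .smallDelta N) 1)
      (1 :: List.replicate (f .smallDelta N) 0) = 1 := fun N hN =>
    lcsLen_delta (by have := (hf' .bigDelta).pos hN; omega)
  have hS : ∀ N, 1 ≤ N → OnAlphabet 2 (0 :: List.replicate (f .bigDelta N + f .smallDelta N) 1)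
      (1 :: List.replicate (f .smallDelta N) 0) := fun N hN =>
    onAlphabet_delta ((hf' _).pos hN) (by omega)
  refine ⟨?_, fun p => ?_⟩
  · simpa using (ha.mono h.bigDelta_le).add (UB.const zero_le_one 1)
  cases p with
  | m => simpa [Param.val] using ((hf .smallDelta).mono h.smallDelta_le).add (UB.const (hn _) 1)
  | L => exact (UB.const (hn _) 1).of_le fun N hN => (hL N hN).le
  | smallDelta => exact (hf .smallDelta).of_le fun N hN => by simp [Param.val, hL N hN]
  | bigDelta => exact ha.of_le fun N hN => by simp [Param.val, hL N hN]
  | sigma =>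
    exact (UB.const (hn _) 2).of_le fun N hN => (alphabetSize_eq (hS N hN).2.1 (hS N hN).2.2).le
  | M =>
    exact ((ha.mono h.bigDelta_le).add
      (((hf .smallDelta).mono h.smallDelta_le).mono h.m_le)).mono h.one_le_M |>.of_le
      fun N _ => (matchingPairs_delta _ _).le
  | d =>
    -- From d ≤ L²·|Σ| with L = 1 and |Σ| = 2.
    refine (UB.const (hn _) 2).of_le fun N hN => ?_
    have := dominantPairs_le_sq_mul (y := 1 :: List.replicate (f .smallDelta N) 0)
      fun a ha => ((hS N hN).2.1 a).1 ha
    rwa [hL N hN, one_mul, one_mul] at this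

/-- A block bound from bounds on the sizes. -/
theorem blockUB_up {R S t : ℕ → ℕ} (h : Feasible α) (hS : ∀ N, 1 ≤ N → 1 ≤ S N)
    (ht : ∀ N, 1 ≤ N → 1 ≤ t N) (hSt : UB (α .L) fun N => S N * t N)
    (hR : UB (α .bigDelta) R) (hsig : UB (α .sigma) t)
    (hM : UB (α .M) fun N => (R N + S N * t N) * S N)
    (hd : UB (α .d) fun N => dominantPairs (blockX (R N) (S N) (t N)) (blockY true (S N) (t N))) :
    BlockUB α (fun N => blockX (R N) (S N) (t N)) fun N => blockY true (S N) (t N) := by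
  have hn := h.nonneg
  refine ⟨?_, fun p => ?_⟩
  · simpa using (hR.mono h.bigDelta_le).add (hSt.mono (h.L_le.trans h.m_le))
  cases p with
  | m => simpa [Param.val] using hSt.mono h.L_le
  | L => simpa [Param.val, lcsLen_block_up] using hSt
  | smallDelta =>
    exact (UB.const (hn _) 0).of_le fun N _ => by simp [Param.val, lcsLen_block_up]
  | bigDelta => exact hR.of_le fun N _ => by simp [Param.val, lcsLen_block_up]
  | sigma =>
    exact hsig.of_le fun N hN => (alphabetSize_eq (fun a => mem_blockX (hS N hN) (ht N hN))
      fun a => mem_blockY (hS N hN)).le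
  | M => exact hM.of_le fun N hN => (matchingPairs_block true (hS N hN) (ht N hN)).le
  | d => exact hd

/-- A bound for descending blocks, which are only used if `δ` and `Δ` are as large as possible. -/
theorem blockUB_down {R S t : ℕ → ℕ} (h : Feasible α) (hLm : α .L < α .m)
    (hS : ∀ N, 1 ≤ N → 1 ≤ S N) (ht : ∀ N, 1 ≤ N → 2 ≤ t N) (hSt : UB (α .m) fun N => S N * t N)
    (hR : UB 1 R) (hSL : UB (α .L) S) (hsig : UB (α .sigma) t)
    (hM : UB (α .d) fun N => (R N + S N * t N) * S N) :
    BlockUB α (fun N => blockX (R N) (S N) (t N)) fun N => blockY false (S N) (t N) := by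
  have hn := h.nonneg
  have hx : UB 1 fun N => (blockX (R N) (S N) (t N)).length := by
    simpa using hR.add (hSt.mono h.m_le)
  have hy : UB (α .m) fun N => (blockY false (S N) (t N)).length := by simpa using hSt
  have hM' : UB (α .d) fun N => matchingPairs (blockX (R N) (S N) (t N))
      (blockY false (S N) (t N)) := hM.of_le fun N hN =>
    (matchingPairs_block false (hS N hN) (by have := ht N hN; omega)).le
  refine ⟨hx, fun p => ?_⟩
  cases p with
  | m => exact hy
  | L =>
    refine hSL.of_le_mul 2 fun N hN => ?_
    rw [Param.val, lcsLen_block_down (hS N hN) (ht N hN)]; omega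
  | smallDelta =>
    rw [(h.eq_of_L_lt hLm).1]
    exact hy.of_le fun N _ => Nat.sub_le _ _
  | bigDelta =>
    rw [(h.eq_of_L_lt hLm).2]
    exact hx.of_le fun N _ => Nat.sub_le _ _
  | sigma =>
    exact hsig.of_le fun N hN => (alphabetSize_eq (fun a => mem_blockX (hS N hN)
      (by have := ht N hN; omega)) fun a => mem_blockY (hS N hN)).le
  | M => exact hM'.mono h.d_le
  | d => exact hM'.of_le fun N _ => dominantPairs_le_matchingPairs _ _

/-- If α_σ ≤ α_L, equal strings may be used, as their contribution to L is affordable. Otherwise the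
reversal keeps L at one, and α_L < α_m makes the contribution to δ and Δ affordable. In both cases d
≤ M = k. -/
theorem blockUB_sigma (h : Feasible α) (hf : ∀ p, UB (α p) (f p)) :
    BlockUB α (fun N => blockX 0 1 (f .sigma N + 2))
      fun N => blockY (decide (α .sigma ≤ α .L)) 1 (f .sigma N + 2) := by
  have hn := h.nonneg
  have ht : UB (α .sigma) fun N => f .sigma N + 2 := (hf _).add (UB.const (hn _) 2)
  have hd := ht.mono h.sigma_le'
  by_cases hL : α .sigma ≤ α .L
  · simp only [hL, decide_true]
    refine blockUB_up h (fun _ _ => le_rfl) (fun _ _ => by omega) ?_ (UB.const (hn _) 0) ht ?_ ?_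
    · simpa using ht.mono hL
    · simpa using hd.mono h.d_le
    · refine hd.of_le fun N _ => (dominantPairs_le_matchingPairs _ _).trans ?_
      rw [matchingPairs_block true le_rfl (by omega)]; omega
  · simp only [hL, decide_false]
    have hLm : α .L < α .m := (not_le.1 hL).trans_le h.sigma_le
    refine blockUB_down h hLm (fun _ _ => le_rfl) (fun _ _ => by omega) ?_
      (UB.const zero_le_one 0) (UB.const (hn _) 1) ht ?_
    · simpa using ht.mono h.sigma_le
    · simpa using hd

end Block

/-- The padding for size `N`, given the target values. -/
noncomputable def padOf (α : Param → ℝ) (f : Param → ℕ → ℕ) (N : ℕ) : Pad :=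
  open scoped Classical in
  let t := if α .d ≤ 2 * α .L then f .L N * f .L N / f .M N + 2
    else f .d N / (f .L N * f .L N) + 3
  { a := f .bigDelta N + f .smallDelta N
    b := f .smallDelta N
    t := t
    S := if α .d ≤ 2 * α .L then f .L N / t + 1 else f .L N
    R := if α .d ≤ 2 * α .L then f .d N / f .L N + 1 else f .L N
    up := decide (α .d ≤ 2 * α .L)
    k := f .sigma N + 2
    up' := decide (α .sigma ≤ α .L)
    R' := if α .L < 1 then N else 0
    S' := if α .L < 1 then f .M N / N + 1 else 1 }

/-! ### Growth of the parameters of the padding -/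

section Bounds
variable {α : Param → ℝ} {f : Param → ℕ → ℕ}

theorem le_div_succ_mul (a : ℕ) {b : ℕ} (hb : 0 < b) : a ≤ (a / b + 1) * b := by
  have := Nat.lt_div_mul_add (a := a) hb
  rw [add_mul, one_mul]; exact this.le

section Ascending
variable (h : Feasible α) (hf : ∀ p, UB (α p) (f p)) (hf' : ∀ p, LB (α p) (f p))
  (hA : α .d ≤ 2 * α .L)
include h hf hf' hA

/-- With τ = max(2α_L - α_M, 0) the sizes are t ≈ N^τ, S ≈ N^(α_L - τ) and R ≈ N^(α_d - α_L). Then L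
= St as desired, d ≈ St·R, and M = (R + St)·S has the dominating term St·S ≈ N^min(2α_L, α_M). The
alphabet is affordable because 2α_L ≤ α_σ + α_M. The lower bound on d requires R not to exceed S in
order, that is α_d ≤ 2α_L - τ, which combines α_d ≤ 2α_L and α_d ≤ α_M. -/
theorem padOf_ascending :
    BlockUB α (fun N => blockX (padOf α f N).R (padOf α f N).S (padOf α f N).t)
      (fun N => blockY (padOf α f N).up (padOf α f N).S (padOf α f N).t) ∧
    LB (α .L) (fun N => Param.L.val (blockX (padOf α f N).R (padOf α f N).S (padOf α f N).t)
      (blockY (padOf α f N).up (padOf α f N).S (padOf α f N).t)) ∧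
    LB (α .d) (fun N => Param.d.val (blockX (padOf α f N).R (padOf α f N).S (padOf α f N).t)
      (blockY (padOf α f N).up (padOf α f N).S (padOf α f N).t)) ∧
    LB (min (2 * α .L) (α .M)) (fun N => Param.M.val
      (blockX (padOf α f N).R (padOf α f N).S (padOf α f N).t)
      (blockY (padOf α f N).up (padOf α f N).S (padOf α f N).t)) := by
  have hn := h.nonneg
  simp only [padOf, hA, if_true, decide_true]
  set t : ℕ → ℕ := fun N => f .L N * f .L N / f .M N + 2 with ht
  set S : ℕ → ℕ := fun N => f .L N / t N + 1 with hS
  set R : ℕ → ℕ := fun N => f .d N / f .L N + 1 with hR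
  set τ := max (2 * α .L - α .M) 0 with hτ
  have τ1 : 2 * α .L - α .M ≤ τ := le_max_left _ _
  have τ0 : 0 ≤ τ := le_max_right _ _
  have τL : τ ≤ α .L := max_le (by have := h.L_le'; have := h.d_le; linarith) (hn _)
  have τσ : τ ≤ α .sigma := max_le (by have := h.L_le_add; linarith) (hn _)
  have τd : α .d ≤ 2 * α .L - τ := by
    rcases max_choice (2 * α .L - α .M) 0 with e | e <;> rw [hτ, e]
    · have := h.d_le; linarith
    · linarith
  have τM : min (2 * α .L) (α .M) = 2 * α .L - τ := by
    rcases le_total (2 * α .L) (α .M) with e | e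
    · rw [min_eq_left e, hτ, max_eq_right (by linarith), sub_zero]
    · rw [min_eq_right e, hτ, max_eq_left (by linarith)]; ring
  have τM' : 2 * α .L - τ ≤ α .M := by linarith
  have dL := h.L_le'
  have tU : UB τ t := ((((hf .L).mul (hf .L)).div (hf' .M)).mono (by linarith)).add
    (UB.const τ0 2)
  -- The count of dominant pairs involves t - 1; the summand 2 in t leaves quotient plus one here.
  have tL : LB τ fun N => t N - 1 := by
    have : LB (α .L + α .L - α .M) fun N => t N - 1 :=
      ((hf' .L).mul (hf' .L)).div_succ (hf .M) fun N hN => (hf' .M).pos hN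
    rcases max_choice (2 * α .L - α .M) 0 with e | e <;> rw [hτ, e]
    · exact this.mono (by linarith)
    · exact LB.one fun N _ => by simp [ht]
  have tL' : LB τ t := tL.of_le fun N _ => Nat.sub_le _ _
  have SU : UB (α .L - τ) S := ((hf .L).div tL').add (UB.const (by linarith) 1)
  have SL : LB (α .L - τ) S := (hf' .L).div_succ tU fun N _ => by simp [ht]
  have hh : LB (α .L - τ) fun N => (S N + 1) / 2 := SL.of_le_mul 2 fun N _ => by omega
  have RU : UB (α .d - α .L) R := ((hf .d).div (hf' .L)).add (UB.const (by linarith) 1)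
  have RL : LB (α .d - α .L) R := (hf' .d).div_succ (hf .L) fun N hN => (hf' .L).pos hN
  have StU : UB (α .L) fun N => S N * t N := (SU.mul tU).mono (by linarith)
  have StL : LB (α .L) fun N => S N * t N := (hf' .L).of_le fun N _ =>
    le_div_succ_mul _ (by simp [ht])
  have S1 : ∀ N, 1 ≤ N → 1 ≤ S N := fun N _ => by simp [hS]
  have t1 : ∀ N, 1 ≤ N → 1 ≤ t N := fun N _ => by simp [ht]
  have RD : UB (α .bigDelta) R := RU.mono (by have := h.d_le_add_bigDelta; linarith)
  refine ⟨blockUB_up h S1 t1 StU RD (tU.mono τσ) ?_ ?_, ?_, ?_, ?_⟩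
  · have h1 : UB (α .M) fun N => R N * S N := (RU.mul SU).mono (by have := h.d_le; linarith)
    have h2 : UB (α .M) fun N => S N * t N * S N := (StU.mul SU).mono (by linarith)
    exact (h1.add h2).of_le fun N _ => (Nat.add_mul _ _ _).le
  · have : UB (α .d) fun N => S N * t N * (R N + 1) :=
      (StU.mul (RU.add (UB.const (by linarith) 1))).mono (by linarith)
    refine this.of_le_mul 2 fun N _ => ?_
    have := dominantPairs_le_mul_delta (x := blockX (R N) (S N) (t N))
      (y := blockY true (S N) (t N)) (by simp)
    rw [lcsLen_block_up, length_blockX, length_blockY, Nat.add_sub_cancel, mul_assoc] at this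
    exact this
  · exact StL.of_le fun N _ => (lcsLen_block_up _ _ _).ge
  · have hmin : LB (α .d - α .L) fun N => min (R N + 1) ((S N + 1) / 2) :=
      (RL.of_le fun N _ => Nat.le_succ _).min (hh.mono (by linarith))
    exact ((hh.mul (hmin.mul tL)).mono (by linarith)).of_le fun N _ =>
      le_dominantPairs_up (Nat.mul_div_le _ _)
  · rw [τM]
    exact ((StL.mul SL).mono (by linarith)).of_le fun N hN => by
      simp only [Param.val]
      rw [matchingPairs_block true (S1 N hN) (t1 N hN)]
      exact Nat.mul_le_mul_right _ (Nat.le_add_left _ _)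

end Ascending

/-- Now S = R ≈ N^α_L and t ≈ N^(α_d - 2α_L), so that S²t ≈ N^α_d bounds d from below, and M = (R +
St)·S bounds it from above by the same order. The length St ≈ N^(α_d - α_L) is affordable by α_d ≤
α_L + α_m, the alphabet by α_d ≤ 2α_L + α_σ. Moreover 2α_L < α_d ≤ α_L + α_m gives α_L < α_m, which
justifies descending runs. -/
theorem padOf_descending (h : Feasible α) (hf : ∀ p, UB (α p) (f p)) (hf' : ∀ p, LB (α p) (f p))
    (hA : ¬α .d ≤ 2 * α .L) :
    BlockUB α (fun N => blockX (padOf α f N).R (padOf α f N).S (padOf α f N).t)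
      (fun N => blockY (padOf α f N).up (padOf α f N).S (padOf α f N).t) ∧
    LB (α .L) (fun N => Param.L.val (blockX (padOf α f N).R (padOf α f N).S (padOf α f N).t)
      (blockY (padOf α f N).up (padOf α f N).S (padOf α f N).t)) ∧
    LB (α .d) (fun N => Param.d.val (blockX (padOf α f N).R (padOf α f N).S (padOf α f N).t)
      (blockY (padOf α f N).up (padOf α f N).S (padOf α f N).t)) := by
  have hn := h.nonneg
  simp only [padOf, hA, if_false, decide_false]
  have hA' := not_le.1 hA
  have dL := h.d_le_add
  have hL := hn .L
  have hLm : α .L < α .m := by linarith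
  set t : ℕ → ℕ := fun N => f .d N / (f .L N * f .L N) + 3 with ht
  have hfL := fun N hN => (hf' .L).pos (N := N) hN
  have tU : UB (α .d - 2 * α .L) t := (((hf .d).div ((hf' .L).mul (hf' .L))).mono
    (by linarith)).add (UB.const (by linarith) 3)
  have tL : LB (α .d - 2 * α .L) fun N => t N - 2 := ((hf' .d).div_succ ((hf .L).mul (hf .L))
    fun N hN => Nat.mul_pos (hfL N hN) (hfL N hN)).mono (by linarith)
  have hh : LB (α .L) fun N => (f .L N + 1) / 2 := (hf' .L).of_le_mul 2 fun N _ => by omega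
  have StU : UB (α .d - α .L) fun N => f .L N * t N := ((hf .L).mul tU).mono (by linarith)
  have t2 : ∀ N, 1 ≤ N → 2 ≤ t N := fun N _ => by simp [ht]
  refine ⟨blockUB_down h hLm hfL t2 (StU.mono (by linarith))
    ((hf .L).mono (h.L_le.trans h.m_le)) (hf .L)
    (tU.mono (by have := h.d_le_add_sigma; linarith)) ?_, ?_, ?_⟩
  · have h1 : UB (α .d) fun N => f .L N * f .L N := ((hf .L).mul (hf .L)).mono (by linarith)
    have h2 : UB (α .d) fun N => f .L N * t N * f .L N := (StU.mul (hf .L)).mono (by linarith)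
    exact (h1.add h2).of_le fun N _ => (Nat.add_mul _ _ _).le
  · exact (hf' .L).of_le fun N hN => by
      simp only [Param.val]
      rw [lcsLen_block_down (hfL N hN) (t2 N hN)]
      have := hfL N hN
      omega
  · exact ((hh.mul (hh.mul tL)).mono (by linarith)).of_le fun N _ =>
      le_dominantPairs_down (Nat.mul_div_le _ _) le_rfl

/-- If α_L < 1 then α_Δ = 1, so N surplus zeros are affordable, and S' ≈ N^(α_M - 1) is affordable
by α_M ≤ α_L + 1. If α_L = 1, the block is a trivial single match. -/
theorem padOf_matching (h : Feasible α) (hf : ∀ p, UB (α p) (f p)) (hf' : ∀ p, LB (α p) (f p)) :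
    BlockUB α (fun N => blockX (padOf α f N).R' (padOf α f N).S' 1)
      (fun N => blockY true (padOf α f N).S' 1) ∧
    (α .L < 1 → LB (α .M) fun N => N * (padOf α f N).S') := by
  have hn := h.nonneg
  by_cases hL : α .L < 1
  · simp only [padOf, hL, if_true]
    have hD : α .bigDelta = 1 := by
      have := h.bigDelta_le
      rcases le_max_iff.1 h.one_le with e | e <;> linarith
    have hM := h.one_le_M
    have hML := h.M_le
    have SU : UB (α .M - 1) fun N => f .M N / N + 1 :=
      ((hf .M).div LB.self).add (UB.const (by linarith) 1)
    have SL : UB (α .L) fun N => f .M N / N + 1 := SU.mono (by linarith)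
    refine ⟨blockUB_up h (fun N _ => by simp) (fun N _ => le_rfl) (by simpa using SL)
      (hD ▸ UB.self) (UB.const (hn _) 1) ?_ ?_, ?_⟩
    · have h1 : UB (α .M) fun N => N * (f .M N / N + 1) := (UB.self.mul SU).mono (by linarith)
      have h2 : UB (α .M) fun N => (f .M N / N + 1) * 1 * (f .M N / N + 1) := by
        simpa using (SU.mul SL).mono (by linarith)
      exact (h1.add h2).of_le fun N _ => (Nat.add_mul _ _ _).le
    · refine (SL.mono h.L_le').of_le fun N _ => ?_
      rw [blockX_one, blockY_one]
      exact dominantPairs_replicate_le _ _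
    · intro _
      exact (hf' .M).of_le fun N hN => by
        rw [mul_comm]; exact le_div_succ_mul _ hN
  · simp only [padOf, hL, if_false]
    refine ⟨blockUB_up h (fun N _ => le_rfl) (fun N _ => le_rfl) (UB.const (hn _) _)
      (UB.const (hn _) _) (UB.const (hn _) 1) (UB.const (hn _) _) (UB.const (hn _) _),
      fun e => e.elim⟩

theorem padOf_valid (hf' : ∀ p, LB (α p) (f p)) {N : ℕ} (hN : 1 ≤ N) : (padOf α f N).Valid where
  b_pos := (hf' .smallDelta).pos hN
  b_le := by simp [padOf]
  S_pos := by
    simp only [padOf]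
    split_ifs
    · exact Nat.le_add_left _ _
    · exact (hf' .L).pos hN
  t_ge := by
    simp only [padOf]
    split_ifs
    · exact Nat.le_add_left _ _
    · exact le_trans (by norm_num) (Nat.le_add_left 3 _)
  k_ge := by simp [padOf]
  S'_pos := by
    simp only [padOf]
    split_ifs
    · exact Nat.le_add_left _ _
    · exact le_rfl

theorem onAlphabet_nil : OnAlphabet 0 [] [] := ⟨le_rfl, by simp, by simp⟩

/-- Upper bounds are sums over the blocks; for a lower bound, the block in charge of the parameter
suffices. For m and n, the identities m = L + δ and n = L + Δ together with `m_le'` and `one_le`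
reduce to the other parameters. -/
theorem padOf_bounds (h : Feasible α) (hf : ∀ p, UB (α p) (f p)) (hf' : ∀ p, LB (α p) (f p)) :
    (UB 1 fun N => ((padOf α f N).X []).length) ∧ (LB 1 fun N => ((padOf α f N).X []).length) ∧
    ∀ p, UB (α p) (fun N => (padOf α f N).val p) ∧ LB (α p) fun N => (padOf α f N).val p := by
  have b1 := blockUB_delta h hf hf'
  have b3 := blockUB_sigma h hf
  have b4 := (padOf_matching h hf hf').1
  obtain ⟨b2, dL, dd⟩ :
      BlockUB α (fun N => blockX (padOf α f N).R (padOf α f N).S (padOf α f N).t)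
        (fun N => blockY (padOf α f N).up (padOf α f N).S (padOf α f N).t) ∧
      LB (α .L) (fun N => Param.L.val (blockX (padOf α f N).R (padOf α f N).S (padOf α f N).t)
        (blockY (padOf α f N).up (padOf α f N).S (padOf α f N).t)) ∧
      LB (α .d) (fun N => Param.d.val (blockX (padOf α f N).R (padOf α f N).S (padOf α f N).t)
        (blockY (padOf α f N).up (padOf α f N).S (padOf α f N).t)) := by
    by_cases hA : α .d ≤ 2 * α .L
    · have := padOf_ascending h hf hf' hA
      exact ⟨this.1, this.2.1, this.2.2.1⟩
    · exact padOf_descending h hf hf' hA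
  -- Gluing the empty pair realises the contributions as parameters of actual strings, for which L ≤
  -- m and L ≤ n are available.
  have hval : ∀ N, 1 ≤ N → ∀ p : Param,
      p.val ((padOf α f N).X []) ((padOf α f N).Y []) = (padOf α f N).val p + p.val [] [] :=
    fun N hN p => Pad.val_eq (padOf_valid hf' hN) onAlphabet_nil p
  have hL0 : lcsLen [] [] = 0 := Nat.le_zero.1 (lcsLen_le_left [] [])
  have hLL : LB (α .L) fun N => (padOf α f N).val .L := dL.of_le fun N _ => by
    simp only [Pad.val]; omega
  have hsD : LB (α .smallDelta) fun N => (padOf α f N).val .smallDelta :=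
    (hf' .smallDelta).of_le fun N hN => by
      have : lcsLen (0 :: List.replicate (f .bigDelta N + f .smallDelta N) 1)
          (1 :: List.replicate (f .smallDelta N) 0) = 1 :=
        lcsLen_delta (by have := (hf' .bigDelta).pos hN; omega)
      simp only [Pad.val, padOf, Param.val, this, List.length_cons, List.length_replicate]
      omega
  have hbD : LB (α .bigDelta) fun N => (padOf α f N).val .bigDelta :=
    (hf' .bigDelta).of_le fun N hN => by
      have : lcsLen (0 :: List.replicate (f .bigDelta N + f .smallDelta N) 1)
          (1 :: List.replicate (f .smallDelta N) 0) = 1 :=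
        lcsLen_delta (by have := (hf' .bigDelta).pos hN; omega)
      simp only [Pad.val, padOf, Param.val, this, List.length_cons, List.length_replicate]
      omega
  refine ⟨?_, ?_, fun p => ⟨?_, ?_⟩⟩
  · refine (b1.1.add (b2.1.add (b3.1.add b4.1))).of_le fun N _ => ?_
    simp only [Pad.X, length_glue, List.length_nil, add_zero]
    simp [padOf]
  · have l1 : LB (α .L) fun N => ((padOf α f N).X []).length := hLL.of_le fun N hN => by
      have h1 := hval N hN .L
      have h2 := lcsLen_le_left ((padOf α f N).X []) ((padOf α f N).Y [])
      simp only [Param.val] at h1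
      omega
    have l2 : LB (α .bigDelta) fun N => ((padOf α f N).X []).length := hbD.of_le fun N hN => by
      have h1 := hval N hN .bigDelta
      simp only [Param.val] at h1
      omega
    rcases le_max_iff.1 h.one_le with e | e
    · exact l1.mono e
    · exact l2.mono e
  · exact (b1.2 p).add ((b2.2 p).add ((b3.2 p).add (b4.2 p)))
  · cases p with
    | m =>
      rcases le_max_iff.1 h.m_le' with e | e
      · refine (hLL.mono e).of_le fun N hN => ?_
        have h1 := hval N hN .L
        have h2 := hval N hN .m
        have h3 := lcsLen_le_right ((padOf α f N).X []) ((padOf α f N).Y [])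
        simp only [Param.val, List.length_nil] at h1 h2
        omega
      · refine (hsD.mono e).of_le fun N hN => ?_
        have h1 := hval N hN .smallDelta
        have h2 := hval N hN .m
        simp only [Param.val, List.length_nil] at h1 h2
        omega
    | L => exact hLL
    | smallDelta => exact hsD
    | bigDelta => exact hbD
    | sigma =>
      refine (hf' .sigma).of_le fun N hN => ?_
      have : alphabetSize (blockX 0 1 (f .sigma N + 2))
          (blockY (decide (α .sigma ≤ α .L)) 1 (f .sigma N + 2)) = f .sigma N + 2 :=
        alphabetSize_eq (fun a => mem_blockX le_rfl (by omega)) fun a => mem_blockY le_rfl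
      simp only [Pad.val, padOf, Param.val, this]
      omega
    | M =>
      by_cases hL : α .L < 1
      · refine ((padOf_matching h hf hf').2 hL).of_le fun N hN => ?_
        have := matchingPairs_block true (R := (padOf α f N).R')
          (padOf_valid hf' hN).S'_pos (le_refl 1)
        have hR : (padOf α f N).R' = N := by simp [padOf, hL]
        simp only [Pad.val, Param.val, this]
        have : N * (padOf α f N).S' ≤ ((padOf α f N).R' + (padOf α f N).S' * 1) *
          (padOf α f N).S' := Nat.mul_le_mul_right _ (by omega)
        omega
      -- For α_L ≥ 1 the inequalities α_d ≤ α_L + α_m ≤ 2α_L put the main block in the ascending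
      -- case, and α_M ≤ α_L + 1 ≤ 2α_L shows that it already has enough matching pairs.
      · have h1 := h.d_le_add
        have h2 := h.m_le
        have h3 := h.M_le
        have h4 := (padOf_ascending h hf hf' (by linarith)).2.2.2
        refine (h4.mono (le_min (by linarith) le_rfl)).of_le fun N _ => ?_
        simp only [Pad.val]; omega
    | d => exact dd.of_le fun N _ => by simp only [Pad.val]; omega

end Bounds

/-! ### Exponents of non-trivial parameter settings -/

/-- Symbols are below |x| by the convention on the alphabet. So infinitely many instances contain
arbitrarily long ones, which is how non-triviality is used. -/
theorem finite_stringPairs (n : ℕ) :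
    {I : List ℕ × List ℕ | IsStringPair I.1 I.2 ∧ I.1.length ≤ n}.Finite := by
  have h : ({l : List (Fin n) | l.length ≤ n}.image (List.map Fin.val)).Finite :=
    (List.finite_length_le (Fin n) n).image _
  refine (h.prod h).subset ?_
  rintro ⟨x, y⟩ ⟨hI, hn⟩
  have key : ∀ l : List ℕ, l.length ≤ n → (∀ a ∈ l, a < n) →
      l ∈ {l : List (Fin n) | l.length ≤ n}.image (List.map Fin.val) := fun l hl ha =>
    ⟨l.pmap Fin.mk ha, by simpa using hl, by simp [List.map_pmap]⟩
  exact ⟨key x hn fun a ha => (hI.mem_lt (List.mem_append_left _ ha)).trans_le hn,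
    key y (hI.1.trans hn) fun a ha => (hI.mem_lt (List.mem_append_right _ ha)).trans_le hn⟩

section Rate
variable {I : Set (List ℕ × List ℕ)} {a b c : ℝ} {u v w : List ℕ → List ℕ → ℕ}

/-- Up to a constant factor, `v` is the `a`-th power of the length of the first string. -/
def Rate (I : Set (List ℕ × List ℕ)) (a : ℝ) (v : List ℕ → List ℕ → ℕ) : Prop :=
  ∃ γ : ℝ, 0 < γ ∧ ∀ x y, (x, y) ∈ I →
    (x.length : ℝ) ^ a ≤ γ * v x y ∧ (v x y : ℝ) ≤ γ * (x.length : ℝ) ^ a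

/-- If a exceeded max(b, c), then n^(a - max(b, c)) would be bounded on instances with unbounded n.
-/
theorem le_max_of_rate (hI : ∀ n : ℕ, ∃ x y, (x, y) ∈ I ∧ n < x.length) (hu : Rate I a u)
    (hv : Rate I b v) (hw : Rate I c w) (k : ℕ)
    (h : ∀ x y, (x, y) ∈ I → u x y ≤ k * (v x y + w x y)) : a ≤ max b c := by
  by_contra! hlt
  obtain ⟨γ, hγ, hu⟩ := hu
  obtain ⟨γ', hγ', hv⟩ := hv
  obtain ⟨γ'', hγ'', hw⟩ := hw
  set e := max b c with he
  obtain ⟨n₀, hn₀⟩ := Filter.eventually_atTop.1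
    (((tendsto_rpow_atTop (sub_pos.2 hlt)).comp tendsto_natCast_atTop_atTop).eventually_gt_atTop
      (γ * (k * (γ' + γ''))))
  obtain ⟨x, y, hxy, hn⟩ := hI n₀
  have h1 := hn₀ x.length hn.le
  have hx1 : (1 : ℝ) ≤ x.length := by exact_mod_cast (by omega : 1 ≤ x.length)
  have hx : (0 : ℝ) < x.length := by linarith
  simp only [Function.comp] at h1
  rw [Real.rpow_sub hx, lt_div_iff₀ (by positivity)] at h1
  refine absurd h1 (not_lt.2 ?_)
  have h2 : (u x y : ℝ) ≤ k * (v x y + w x y) := by exact_mod_cast h x y hxy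
  have h3 : (v x y : ℝ) ≤ γ' * (x.length : ℝ) ^ e := (hv x y hxy).2.trans (by
    gcongr
    exact le_max_left _ _)
  have h4 : (w x y : ℝ) ≤ γ'' * (x.length : ℝ) ^ e := (hw x y hxy).2.trans (by
    gcongr
    exact le_max_right _ _)
  calc (x.length : ℝ) ^ a ≤ γ * u x y := (hu x y hxy).1
    _ ≤ γ * (k * (γ' * (x.length : ℝ) ^ e + γ'' * (x.length : ℝ) ^ e)) := by
      gcongr
      exact h2.trans (by gcongr)
    _ = _ := by ring

theorem le_of_rate (hI : ∀ n : ℕ, ∃ x y, (x, y) ∈ I ∧ n < x.length) (hu : Rate I a u)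
    (hv : Rate I b v) (k : ℕ) (h : ∀ x y, (x, y) ∈ I → u x y ≤ k * v x y) : a ≤ b := by
  simpa using le_max_of_rate hI hu hv hv k fun x y hxy => (h x y hxy).trans
    (Nat.mul_le_mul_left _ (Nat.le_add_left _ _))

theorem Rate.mul (hI : ∀ x y, (x, y) ∈ I → 1 ≤ x.length) (hu : Rate I a u) (hv : Rate I b v) :
    Rate I (a + b) fun x y => u x y * v x y := by
  obtain ⟨γ, hγ, hu⟩ := hu
  obtain ⟨γ', hγ', hv⟩ := hv
  refine ⟨γ * γ', by positivity, fun x y hxy => ?_⟩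
  have hx : (0 : ℝ) < x.length := by exact_mod_cast hI x y hxy
  obtain ⟨h1, h2⟩ := hu x y hxy
  obtain ⟨h3, h4⟩ := hv x y hxy
  push_cast
  rw [Real.rpow_add hx]
  constructor
  · rw [mul_mul_mul_comm]
    exact mul_le_mul h1 h3 (by positivity) (by positivity)
  · rw [mul_mul_mul_comm]
    exact mul_le_mul h2 h4 (by positivity) (by positivity)

end Rate

theorem feasible_of_nonTrivial {α : Param → ℝ} (hα : ∀ p, 0 ≤ α p) (hnt : NonTrivial α) :
    Feasible α := by
  obtain ⟨γ, hγ, hinf⟩ := hnt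
  set I := {J ∈ exactInstances γ α | 1 ≤ J.1.length} with hI
  have hlarge : ∀ n : ℕ, ∃ x y, (x, y) ∈ I ∧ n < x.length := by
    intro n
    by_contra! hc
    refine hinf ((finite_stringPairs n).subset ?_)
    rintro ⟨x, y⟩ h
    refine ⟨h.1, ?_⟩
    by_contra! h'
    simp only at h'
    exact absurd (hc x y ⟨h, by simp only; omega⟩) (by omega)
  have hpos : ∀ x y, (x, y) ∈ I → 1 ≤ x.length := fun x y h => h.2
  have hR : ∀ p : Param, Rate I (α p) p.val := fun p => ⟨γ, by linarith, fun x y h => by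
    have := h.1.2 p
    rw [div_le_iff₀ (by linarith), mul_comm] at this
    exact ⟨this.1, this.2.trans (mul_comm _ _).le⟩⟩
  have hn : Rate I 1 fun x _ => x.length := ⟨1, one_pos, fun x y _ => by simp⟩
  -- A parameter of a non-empty exact instance is an integer that is at least n^α_p/γ > 0.
  have hV : ∀ p : Param, ∀ x y, (x, y) ∈ I → 1 ≤ p.val x y := by
    intro p x y h
    have hx : (0 : ℝ) < x.length := by exact_mod_cast h.2
    have h1 : (0 : ℝ) < (x.length : ℝ) ^ α p / γ := by positivity
    have : (0 : ℝ) < p.val x y := h1.trans_le (h.1.2 p).1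
    exact_mod_cast this
  have mul := @Rate.mul I
  have key : ∀ {a b : ℝ} {u v : List ℕ → List ℕ → ℕ} (k : ℕ), Rate I a u → Rate I b v →
      (∀ x y s, OnAlphabet s x y → (x, y) ∈ I → u x y ≤ k * v x y) → a ≤ b := by
    intro a b u v k hu hv h
    refine le_of_rate hlarge hu hv k fun x y hxy => ?_
    obtain ⟨s, hs⟩ := hxy.1.1.2
    exact h x y s ⟨hxy.1.1.1, hs⟩ hxy
  exact
  { nonneg := hα
    m_le := key 1 (hR .m) hn fun x y s h _ => by simpa [Param.val] using h.1
    L_le := key 1 (hR .L) (hR .m) fun x y s h _ => by simpa [Param.val] using lcsLen_le_right x y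
    smallDelta_le := key 1 (hR .smallDelta) (hR .m) fun x y s h _ => by simp [Param.val]
    smallDelta_le' := key 1 (hR .smallDelta) (hR .bigDelta) fun x y s h _ => by
      have := h.1; simp only [Param.val]; omega
    bigDelta_le := key 1 (hR .bigDelta) hn fun x y s h _ => by simp [Param.val]
    one_le := le_max_of_rate hlarge hn (hR .L) (hR .bigDelta) 1 fun x y _ => by
      simp only [Param.val]; omega
    m_le' := le_max_of_rate hlarge (hR .m) (hR .L) (hR .smallDelta) 1 fun x y _ => by
      simp only [Param.val]; omega
    sigma_le := key 1 (hR .sigma) (hR .m) fun x y s h _ => by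
      simp only [Param.val, alphabetSize_eq h.2.1 h.2.2, one_mul]
      exact size_le_length h.2.2
    sigma_le' := key 1 (hR .sigma) (hR .d) fun x y s h _ => by
      simpa [Param.val] using alphabetSize_le_dominantPairs x y
    L_le' := key 1 (hR .L) (hR .d) fun x y s h _ => by
      simpa [Param.val] using lcsLen_le_dominantPairs x y
    d_le := key 1 (hR .d) (hR .M) fun x y s h _ => by
      simpa [Param.val] using dominantPairs_le_matchingPairs x y
    d_le_add := key 1 (hR .d) (mul hpos (hR .L) (hR .m)) fun x y s h _ => by
      simpa [Param.val] using dominantPairs_le_mul_length x y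
    -- Since Δ ≥ 1, the bound 2m(Δ + 1) is at most 4mΔ.
    d_le_add' := key 4 (hR .d) (mul hpos (hR .m) (hR .bigDelta)) fun x y s h hI => by
      have h1 := dominantPairs_le_mul_delta h.1
      have h2 := hV .bigDelta x y hI
      simp only [Param.val] at h2 ⊢
      refine h1.trans ?_
      calc 2 * y.length * (x.length - lcsLen x y + 1)
          ≤ 2 * y.length * (2 * (x.length - lcsLen x y)) := Nat.mul_le_mul_left _ (by omega)
        _ = _ := by ring
    d_le_add_sigma := by
      rw [two_mul, add_assoc]
      refine key 1 (hR .d) (mul hpos (hR .L) (mul hpos (hR .L) (hR .sigma))) fun x y s h _ => ?_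
      simp only [Param.val, alphabetSize_eq h.2.1 h.2.2, one_mul]
      exact dominantPairs_le_sq_mul fun a ha => (h.2.1 a).1 ha
    one_le_M := key 1 hn (hR .M) fun x y s h _ => by
      simpa [Param.val] using length_le_matchingPairs fun a ha => (h.2.2 a).2 ((h.2.1 a).1 ha)
    L_le_add := by
      rw [two_mul]
      refine key 1 (mul hpos (hR .L) (hR .L)) (mul hpos (hR .sigma) (hR .M)) fun x y s h _ => ?_
      simp only [Param.val, alphabetSize_eq h.2.1 h.2.2, one_mul, ← pow_two]
      exact lcsLen_sq_le fun a ha => (h.2.1 a).1 ha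
    M_le := key 2 (hR .M) (mul hpos (hR .L) hn) fun x y s h _ => by
      have := matchingPairs_le h.1 (fun a ha => (h.2.1 a).1 ha) fun a ha => (h.2.2 a).1 ha
      rwa [mul_assoc] at this }

/-! ### Padded instances -/

theorem exists_forall_param {P : Param → ℝ → Prop} (hmono : ∀ p c c', c ≤ c' → P p c → P p c')
    (h : ∀ p, ∃ c, P p c) : ∃ c : ℝ, 1 ≤ c ∧ ∀ p, P p c := by
  choose c hc using h
  have le : ∀ p, c p ≤ 1 + (|c .m| + |c .L| + |c .smallDelta| + |c .bigDelta| + |c .sigma| +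
      |c .M| + |c .d|) := by
    intro p
    have h1 := fun q => abs_nonneg (c q)
    have h2 := le_abs_self (c p)
    cases p <;> linarith [h1 .m, h1 .L, h1 .smallDelta, h1 .bigDelta, h1 .sigma, h1 .M, h1 .d]
  exact ⟨_, le_add_of_nonneg_right (by positivity), fun p => hmono p _ _ (le p) (hc p)⟩

/-- The padding alone provides the lower bounds, and the instance adds at most γ·N^α_p. As the total
length is Θ(N), powers of N may be replaced by powers of the length. Taking `max n 1` for N covers n
= 0. -/
theorem exists_exact_of_closure {α : Param → ℝ} {f : Param → ℕ → ℕ} (h : Feasible α)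
    (hf : ∀ p, UB (α p) (f p)) (hf' : ∀ p, LB (α p) (f p)) {γ : ℝ} (hγ : 1 ≤ γ) :
    ∃ γ' : ℝ, 1 ≤ γ' ∧ ∃ K : ℕ, ∀ n x y, (n, x, y) ∈ closureInstances γ α →
      ((padOf α f (max n 1)).X x, (padOf α f (max n 1)).Y y) ∈ exactInstances γ' α ∧
      ((padOf α f (max n 1)).X x).length ≤ K * max n 1 := by
  obtain ⟨⟨c₂, hc₂, hX⟩, ⟨c₁, hc₁, hX'⟩, hval⟩ := padOf_bounds h hf hf'
  have hlen : ∀ N, ∀ x, ((padOf α f N).X x).length = ((padOf α f N).X []).length + x.length :=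
    fun N x => by rw [Pad.length_X, Pad.length_X, List.length_nil, add_zero]
  have hN : ∀ n : ℕ, (n : ℝ) ≤ (max n 1 : ℕ) := fun n => by exact_mod_cast le_max_left n 1
  have lenle : ∀ n x y, (n, x, y) ∈ closureInstances γ α →
      (((padOf α f (max n 1)).X x).length : ℝ) ≤ (c₂ + γ) * (max n 1 : ℕ) := by
    intro n x y hI
    have h1 := hX (max n 1) (le_max_right _ _)
    have h2 : (x.length : ℝ) ≤ γ * (max n 1 : ℕ) := hI.2.1.trans (mul_le_mul_of_nonneg_left (hN n) (by linarith))
    rw [Real.rpow_one] at h1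
    rw [hlen]
    push_cast at *
    linarith
  have lege : ∀ n x, c₁ * (max n 1 : ℕ) ≤ (((padOf α f (max n 1)).X x).length : ℝ) := by
    intro n x
    have h1 := hX' (max n 1) (le_max_right _ _)
    rw [Real.rpow_one] at h1
    refine h1.trans ?_
    rw [hlen]
    exact_mod_cast Nat.le_add_right _ _
  obtain ⟨γ', hγ', hp⟩ := exists_forall_param (P := fun p c => ∀ n x y,
      (n, x, y) ∈ closureInstances γ α →
      (((padOf α f (max n 1)).X x).length : ℝ) ^ α p ≤
        c * p.val ((padOf α f (max n 1)).X x) ((padOf α f (max n 1)).Y y) ∧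
      (p.val ((padOf α f (max n 1)).X x) ((padOf α f (max n 1)).Y y) : ℝ) ≤
        c * (((padOf α f (max n 1)).X x).length : ℝ) ^ α p)
    (fun p c c' hcc hc n x y hI => ⟨(hc n x y hI).1.trans (by gcongr),
      (hc n x y hI).2.trans (by gcongr)⟩) (by
    intro p
    obtain ⟨⟨c₄, hc₄, hU⟩, c₃, hc₃, hL⟩ := hval p
    -- The first summand serves the lower bound on the parameter (length at most (c₂ + γ)·N, value
    -- at least c₃·N^α_p), the second the upper bound (value at most (c₄ + γ)·N^α_p, length at least
    -- c₁·N).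
    refine ⟨(c₂ + γ) ^ α p / c₃ + (c₄ + γ) / c₁ ^ α p, fun n x y hI => ?_⟩
    have hN1 : 1 ≤ max n 1 := le_max_right _ _
    have hnN := hN n
    have l1 := lenle n x y hI
    have l2 := lege n x
    obtain ⟨s, hs⟩ := hI.1.2
    rw [Pad.val_eq (padOf_valid hf' hN1) ⟨hI.1.1, hs⟩ p]
    set N := max n 1
    set ℓ := ((padOf α f N).X x).length
    have hap := h.nonneg p
    have hNa : (0 : ℝ) < (N : ℝ) ^ α p := Real.rpow_pos_of_pos (by exact_mod_cast hN1) _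
    have e1 : (ℓ : ℝ) ^ α p ≤ (c₂ + γ) ^ α p * (N : ℝ) ^ α p := by
      rw [← Real.mul_rpow (by positivity) (by positivity)]
      gcongr
    have e2 : c₁ ^ α p * (N : ℝ) ^ α p ≤ (ℓ : ℝ) ^ α p := by
      rw [← Real.mul_rpow (by positivity) (by positivity)]
      gcongr
    have e3 := hL N hN1
    have e4 := hU N hN1
    have e5 : (p.val x y : ℝ) ≤ γ * (N : ℝ) ^ α p := (hI.2.2 p).trans (by gcongr)
    have e6 : (0 : ℝ) ≤ p.val x y := Nat.cast_nonneg _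
    have hc1 : (0 : ℝ) < c₁ ^ α p := Real.rpow_pos_of_pos hc₁ _
    push_cast
    constructor
    · calc (ℓ : ℝ) ^ α p ≤ (c₂ + γ) ^ α p * (N : ℝ) ^ α p := e1
        _ = (c₂ + γ) ^ α p / c₃ * (c₃ * (N : ℝ) ^ α p) := by field_simp
        _ ≤ _ := by
          gcongr
          · exact le_add_of_nonneg_right (by positivity)
          · linarith
    · calc ((padOf α f N).val p : ℝ) + p.val x y ≤ (c₄ + γ) * (N : ℝ) ^ α p := by linarith
        _ = (c₄ + γ) / c₁ ^ α p * (c₁ ^ α p * (N : ℝ) ^ α p) := by field_simp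
        _ ≤ _ := by
          gcongr
          exact le_add_of_nonneg_left (by positivity))
  refine ⟨γ', hγ', ⌈c₂ + γ⌉₊, fun n x y hI => ⟨⟨?_, fun p => ?_⟩, ?_⟩⟩
  · obtain ⟨s, hs⟩ := hI.1.2
    exact (Pad.onAlphabet (padOf_valid hf' (le_max_right n 1)) ⟨hI.1.1, hs⟩).isStringPair
  · obtain ⟨h1, h2⟩ := hp p n x y hI
    rw [div_le_iff₀ (by linarith)]
    exact ⟨h1.trans (mul_comm _ _).le, h2.trans (mul_comm _ _).le⟩
  · have := (lenle n x y hI).trans (mul_le_mul_of_nonneg_right (Nat.le_ceil (c₂ + γ))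
      (Nat.cast_nonneg _))
    exact_mod_cast this

/-! ### Writing padded instances -/

/-- This describes periodic strings by index modulo period, the form in which the driver writes
segments. -/
theorem rep_eq_map {w : List ℕ} {t : ℕ} (hw : w.length = t) (S : ℕ) :
    rep S w = (List.range (S * t)).map fun i => w.getD (i % t) 0 := by
  subst hw
  rcases Nat.eq_zero_or_pos w.length with h | h
  · rw [List.length_eq_zero_iff.1 h]
    induction S with
    | zero => rfl
    | succ S ih => rw [rep_succ, ih]; simp
  induction S with
  | zero => simp
  | succ S ih =>
    rw [rep_succ', ih, Nat.add_mul, one_mul, List.range_add, List.map_append, List.map_map]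
    congr 1
    refine List.ext_getElem (by simp) fun i h1 h2 => ?_
    simp only [List.getElem_map, List.getElem_range, Function.comp]
    rw [Nat.mul_add_mod_self_right, Nat.mod_eq_of_lt h1, List.getD_eq_getElem _ _ h1]

theorem map_rep_range (b S t : ℕ) :
    (rep S (List.range t)).map (· + b) = (List.range (S * t)).map fun i => b + i % t := by
  rcases Nat.eq_zero_or_pos t with rfl | ht
  · rw [rep_eq_map (w := List.range 0) (t := 0) rfl]; simp
  rw [rep_eq_map (List.length_range), List.map_map]
  refine List.map_congr_left fun i _ => ?_
  have := Nat.mod_lt i ht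
  simp only [Function.comp]
  rw [List.getD_eq_getElem _ _ (by simpa using this), List.getElem_range, add_comm]

theorem map_rep_reverse_range (b S t : ℕ) :
    (rep S (List.range t).reverse).map (· + b) =
      (List.range (S * t)).map fun i => b + t - 1 - i % t := by
  rcases Nat.eq_zero_or_pos t with rfl | ht
  · rw [rep_eq_map (w := (List.range 0).reverse) (t := 0) rfl]; simp
  rw [rep_eq_map (t := t) (by simp), List.map_map]
  refine List.map_congr_left fun i _ => ?_
  have := Nat.mod_lt i ht
  simp only [Function.comp]
  rw [List.getD_eq_getElem _ _ (by simpa using this), List.getElem_reverse, List.getElem_range,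
    List.length_range]
  omega

theorem replicate_eq_map (n b : ℕ) :
    List.replicate n b = (List.range n).map fun i => b + i % 1 := by
  simp [Nat.mod_one]

/-- Code that stores the value of the function computed by `P` at variable `9` in variable `d`. -/
def paramBlock (d r : ℕ) (P : Program) : Block :=
  (openBlock r).seq <| (cmdsBlock [.seg 2 (.up 9 2)]).seq <| callBlock d r P

theorem le_growth (f : Block) {M A : ℕ} (h : M ≤ A) : M ≤ A ^ f.growth :=
  h.trans (Nat.le_self_pow f.pos.ne' _)

theorem paramBlock_spec {inp : List ℕ} {r d M W t v : ℕ} {ρ : ℕ → ℕ} {s : Store} {P : Program}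
    (hr : 1 ≤ r) (hr9 : r < 9) (hd : 12 < d) (hM : 10 ≤ M) (hW : W ≤ M) (hs : s.LE M)
    (hb : Base inp r ρ s) (hhalt : P.length ≤ (run P [ρ 9] t).pc)
    (hv : (run P [ρ 9] t).reg 0 = v) (hle : ∀ u ≤ t, (run P [ρ 9] u).WordsLE W) :
    (paramBlock d r P).Spec M (3 * t + 18) s (Base inp (r + 1) (Function.update ρ d v)) := by
  refine ((open_spec hr hr9 hM hs hb).seq (by omega) (T₂ := 14 + (3 * t + 1)) ?_).imp (by omega)
    fun _ h => h
  rintro s₂ hs₂ ⟨hb2, ht2⟩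
  have m2 := le_growth (openBlock r) (le_refl M)
  have h1 := hb2.one
  refine ((cmds_spec hr hr9 (hM.trans m2) hs₂ hb2 ht2 (by simp [Cmd.Ok, Gen.Ok])
    (by simp [cmdsLegal, Cmd.Legal, Gen.Legal])).imp (T' := 14) ?_ fun _ h => h).seq (by omega) ?_
  · simp [cmdsExec, Cmd.exec, h1]
  rintro s₃ hs₃ ⟨hb3, ht3⟩
  have m3 := le_growth (cmdsBlock [.seg 2 (.up 9 2)]) m2
  have e : cmdsExec inp [.seg 2 (.up 9 2)] ([], ρ) = ([ρ 9], ρ) := by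
    simp [cmdsExec, Cmd.exec, h1, Gen.value]
  rw [e] at hb3 ht3
  subst hv
  refine call_spec hr hr9 hd (hM.trans m3) hs₃ hb3 ht3 hhalt fun u hu => ?_
  have := hle u hu
  exact ⟨fun i => (this.1 i).trans (hW.trans m3), fun i => (this.2 i).trans (hW.trans m3)⟩

/-- Computing `t, S, R` of the main block and its contribution to the common subsequence. -/
noncomputable def mainCmds (α : Param → ℝ) : List Cmd :=
  open scoped Classical in
  [.const 27 2, .const 28 3, .op .mul 29 21 21] ++
  (if α .d ≤ 2 * α .L then
    [.op .div 29 29 25, .op .add 14 29 27, .op .div 15 21 14, .op .add 15 15 2,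
      .op .div 16 26 21, .op .add 16 16 2, .op .mul 30 15 14, .op .add 31 30 1]
  else
    [.op .div 29 26 29, .op .add 14 29 28, .op .add 15 21 1, .op .add 16 21 1, .op .mul 30 15 14,
      .op .mul 31 27 15, .op .sub 31 31 2])

/-- Computing the sizes of the other blocks. -/
noncomputable def restCmds (α : Param → ℝ) : List Cmd :=
  open scoped Classical in
  [.op .add 13 23 22, .op .add 17 24 27, .op .add 32 (if α .sigma ≤ α .L then 17 else 2) 1] ++
  (if α .L < 1 then [.op .add 18 9 1, .op .div 19 25 9, .op .add 19 19 2]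
  else [.op .add 18 1 1, .op .add 19 2 1])

/-- Computing offsets and lengths. -/
def totalCmds : List Cmd :=
  [.op .add 33 31 32, .op .add 33 33 19, .op .add 33 33 2, .op .add 34 27 14, .op .add 35 34 17,
    .op .add 36 35 2, .op .add 38 18 19, .op .add 37 13 2, .op .add 37 37 16, .op .add 37 37 30,
    .op .add 37 37 17, .op .add 37 37 38, .op .add 37 37 10, .op .add 39 22 2, .op .add 39 39 30,
    .op .add 39 39 17, .op .add 39 39 19, .op .add 39 39 11, .op .add 40 28 1, .op .add 41 40 10,
    .op .sub 42 34 2, .op .sub 43 35 2]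

/-- Computing all data of the padding: variables `21, …, 26` contain the target values of
`L, δ, Δ, |Σ|, M, d`. -/
noncomputable def padCmds (α : Param → ℝ) : List Cmd := mainCmds α ++ (restCmds α ++ totalCmds)

/-- The variables after `padCmds`. -/
structure PadVars (D : Pad) (lx ly : ℕ) (ρ : ℕ → ℕ) : Prop where
  v1 : ρ 1 = 0
  v2 : ρ 2 = 1
  v10 : ρ 10 = lx
  v11 : ρ 11 = ly
  v12 : ρ 12 = lx + ly + 3
  v13 : ρ 13 = D.a
  v14 : ρ 14 = D.t
  v16 : ρ 16 = D.R
  v17 : ρ 17 = D.k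
  v19 : ρ 19 = D.S'
  v22 : ρ 22 = D.b
  v27 : ρ 27 = 2
  v30 : ρ 30 = D.S * D.t
  v33 : ρ 33 = D.lcs
  v34 : ρ 34 = 2 + D.t
  v35 : ρ 35 = 2 + D.t + D.k
  v36 : ρ 36 = 2 + D.t + D.k + 1
  v37 : ρ 37 = D.a + 1 + D.R + D.S * D.t + D.k + (D.R' + D.S') + lx
  v38 : ρ 38 = D.R' + D.S'
  v39 : ρ 39 = D.b + 1 + D.S * D.t + D.k + D.S' + ly
  v40 : ρ 40 = 3
  v41 : ρ 41 = 3 + lx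
  v42 : ρ 42 = 2 + D.t - 1
  v43 : ρ 43 = 2 + D.t + D.k - 1

theorem cmdsExec_append (inp : List ℕ) (cs cs' : List Cmd) (s : List ℕ × (ℕ → ℕ)) :
    cmdsExec inp (cs ++ cs') s = cmdsExec inp cs' (cmdsExec inp cs s) := List.foldl_append ..

section PadCmds
variable (α : Param → ℝ) (f : Param → ℕ → ℕ) (inp l : List ℕ) {N : ℕ} {ρ : ℕ → ℕ}

theorem cmdsExec_mainCmds (h1 : ρ 1 = 0) (h2 : ρ 2 = 1) (h21 : ρ 21 = f .L N)
    (h25 : ρ 25 = f .M N) (h26 : ρ 26 = f .d N) :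
    ∃ ρ', cmdsExec inp (mainCmds α) (l, ρ) = (l, ρ') ∧
      (∀ v, v < 14 ∨ (16 < v ∧ v < 27) → ρ' v = ρ v) ∧ ρ' 27 = 2 ∧ ρ' 28 = 3 ∧
      ρ' 14 = (padOf α f N).t ∧ ρ' 16 = (padOf α f N).R ∧
      ρ' 30 = (padOf α f N).S * (padOf α f N).t ∧
      ρ' 31 = if (padOf α f N).up then (padOf α f N).S * (padOf α f N).t
        else 2 * (padOf α f N).S - 1 := by
  by_cases hA : α .d ≤ 2 * α .L <;>
  · simp only [mainCmds, hA, if_true, if_false, List.cons_append, List.nil_append]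
    refine ⟨_, rfl, fun v hv => ?_, ?_⟩
    · have : v ≠ 14 ∧ v ≠ 15 ∧ v ≠ 16 ∧ v ≠ 27 ∧ v ≠ 28 ∧ v ≠ 29 ∧ v ≠ 30 ∧ v ≠ 31 := by omega
      simp [Cmd.exec, this]
    · simp [padOf, hA, Cmd.exec, BinOp.eval, h1, h2, h21, h25, h26]

theorem cmdsExec_restCmds (h1 : ρ 1 = 0) (h2 : ρ 2 = 1) (h9 : ρ 9 = N)
    (h22 : ρ 22 = f .smallDelta N) (h23 : ρ 23 = f .bigDelta N) (h24 : ρ 24 = f .sigma N)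
    (h25 : ρ 25 = f .M N) (h27 : ρ 27 = 2) :
    ∃ ρ', cmdsExec inp (restCmds α) (l, ρ) = (l, ρ') ∧
      (∀ v, v < 13 ∨ (13 < v ∧ v < 17) ∨ (19 < v ∧ v < 32) → ρ' v = ρ v) ∧
      ρ' 13 = (padOf α f N).a ∧ ρ' 17 = (padOf α f N).k ∧ ρ' 18 = (padOf α f N).R' ∧
      ρ' 19 = (padOf α f N).S' ∧
      ρ' 32 = if (padOf α f N).up' then (padOf α f N).k else 1 := by
  by_cases hB : α .sigma ≤ α .L <;> by_cases hC : α .L < 1 <;>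
  · simp only [restCmds, hB, hC, if_true, if_false, List.cons_append, List.nil_append]
    refine ⟨_, rfl, fun v hv => ?_, ?_⟩
    · have : v ≠ 13 ∧ v ≠ 17 ∧ v ≠ 18 ∧ v ≠ 19 ∧ v ≠ 32 := by omega
      simp [Cmd.exec, this]
    · simp [padOf, hB, hC, Cmd.exec, BinOp.eval, h1, h2, h9, h22, h23, h24,
        h25, h27]

theorem cmdsExec_totalCmds {D : Pad} {lx ly : ℕ} (h1 : ρ 1 = 0) (h2 : ρ 2 = 1) (h10 : ρ 10 = lx)
    (h11 : ρ 11 = ly) (h13 : ρ 13 = D.a) (h14 : ρ 14 = D.t) (h16 : ρ 16 = D.R) (h17 : ρ 17 = D.k)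
    (h18 : ρ 18 = D.R') (h19 : ρ 19 = D.S') (h22 : ρ 22 = D.b) (h27 : ρ 27 = 2) (h28 : ρ 28 = 3)
    (h30 : ρ 30 = D.S * D.t) (h31 : ρ 31 = if D.up then D.S * D.t else 2 * D.S - 1)
    (h32 : ρ 32 = if D.up' then D.k else 1) :
    ∃ ρ', cmdsExec inp totalCmds (l, ρ) = (l, ρ') ∧ (∀ v < 33, ρ' v = ρ v) ∧
      ρ' 33 = D.lcs ∧ ρ' 34 = 2 + D.t ∧ ρ' 35 = 2 + D.t + D.k ∧ ρ' 36 = 2 + D.t + D.k + 1 ∧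
      ρ' 37 = D.a + 1 + D.R + D.S * D.t + D.k + (D.R' + D.S') + lx ∧ ρ' 38 = D.R' + D.S' ∧
      ρ' 39 = D.b + 1 + D.S * D.t + D.k + D.S' + ly ∧ ρ' 40 = 3 ∧ ρ' 41 = 3 + lx ∧
      ρ' 42 = 2 + D.t - 1 ∧ ρ' 43 = 2 + D.t + D.k - 1 := by
  refine ⟨_, rfl, fun v hv => ?_, ?_⟩
  · have : v ≠ 33 ∧ v ≠ 34 ∧ v ≠ 35 ∧ v ≠ 36 ∧ v ≠ 37 ∧ v ≠ 38 ∧ v ≠ 39 ∧ v ≠ 40 ∧ v ≠ 41 ∧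
      v ≠ 42 ∧ v ≠ 43 := by omega
    simp [Cmd.exec, this]
  · simp [Cmd.exec, BinOp.eval, h1, h2, h10, h11, h13, h14, h16,
      h17, h18, h19, h22, h27, h28, h30]
    rw [h31, h32, Pad.lcs]
    ring

theorem cmdsExec_padCmds {lx ly : ℕ} (h1 : ρ 1 = 0) (h2 : ρ 2 = 1) (h9 : ρ 9 = N)
    (h10 : ρ 10 = lx) (h11 : ρ 11 = ly) (h12 : ρ 12 = lx + ly + 3) (h21 : ρ 21 = f .L N)
    (h22 : ρ 22 = f .smallDelta N) (h23 : ρ 23 = f .bigDelta N) (h24 : ρ 24 = f .sigma N)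
    (h25 : ρ 25 = f .M N) (h26 : ρ 26 = f .d N) :
    ∃ ρ', cmdsExec inp (padCmds α) (l, ρ) = (l, ρ') ∧ PadVars (padOf α f N) lx ly ρ' := by
  obtain ⟨ρ₁, e₁, k₁, a27, a28, a14, a16, a30, a31⟩ :=
    cmdsExec_mainCmds α f inp l h1 h2 h21 h25 h26
  obtain ⟨ρ₂, e₂, k₂, a13, a17, a18, a19, a32⟩ := cmdsExec_restCmds α f inp l (ρ := ρ₁)
    (by rw [k₁ _ (by omega), h1]) (by rw [k₁ _ (by omega), h2]) (by rw [k₁ _ (by omega), h9])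
    (by rw [k₁ _ (by omega), h22]) (by rw [k₁ _ (by omega), h23]) (by rw [k₁ _ (by omega), h24])
    (by rw [k₁ _ (by omega), h25]) a27
  have b1 : ρ₂ 1 = 0 := by rw [k₂ _ (by omega), k₁ _ (by omega), h1]
  have b2 : ρ₂ 2 = 1 := by rw [k₂ _ (by omega), k₁ _ (by omega), h2]
  have b10 : ρ₂ 10 = lx := by rw [k₂ _ (by omega), k₁ _ (by omega), h10]
  have b11 : ρ₂ 11 = ly := by rw [k₂ _ (by omega), k₁ _ (by omega), h11]
  have b12 : ρ₂ 12 = lx + ly + 3 := by rw [k₂ _ (by omega), k₁ _ (by omega), h12]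
  have b22 : ρ₂ 22 = (padOf α f N).b := by rw [k₂ _ (by omega), k₁ _ (by omega), h22]; rfl
  have b14 := (k₂ 14 (by omega)).trans a14
  have b16 := (k₂ 16 (by omega)).trans a16
  have b27 := (k₂ 27 (by omega)).trans a27
  have b30 := (k₂ 30 (by omega)).trans a30
  obtain ⟨ρ₃, e₃, k₃, a33, a34, a35, a36, a37, a38, a39, a40, a41, a42, a43⟩ :=
    cmdsExec_totalCmds inp l b1 b2 b10 b11 a13 b14 b16 a17 a18 a19 b22 b27
    ((k₂ _ (by omega)).trans a28) b30 ((k₂ _ (by omega)).trans a31) a32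
  refine ⟨ρ₃, ?_, ⟨?_, ?_, ?_, ?_, ?_, ?_, ?_, ?_, ?_, ?_, ?_, ?_, ?_, a33, a34, a35, a36, a37, a38,
    a39, a40, a41, a42, a43⟩⟩
  · rw [padCmds, cmdsExec_append, cmdsExec_append, e₁, e₂, e₃]
  all_goals
    rw [k₃ _ (by omega)]
    assumption

end PadCmds

/-- Writing the padded instance. -/
def padSegs (up up' : Bool) : List Cmd :=
  [.seg 2 (.up 37 2), .seg 2 (.up 39 2), .seg 2 (.up 1 2), .seg 13 (.up 2 2), .seg 16 (.up 27 2),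
    .seg 30 (.up 27 14), .seg 17 (.up 34 17), .seg 38 (.up 35 2), .seg 10 (.copy 40 36),
    .seg 2 (.up 2 2), .seg 22 (.up 1 2), .seg 30 (if up then .up 27 14 else .down 42 14),
    .seg 17 (if up' then .up 34 17 else .down 43 17), .seg 19 (.up 35 2), .seg 11 (.copy 41 36)]

theorem padSegs_ok (up up' : Bool) : ∀ c ∈ padSegs up up', c.Ok := by
  cases up <;> cases up' <;> simp [padSegs, Cmd.Ok, Gen.Ok]

theorem padCmds_ok (α : Param → ℝ) : ∀ c ∈ padCmds α, c.Ok := by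
  simp only [padCmds, mainCmds, restCmds, totalCmds]
  split_ifs <;> simp [Cmd.Ok, Instr.Plain]

theorem map_blockX (b R S t : ℕ) : (blockX R S t).map (· + b) =
    (List.range R).map (fun i => b + i % 1) ++ (List.range (S * t)).map fun i => b + i % t := by
  rw [blockX, List.map_append, map_rep_range, List.map_replicate, zero_add, replicate_eq_map]

theorem map_blockY (b S t : ℕ) (up : Bool) : (blockY up S t).map (· + b) =
    (List.range (S * t)).map fun i => if up then b + i % t else b + t - 1 - i % t := by
  cases up
  · simpa [blockY] using map_rep_reverse_range b S t
  · simpa [blockY] using map_rep_range b S t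

theorem map_glue (b s : ℕ) (u v : List ℕ) :
    (glue s u v).map (· + b) = u.map (· + b) ++ v.map (· + (b + s)) := by
  rw [glue, List.map_append, List.map_map]
  congr 1
  exact List.map_congr_left fun a _ => by simp only [Function.comp]; omega

theorem Pad.X_eq (D : Pad) (x : List ℕ) : D.X x = 0 :: (List.replicate D.a 1 ++
    ((List.range D.R).map (fun i => 2 + i % 1) ++ ((List.range (D.S * D.t)).map
      (fun i => 2 + i % D.t) ++ ((List.range D.k).map (fun i => 2 + D.t + i % D.k) ++
      ((List.range (D.R' + D.S')).map (fun i => 2 + D.t + D.k + i % 1) ++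
        x.map (· + (2 + D.t + D.k + 1))))))) := by
  rw [X, glue, map_glue, map_glue, map_glue, map_blockX, map_blockX, blockX_one,
    List.map_replicate, replicate_eq_map (D.R' + D.S')]
  simp

theorem Pad.Y_eq (D : Pad) (y : List ℕ) : D.Y y = 1 :: (List.replicate D.b 0 ++
    ((List.range (D.S * D.t)).map (fun i => if D.up then 2 + i % D.t else 2 + D.t - 1 - i % D.t) ++
      ((List.range D.k).map (fun i => if D.up' then 2 + D.t + i % D.k
        else 2 + D.t + D.k - 1 - i % D.k) ++
      ((List.range D.S').map (fun i => 2 + D.t + D.k + i % 1) ++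
        y.map (· + (2 + D.t + D.k + 1)))))) := by
  rw [Y, glue, map_glue, map_glue, map_glue, map_blockY, map_blockY, blockY_one,
    List.map_replicate, replicate_eq_map D.S']
  simp

/-- The tape is the encoding that the exact problem prescribes: two lengths, then both padded
strings. The original strings are copied from the input, where they start at cells 3 and 3 + |x|,
and shifted beyond the alphabet of the padding. -/
theorem cmdsExec_padSegs {D : Pad} {n : ℕ} {x y : List ℕ} {ρ : ℕ → ℕ}
    (h : PadVars D x.length y.length ρ) :
    cmdsExec (n :: x.length :: y.length :: (x ++ y)) (padSegs D.up D.up') ([], ρ) =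
      ((D.X x).length :: (D.Y y).length :: (D.X x ++ D.Y y), ρ) := by
  have hx : (List.range x.length).map (fun i =>
      (n :: x.length :: y.length :: (x ++ y)).getD (3 + i) 0 + (2 + D.t + D.k + 1)) =
      x.map (· + (2 + D.t + D.k + 1)) := by
    refine List.ext_getElem (by simp) fun i h1 h2 => ?_
    have : i < x.length := by simpa using h2
    simp only [List.getElem_map, List.getElem_range]
    rw [show 3 + i = i + 1 + 1 + 1 by omega, List.getD_cons_succ, List.getD_cons_succ,
      List.getD_cons_succ, List.getD_append _ _ _ _ this, List.getD_eq_getElem _ _ this]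
  have hy : (List.range y.length).map (fun i =>
      (n :: x.length :: y.length :: (x ++ y)).getD (3 + x.length + i) 0 + (2 + D.t + D.k + 1)) =
      y.map (· + (2 + D.t + D.k + 1)) := by
    have := map_range_getD_append (n :: x.length :: y.length :: x) y (2 + D.t + D.k + 1)
    simpa [add_comm, add_left_comm, add_assoc] using this
  obtain ⟨v1, v2, v10, v11, v12, v13, v14, v16, v17, v19, v22, v27, v30, v33, v34, v35, v36, v37,
    v38, v39, v40, v41, v42, v43⟩ := h
  set inp := n :: x.length :: y.length :: (x ++ y)
  have gu : ∀ b t, Gen.value inp ρ (.up b t) = fun i => ρ b + i % ρ t := fun _ _ => rfl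
  have gd : ∀ b t, Gen.value inp ρ (.down b t) = fun i => ρ b - i % ρ t := fun _ _ => rfl
  have gc : ∀ q b, Gen.value inp ρ (.copy q b) = fun i => inp.getD (ρ q + i) 0 + ρ b :=
    fun _ _ => rfl
  have e1 : (List.range 1) = [0] := rfl
  have lX : (D.X x).length = ρ 37 := by rw [Pad.length_X, v37]; omega
  have lY : (D.Y y).length = ρ 39 := by rw [Pad.length_Y, v39]; omega
  rw [lX, lY, Pad.X_eq, Pad.Y_eq, ← hx, ← hy, replicate_eq_map D.a, replicate_eq_map D.b]
  cases hu : D.up <;> cases hu' : D.up' <;>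
    simp only [padSegs, cmdsExec, List.foldl_cons, List.foldl_nil, Cmd.exec, if_true, if_false,
      Bool.false_eq_true, gu, gd, gc, v1, v2, v10, v11, v13, v14, v16, v17, v19, v22, v27, v30, v34,
      v35, v36, v38, v40, v41, v42, v43, e1, List.map_cons, List.map_nil, Nat.mod_one, add_zero,
      List.nil_append, List.cons_append, List.append_assoc]

theorem padSegs_legal {D : Pad} {x y inp : List ℕ} {ρ : ℕ → ℕ}
    (h : PadVars D x.length y.length ρ) : cmdsLegal inp (padSegs D.up D.up') ([], ρ) := by
  cases D.up <;> cases D.up' <;>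
    simp [padSegs, cmdsLegal, Cmd.Legal, Gen.Legal, Cmd.exec, h.v40, h.v41, h.v10, h.v11, h.v12] <;> omega

theorem cmdsLegal_append {inp : List ℕ} {cs cs' : List Cmd} {s : List ℕ × (ℕ → ℕ)} :
    cmdsLegal inp (cs ++ cs') s ↔ cmdsLegal inp cs s ∧ cmdsLegal inp cs' (cmdsExec inp cs s) := by
  induction cs generalizing s with
  | nil => simp [cmdsLegal, cmdsExec]
  | cons c cs ih => simp [cmdsLegal, ih, and_assoc, cmdsExec]

theorem padCmds_legal (α : Param → ℝ) (inp : List ℕ) (s : List ℕ × (ℕ → ℕ)) :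
    cmdsLegal inp (padCmds α) s := by
  simp only [padCmds, mainCmds, restCmds, totalCmds]
  split_ifs <;> simp [cmdsLegal, Cmd.Legal]

/-! ### The downward closure reduces to the exact problem -/

/-- Initialisation on an input `n, lx, ly, x, y`. -/
def closureInit : List Instr :=
  [.const 18 1, .const 27 9, .load 81 9, .op .sub 45 18 81, .op .add 81 81 45, .load 90 18,
    .const 45 2, .load 99 45, .op .add 108 90 99, .const 45 3, .op .add 108 108 45]

/-- Compute the target values by the programs `P p`, pad the instance, run `A` on it, and subtract
the contribution of the padding. -/
noncomputable def closureBlock (α : Param → ℝ) (up up' : Bool) (P : Param → Program)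
    (A : Program) : Block :=
  (Block.line closureInit).seq <| (paramBlock 21 1 (P .L)).seq <|
    (paramBlock 22 2 (P .smallDelta)).seq <| (paramBlock 23 3 (P .bigDelta)).seq <|
    (paramBlock 24 4 (P .sigma)).seq <| (paramBlock 25 5 (P .M)).seq <|
    (paramBlock 26 6 (P .d)).seq <| (openBlock 7).seq <|
    (cmdsBlock (padCmds α ++ padSegs up up')).seq <| (callBlock 50 7 A).seq <|
    Block.line [.op .sub 0 450 297]

theorem closureBlock_spec {α : Param → ℝ} {f : Param → ℕ → ℕ} {P : Param → Program} {A : Program}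
    {n M τ : ℕ} {x y : List ℕ} {t : Param → ℕ} (hM : 10 ≤ M)
    (hs : (initStore (n :: x.length :: y.length :: (x ++ y))).LE M)
    (hP : ∀ p, (P p).length ≤ (run (P p) [max n 1] (t p)).pc ∧
      (run (P p) [max n 1] (t p)).reg 0 = f p (max n 1) ∧
      ∀ u ≤ t p, (run (P p) [max n 1] u).WordsLE M)
    (hA : A.length ≤ (run A (((padOf α f (max n 1)).X x).length ::
        ((padOf α f (max n 1)).Y y).length ::
        ((padOf α f (max n 1)).X x ++ (padOf α f (max n 1)).Y y)) τ).pc ∧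
      ∀ u ≤ τ, (run A (((padOf α f (max n 1)).X x).length :: ((padOf α f (max n 1)).Y y).length ::
        ((padOf α f (max n 1)).X x ++ (padOf α f (max n 1)).Y y)) u).WordsLE M) :
    (closureBlock α (padOf α f 0).up (padOf α f 0).up' P A).Spec M
      (3 * (t .L + t .smallDelta + t .bigDelta + t .sigma + t .M + t .d + τ) +
        10 * (((padOf α f (max n 1)).X x).length + ((padOf α f (max n 1)).Y y).length) +
        4 * (padCmds α ++ padSegs (padOf α f 0).up (padOf α f 0).up').length + 150)
      (initStore (n :: x.length :: y.length :: (x ++ y))) fun s => s.1 0 =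
        (run A (((padOf α f (max n 1)).X x).length :: ((padOf α f (max n 1)).Y y).length ::
          ((padOf α f (max n 1)).X x ++ (padOf α f (max n 1)).Y y)) τ).reg 0 -
          (padOf α f (max n 1)).lcs := by
  set N := max n 1 with hN
  set D := padOf α f N with hD
  set inp := n :: x.length :: y.length :: (x ++ y) with hinp
  have hlen : inp.length = x.length + y.length + 3 := by simp [hinp]
  -- The directions of the runs depend on the exponents only, so the program is fixed in advance;
  -- size `0` is an arbitrary choice.
  have hup : (padOf α f 0).up = D.up := rfl
  have hup' : (padOf α f 0).up' = D.up' := rfl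
  rw [hup, hup']
  set len := (padCmds α ++ padSegs D.up D.up').length with hlen'
  have step : ∀ {p r d M' s ρ}, 1 ≤ r → r < 9 → 12 < d → M ≤ M' → s.LE M' → Base inp r ρ s →
      ρ 9 = N → (paramBlock d r (P p)).Spec M' (3 * t p + 18) s
        (Base inp (r + 1) (Function.update ρ d (f p N))) := by
    intro p r d M' s ρ hr hr9 hd hMM hs hb h9
    obtain ⟨h1, h2, h3⟩ := hP p
    exact paramBlock_spec hr hr9 hd (hM.trans hMM) hMM hs hb (by rwa [h9]) (by rwa [h9])
      (by rwa [h9])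
  refine Block.Spec.imp (T := 11 + ((3 * t .L + 18) + ((3 * t .smallDelta + 18) +
    ((3 * t .bigDelta + 18) + ((3 * t .sigma + 18) + ((3 * t .M + 18) + ((3 * t .d + 18) + (3 +
    ((10 * ((D.X x).length + (D.Y y).length + 2) + 4 * len) + ((3 * τ + 1) + 1)))))))))) ?_
    (by omega) fun _ h => h
  -- The initialisation obtains max n 1 as n + (1 - n) with truncated subtraction.
  refine (Block.line_spec (Q := fun s => Base inp 1 (fun v => s.1 (9 * v)) s ∧
      s.1 81 = N ∧ s.1 90 = x.length ∧ s.1 99 = y.length ∧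
      s.1 108 = x.length + y.length + 3) (by simp [closureInit, Instr.Plain])
    hM hs ?_).seq (by omega) ?_
  · refine ⟨Base.of_init rfl (fun i hi => ?_) ?_ ?_ ?_ ?_, ?_, ?_, ?_, ?_⟩
    · simp only [closureInit, lineAct_cons, lineAct_nil, act_const, act_op, act_load, initStore,
        Function.update_apply]
      repeat rw [if_neg (by omega)]
    all_goals simp [closureInit, initStore, BinOp.eval, hinp, hN]
    omega
  rintro s₁ hs₁ ⟨hb, e9, e10, e11, e12⟩
  have m1 := le_growth (Block.line closureInit) (le_refl M)
  have z1 : s₁.1 9 = 0 := hb.zero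
  have z2 : s₁.1 18 = 1 := hb.one
  set ρ₁ : ℕ → ℕ := fun v => s₁.1 (9 * v) with hρ
  refine (step le_rfl (by omega) (by omega) m1 hs₁ hb e9).seq (by omega) ?_
  intro s₂ hs₂ hb₂
  have m2 := le_growth (paramBlock 21 1 (P .L)) m1
  refine (step (by omega) (by omega) (by omega) m2 hs₂ hb₂ (by simpa using e9)).seq (by omega) ?_
  intro s₃ hs₃ hb₃
  have m3 := le_growth (paramBlock 22 2 (P .smallDelta)) m2
  refine (step (by omega) (by omega) (by omega) m3 hs₃ hb₃ (by simpa using e9)).seq (by omega) ?_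
  intro s₄ hs₄ hb₄
  have m4 := le_growth (paramBlock 23 3 (P .bigDelta)) m3
  refine (step (by omega) (by omega) (by omega) m4 hs₄ hb₄ (by simpa using e9)).seq (by omega) ?_
  intro s₅ hs₅ hb₅
  have m5 := le_growth (paramBlock 24 4 (P .sigma)) m4
  refine (step (by omega) (by omega) (by omega) m5 hs₅ hb₅ (by simpa using e9)).seq (by omega) ?_
  intro s₆ hs₆ hb₆
  have m6 := le_growth (paramBlock 25 5 (P .M)) m5
  refine (step (by omega) (by omega) (by omega) m6 hs₆ hb₆ (by simpa using e9)).seq (by omega) ?_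
  intro s₇ hs₇ hb₇
  have m7 := le_growth (paramBlock 26 6 (P .d)) m6
  refine (open_spec (by omega) (by omega) (hM.trans m7) hs₇ hb₇).seq (by omega) ?_
  rintro s₈ hs₈ ⟨hb₈, ht₈⟩
  have m8 := le_growth (openBlock 7) m7
  obtain ⟨ρ', eρ, hρ'⟩ := cmdsExec_padCmds α f inp [] (N := N) (lx := x.length) (ly := y.length)
    hb₈.zero hb₈.one (by simpa using e9) (by simpa using e10) (by simpa using e11)
    (by simpa using e12) (by simp) (by simp) (by simp) (by simp) (by simp) (by simp)
  have eρ' := cmdsExec_padSegs (D := D) (n := n) hρ'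
  rw [← eρ, ← cmdsExec_append] at eρ'
  refine ((cmds_spec (by omega) (by omega) (hM.trans m8) hs₈ hb₈ ht₈ ?_ ?_).imp (by
    rw [eρ']
    simp only [List.length_cons, List.length_append, List.length_nil, ← hlen']
    omega) fun _ h => h).seq (by omega) ?_
  · intro c hc
    rcases List.mem_append.1 hc with hc | hc
    · exact padCmds_ok α c hc
    · exact padSegs_ok _ _ c hc
  · rw [cmdsLegal_append, eρ]
    exact ⟨padCmds_legal _ _ _, padSegs_legal hρ'⟩
  rw [eρ']
  rintro s₉ hs₉ ⟨hb₉, ht₉⟩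
  have m9 := le_growth (cmdsBlock (padCmds α ++ padSegs D.up D.up')) m8
  refine (call_spec (by omega) (by omega) (by norm_num) (hM.trans m9) hs₉ hb₉ ht₉ hA.1
    fun u hu => ?_).seq (by omega) ?_
  · have := hA.2 u hu
    exact ⟨fun i => (this.1 i).trans m9, fun i => (this.2 i).trans m9⟩
  intro s₁₀ hs₁₀ hb₁₀
  have m10 := le_growth (callBlock 50 7 A) m9
  -- Registers `450` and `297` are the variables `50` and `33`: the answer for the padded pair and
  -- the LCS length of the padding.
  refine Block.line_spec (l := [.op .sub 0 450 297]) (by simp [Instr.Plain]) (hM.trans m10) hs₁₀ ?_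
  have h50 := hb₁₀.env 50 (by omega)
  have h33 := hb₁₀.env 33 (by omega)
  rw [Function.update_self] at h50
  rw [Function.update_of_ne (by norm_num)] at h33
  have h33' := h33.trans hρ'.v33
  simp only [lineAct_cons, lineAct_nil, act_op, BinOp.eval, Function.update_self]
  exact congrArg₂ _ h50 h33'

theorem closure_of_exact {α : Param → ℝ} {β γ : ℝ} (hβ : 1 ≤ β) (h : Feasible α)
    (hpc : ∀ p, PowerComputable β (α p)) (hγ : 1 ≤ γ)
    (hex : ∀ γ : ℝ, 1 ≤ γ → HasAlgorithm (exactLCS γ α) β) : HasAlgorithm (closureLCS γ α) β := by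
  choose f hf hP using hpc
  choose P Cp kp hP using hP
  have hU : ∀ p, UB (α p) (f p) := fun p => by
    obtain ⟨c, hc, h⟩ := hf p
    exact ⟨c, by linarith, fun N hN => (h N hN).2⟩
  have hL : ∀ p, LB (α p) (f p) := fun p => by
    obtain ⟨c, hc, h⟩ := hf p
    exact ⟨c⁻¹, by positivity, fun N hN => by
      rw [inv_mul_eq_div]; exact (h N hN).1⟩
  -- The constant γ' is uniform in the instances, so one program for the exact problem serves them
  -- all.
  obtain ⟨γ', hγ', K, hK⟩ := exists_exact_of_closure h hU hL hγ
  obtain ⟨A, C', k', hA⟩ := hex γ' hγ'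
  have bdd : ∀ g : Param → ℕ, ∃ c, ∀ p, g p ≤ c := fun g =>
    ⟨g .m + g .L + g .smallDelta + g .bigDelta + g .sigma + g .M + g .d, fun p => by
      cases p <;> omega⟩
  obtain ⟨Cs, hCs⟩ := bdd Cp
  obtain ⟨ks, hks⟩ := bdd kp
  set len := (padCmds α ++ padSegs (padOf α f 0).up (padOf α f 0).up').length with hlen
  set E := ⌈((K + 1 : ℕ) : ℝ) ^ β⌉₊ with hE
  -- For the time: six programs for target values, simulated at three steps each; the program `A` on
  -- strings of length at most (K + 1)·N, likewise; ten steps for each of at most 2KN symbols; and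
  -- overhead. The last two summands serve the word bounds.
  set C := 18 * Cs + 3 * (C' * E) + 20 * K + 4 * len + 150 + Cs + C' * (K + 1) ^ k' with hC
  refine (closureBlock α (padOf α f 0).up (padOf α f 0).up' P A).hasAlgorithm (C := C)
    (k := 1 + ks + k') ?_
  rintro ⟨⟨n, x, y⟩, hI⟩
  obtain ⟨hexact, hlenX⟩ := hK n x y hI
  obtain ⟨s, hs⟩ := hI.1.2
  have hxy : OnAlphabet s x y := ⟨hI.1.1, hs⟩
  have hval := Pad.val_eq (padOf_valid hL (le_max_right n 1)) hxy .L
  rw [Pad.val_L (padOf_valid hL (le_max_right n 1))] at hval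
  obtain ⟨τ, hτ, hhalt, hans, hw⟩ := hA ⟨_, hexact⟩
  have hX := Pad.length_X (D := padOf α f (max n 1)) x
  have hYX := hexact.1.1
  have hnN : n ≤ max n 1 := le_max_left n 1
  simp only [exactLCS, closureLCS] at hτ hhalt hans hw hYX ⊢
  have hrun : ∀ p, ∃ t : ℕ, (t : ℝ) ≤ Cs * (max n 1 : ℕ) ^ β ∧
      (P p).length ≤ (run (P p) [max n 1] t).pc ∧
      (run (P p) [max n 1] t).reg 0 = f p (max n 1) ∧
      ∀ u ≤ t, (run (P p) [max n 1] u).WordsLE (Cs * (max n 1) ^ ks) := by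
    intro p
    obtain ⟨t, h1, h2, h3, h4⟩ := hP p (max n 1)
    have hN1 : 1 ≤ max n 1 := le_max_right _ _
    simp only [max_eq_left hN1] at h1 h4
    refine ⟨t, h1.trans (by gcongr; exact hCs p), h2, h3, fun u hu => ?_⟩
    have hb : Cp p * (max n 1) ^ kp p ≤ Cs * (max n 1) ^ ks :=
      Nat.mul_le_mul (hCs p) (Nat.pow_le_pow_right hN1 (hks p))
    exact ⟨fun i => ((h4 u hu).1 i).trans hb, fun a => ((h4 u hu).2 a).trans hb⟩
  choose t ht hrun using hrun
  have hN1 : 1 ≤ max n 1 := le_max_right _ _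
  set N := max n 1 with hN
  set x' := (padOf α f N).X x with hx'
  set y' := (padOf α f N).Y y with hy'
  set M := C * N ^ (1 + ks + k') with hM
  have hxx : x.length ≤ x'.length := by omega
  have hNM : ∀ c, c ≤ C → c * N ≤ M := fun c hc =>
    Nat.mul_le_mul hc (Nat.le_self_pow (by omega) N)
  have hM1 : 150 * N ≤ M := hNM _ (by omega)
  have hM2 : K * N ≤ M := hNM _ (by omega)
  have hsM : Cs * N ^ ks ≤ M :=
    Nat.mul_le_mul (by omega) (Nat.pow_le_pow_right hN1 (by omega))
  have hmax : max x'.length 1 ≤ (K + 1) * N := by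
    rw [Nat.add_mul, one_mul]; exact max_le (by omega) (by omega)
  have hAM : C' * (max x'.length 1) ^ k' ≤ M := by
    calc C' * (max x'.length 1) ^ k' ≤ C' * ((K + 1) * N) ^ k' :=
          Nat.mul_le_mul_left _ (Nat.pow_le_pow_left hmax _)
      _ = C' * (K + 1) ^ k' * N ^ k' := by rw [mul_pow, mul_assoc]
      _ ≤ M := Nat.mul_le_mul (by omega) (Nat.pow_le_pow_right hN1 (by omega))
  have hτ' : (τ : ℝ) ≤ C' * E * (N : ℝ) ^ β := by
    refine hτ.trans ?_
    have h1 : ((max x'.length 1 : ℕ) : ℝ) ≤ ((K + 1 : ℕ) : ℝ) * N := by exact_mod_cast hmax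
    rw [mul_assoc]
    refine mul_le_mul_of_nonneg_left ?_ (Nat.cast_nonneg _)
    calc ((max x'.length 1 : ℕ) : ℝ) ^ β ≤ (((K + 1 : ℕ) : ℝ) * N) ^ β :=
          Real.rpow_le_rpow (Nat.cast_nonneg _) h1 (by linarith)
      _ = ((K + 1 : ℕ) : ℝ) ^ β * (N : ℝ) ^ β :=
          Real.mul_rpow (Nat.cast_nonneg _) (Nat.cast_nonneg _)
      _ ≤ _ := mul_le_mul_of_nonneg_right (Nat.le_ceil _) (by positivity)
  refine ⟨M, _, le_rfl, ?_, (closureBlock_spec (τ := τ) (t := t) (show 10 ≤ M by omega) ?_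
    (fun p => ⟨(hrun p).1, (hrun p).2.1, fun u hu => ?_⟩) ⟨hhalt, fun u hu => ?_⟩).imp le_rfl
    fun s hs => ?_⟩
  · have hNβ : (N : ℝ) ≤ (N : ℝ) ^ β := Real.self_le_rpow_of_one_le (by exact_mod_cast hN1) hβ
    have hN1' : (1 : ℝ) ≤ (N : ℝ) ^ β := Real.one_le_rpow (by exact_mod_cast hN1) (by linarith)
    have e1 : ((x'.length : ℝ) + y'.length) ≤ 2 * K * (N : ℝ) ^ β := by
      have : x'.length + y'.length ≤ 2 * K * N := by rw [mul_assoc]; omega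
      calc ((x'.length : ℝ) + y'.length) ≤ 2 * K * (N : ℝ) := by exact_mod_cast this
        _ ≤ _ := by gcongr
    have e2 : (4 * len + 150 : ℝ) ≤ (4 * len + 150) * (N : ℝ) ^ β :=
      le_mul_of_one_le_right (by positivity) hN1'
    have e3 : (0 : ℝ) ≤ (Cs + C' * (K + 1) ^ k') * (N : ℝ) ^ β := by positivity
    have t1 := ht .L
    have t2 := ht .smallDelta
    have t3 := ht .bigDelta
    have t4 := ht .sigma
    have t5 := ht .M
    have t6 := ht .d
    rw [hC, ← hlen]
    push_cast
    nlinarith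
  · refine initStore_le fun a ha => ?_
    simp only [List.mem_cons] at ha
    have := hI.1.1
    simp only at this
    rcases ha with rfl | rfl | rfl | ha
    · omega
    · omega
    · omega
    · have := hI.1.mem_lt ha
      simp only at this
      omega
  · have := (hrun p).2.2 u hu
    exact ⟨fun i => (this.1 i).trans hsM, fun a => (this.2 a).trans hsM⟩
  · have := hw u hu
    exact ⟨fun i => (this.1 i).trans hAM, fun a => (this.2 a).trans hAM⟩
  -- The machine returns the LCS length of the padded pair minus that of the padding, which is L(x,
  -- y) by additivity.
  · rw [hs, hans]
    simp only [Param.val] at hval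
    exact hval ▸ Nat.add_sub_cancel_left _ _

end LCSMono

/-! ### Both parts of the theorem -/

open LCSMono in
theorem mainTheorem6 (α : Param → ℝ) (hα : ∀ p, 0 ≤ α p) (hnt : NonTrivial α)
    (β : ℝ) (hβ : 1 ≤ β) :
    ((∀ γ : ℝ, 1 ≤ γ → HasAlgorithm (closureLCS γ α) β) →
      ∀ γ : ℝ, 1 ≤ γ → HasAlgorithm (exactLCS γ α) β) ∧
    ((∀ p, PowerComputable β (α p)) →
      ((∀ γ : ℝ, 1 ≤ γ → HasAlgorithm (exactLCS γ α) β) ↔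
        ∀ γ : ℝ, 1 ≤ γ → HasAlgorithm (closureLCS γ α) β)) := by
  have part₁ : (∀ γ : ℝ, 1 ≤ γ → HasAlgorithm (closureLCS γ α) β) →
      ∀ γ : ℝ, 1 ≤ γ → HasAlgorithm (exactLCS γ α) β := fun h γ hγ =>
    exact_of_closure hγ hβ (h γ hγ)
  exact ⟨part₁, fun hpc => ⟨fun h γ hγ =>
    closure_of_exact hβ (feasible_of_nonTrivial hα hnt) hpc hγ h, part₁⟩⟩
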